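/- **Conventions.** A *compact prop* is a strict symmetric monoidal category whose monoid of objects is $(\mathbb N,+)$, with arrows $\eta:0\to 2$ and $\epsilon:2\to 0$, invariant under the symmetry $\sigma_{1,1}$ and satisfying the two snake equations. An isomorphism of compact props is the identity on objects, bijective on arrows, and preserves identities, composition, tensor product $\oplus$, symmetries, $\eta$ and $\epsilon$. Composition is written in diagrammatic order: $f;g$ is first $f$, then $g$. **Gaussian relations.** For $n\in\mathbb N$ write elements of $\mathbb C^{2n}$ as $(z,x)$ with $z,x\in\mathbb C^n$, and let $\omega_n((z,x),(z',x'))=\sum_j (z_jx'_j-x_jz'_j)$ and $\chi_n((z,x),(z',x'))=\bar z^{T}x'+\bar x^{T}z'$. On $\mathbb C^{2n}\oplus\mathbb C^{2m}$ put $\omega_{n,m}((v_I,v_O),(w_I,w_O))=\omega_m(v_O,w_O)-\omega_n(v_I,w_I)$. A complex affine Lagrangian relation $n\to m$ is a subset of $\mathbb C^{2n}\oplus\mathbb C^{2m}$ that is empty or a translate $S+a$ of a Lagrangian subspace $S$ for $\omega_{n,m}$ (isotropic of dimension $n+m$). A Lagrangian $S$ is *quasi-real* if $i\,\omega_{n,m}(\bar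 v,v)\ge 0$ for all $v\in S$ and $\chi_m(v_O,w_O)-\chi_n(v_I,w_I)=0$ for all $v,w\in S$. An affine Lagrangian relation is quasi-real if it is empty or equal to $S+a$ with $S$ quasi-real and $a$ real with all its $x$-coordinates equal to $0$. With relational composition, the direct sum, the evident symmetries, $\eta=\{(\bullet,(z,z,x,-x))\}$ and $\epsilon=\{((z,z,x,-x),\bullet)\}$, where $(z,z,x,-x)$ denotes the vector with $z$-part $(z,z)$ and $x$-part $(x,-x)$, the complex affine Lagrangian relations form a compact prop, and the quasi-real ones form a sub-prop of it, $\mathsf{GaussRel}$. **Graphical Gaussian algebra.** $\mathsf{GAA}_{\mathbb R}$ is the compact prop presented by generators $G_{n,m}:n\to m$ (grey spiders), $W^a_{n,m}:n\to m$ for $a\in\mathbb R$ (white spiders) and $S_a:1\to1$ for $a\in\mathbb R$ (scalars), for all $n,m\in\mathbb N$, and the following equations for all $n,m,k,p,q\in\mathbb N$, $a,b\in\mathbb R$ and $c\in\mathbb R\setminus\{0\}$; here $W_{n,m}=W^0_{n,m}$, and $X_{n,m}$ stands for $G_{n,m}$ or $W^a_{n,m}$. * Flexsymmetry: $X_{n,p+2+q};(1_p\oplus\sigma_{1,1}\oplus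 1_q)=X_{n,p+2+q}$ and $(1_n\oplus\eta);(X_{n+1,m}\oplus 1_1)=X_{n,m+1}$. * Grey spiders: $G_{n,m+1};(1_m\oplus G_{1,k})=G_{n,m+k}$; $G_{1,2};G_{2,1}=1_1$; $G_{0,1};G_{1,0}=1_0$; $G_{1,1}=1_1$; $G_{0,2}=\eta$; $G_{2,0}=\epsilon$. * White spiders: $W^a_{n,m+1};(1_m\oplus(S_{-1};W^b_{1,k}))=W^{a+b}_{n,m+k}$; $W_{1,2};W_{2,1}=1_1$; $W_{0,1};W_{1,0}=1_0$; $W_{1,1}=S_{-1}$. * Interaction: $W_{2,1};G_{1,2}=(G_{1,2}\oplus G_{1,2});(1_1\oplus\sigma_{1,1}\oplus1_1);(W_{2,1}\oplus W_{2,1})$; $W_{2,1};G_{1,0}=G_{1,0}\oplus G_{1,0}$; $W^a_{0,1};G_{1,2}=W^a_{0,1}\oplus W^a_{0,1}$; $W^a_{0,1};G_{1,0}=1_0$. * Scalars: $S_1=1_1$; $S_0=G_{1,0};W_{0,1}$; $S_a;S_b=S_{ab}$; $G_{1,2};(S_a\oplus S_b);W_{2,1};S_{-1}=S_{a+b}$;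 $S_a;G_{1,2}=G_{1,2};(S_a\oplus S_a)$; $S_a;G_{1,0}=G_{1,0}$; $(S_a\oplus S_a);W_{2,1}=W_{2,1};S_a$; $W^b_{0,1};S_a=W^{ab}_{0,1}$; $(1_1\oplus\eta);(1_1\oplus S_c\oplus1_1);(\epsilon\oplus1_1)=S_{c^{-1}}$. * Inconsistency: $W^c_{0,0}\oplus1_1=W^c_{0,0}\oplus(G_{1,0};G_{0,1})$. $\mathsf{GGA}$ is the compact prop obtained from $\mathsf{GAA}_{\mathbb R}$ by adding one generator $\nu:0\to1$, the *vacuum*, and the equations, for all $n\in\mathbb N$, $v\in\mathbb R^n$ and $\theta\in[0,2\pi)$, $$\nu^{\oplus 2};R(\theta)=\nu^{\oplus 2},\qquad \nu^{\oplus n};(W^{v_1}_{1,0}\oplus\dots\oplus W^{v_n}_{1,0})=1_0,\qquad \nu^{\oplus n};G_{1,0}^{\oplus n}=1_0,$$ where $R(\theta):2\to2$ is the diagram of the rotation matrix, $$R(\theta)=(G_{1,2}\oplus G_{1,2});(S_{\cos\theta}\oplus S_{\sin\theta}\oplus S_{-\sin\theta}\oplus S_{\cos\theta});(1_1\oplus\sigma_{1,1}\oplus1_1);((W_{2,1};S_{-1})\oplus(W_{2,1};S_{-1})).$$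 **Theorem.** There is an isomorphism of compact props $\mathsf{GGA}\cong\mathsf{GaussRel}$. It can be chosen so that it acts on generators by * $G_{n,m}\mapsto\{((z,x),(z',x')) : \text{all } z_i, z'_j \text{ are equal, and } \sum_i x_i=\sum_j x'_j\}$, * $W^a_{n,m}\mapsto\{((z,x),(z',x')) : \sum_i z_i+\sum_j z'_j=a,\ \exists c\in\mathbb C:\ x_i=c \text{ and } x'_j=-c \text{ for all } i,j\}$, * $S_a\mapsto\{((z,x),(z',x')) : z'=az,\ x=ax'\}$, * $\nu\mapsto\{(\bullet,(z,x)) : z=ix\}$. -/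

import Mathlib

/-! ### Compact props -/

/-- Transport of an arrow along equalities of its source and target. -/
def castHom (H : ℕ → ℕ → Type) {n n' m m' : ℕ} (hn : n = n') (hm : m = m') (f : H n m) :
    H n' m' :=
  hm ▸ hn ▸ f

/-- A compact prop: a strict symmetric monoidal category whose monoid of objects is `(ℕ, +)`,
with a cup and a cap on a single wire.  Composition is written in diagrammatic order. -/
structure CompactProp where
  Hom : ℕ → ℕ → Type
  id (n : ℕ) : Hom n n
  comp {n m k : ℕ} : Hom n m → Hom m k → Hom n k
  tensor {n m n' m' : ℕ} : Hom n m → Hom n' m' → Hom (n + n') (m + m')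
  symm (n m : ℕ) : Hom (n + m) (m + n)
  cup : Hom 0 2
  cap : Hom 2 0
  id_comp {n m : ℕ} (f : Hom n m) : comp (id n) f = f
  comp_id {n m : ℕ} (f : Hom n m) : comp f (id m) = f
  comp_assoc {n m k l : ℕ} (f : Hom n m) (g : Hom m k) (h : Hom k l) :
    comp (comp f g) h = comp f (comp g h)
  tensor_id (n m : ℕ) : tensor (id n) (id m) = id (n + m)
  tensor_comp {n m k n' m' k' : ℕ} (f : Hom n m) (g : Hom m k) (f' : Hom n' m')
    (g' : Hom m' k') :
    tensor (comp f g) (comp f' g') = comp (tensor f f') (tensor g g')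
  tensor_assoc {n m n' m' n'' m'' : ℕ} (f : Hom n m) (g : Hom n' m') (h : Hom n'' m'') :
    castHom Hom (Nat.add_assoc n n' n'') (Nat.add_assoc m m' m'') (tensor (tensor f g) h) =
      tensor f (tensor g h)
  id_tensor {n m : ℕ} (f : Hom n m) :
    castHom Hom (Nat.zero_add n) (Nat.zero_add m) (tensor (id 0) f) = f
  tensor_id_zero {n m : ℕ} (f : Hom n m) : tensor f (id 0) = f
  symm_natural {n m n' m' : ℕ} (f : Hom n m) (g : Hom n' m') :
    comp (tensor f g) (symm m m') = comp (symm n n') (tensor g f)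
  symm_symm (n m : ℕ) : comp (symm n m) (symm m n) = id (n + m)
  hexagon (n m k : ℕ) :
    symm n (m + k) =
      comp (castHom Hom (Nat.add_assoc n m k) rfl (tensor (symm n m) (id k)))
        (castHom Hom (Nat.add_assoc m n k).symm (Nat.add_assoc m k n).symm
          (tensor (id m) (symm n k)))
  snake_left : comp (m := 3) (tensor cup (id 1)) (tensor (id 1) cap) = id 1
  snake_right : comp (m := 3) (tensor (id 1) cup) (tensor cap (id 1)) = id 1
  cup_symm : comp cup (symm 1 1) = cup
  symm_cap : comp (symm 1 1) cap = cap

/-- An isomorphism of compact props: identity on objects, bijective on arrows, and compatible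
with all of the structure. -/
structure CompactProp.Iso (P Q : CompactProp) where
  equiv (n m : ℕ) : P.Hom n m ≃ Q.Hom n m
  map_id (n : ℕ) : equiv n n (P.id n) = Q.id n
  map_comp {n m k : ℕ} (f : P.Hom n m) (g : P.Hom m k) :
    equiv n k (P.comp f g) = Q.comp (equiv n m f) (equiv m k g)
  map_tensor {n m n' m' : ℕ} (f : P.Hom n m) (g : P.Hom n' m') :
    equiv (n + n') (m + m') (P.tensor f g) = Q.tensor (equiv n m f) (equiv n' m' g)
  map_symm (n m : ℕ) : equiv (n + m) (m + n) (P.symm n m) = Q.symm n m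
  map_cup : equiv 0 2 P.cup = Q.cup
  map_cap : equiv 2 0 P.cap = Q.cap

theorem castHom_subtype {H : ℕ → ℕ → Type} (p : ∀ n m, H n m → Prop) {n n' m m' : ℕ}
    (hn : n = n') (hm : m = m') (f : {f : H n m // p n m f}) :
    (castHom (fun n m => {f : H n m // p n m f}) hn hm f).1 = castHom H hn hm f.1 := by
  subst hn hm; rfl

/-- The sub-prop of a compact prop determined by a class of arrows that contains the structure
and is closed under composition and tensor product. -/
def CompactProp.sub (P : CompactProp) (p : ∀ n m, P.Hom n m → Prop)
    (h_id : ∀ n, p n n (P.id n))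
    (h_comp : ∀ n m k (f : P.Hom n m) (g : P.Hom m k), p n m f → p m k g → p n k (P.comp f g))
    (h_tensor : ∀ n m n' m' (f : P.Hom n m) (g : P.Hom n' m'), p n m f → p n' m' g →
      p (n + n') (m + m') (P.tensor f g))
    (h_symm : ∀ n m, p (n + m) (m + n) (P.symm n m))
    (h_cup : p 0 2 P.cup) (h_cap : p 2 0 P.cap) : CompactProp where
  Hom n m := {f : P.Hom n m // p n m f}
  id n := ⟨P.id n, h_id n⟩
  comp f g := ⟨P.comp f.1 g.1, h_comp _ _ _ _ _ f.2 g.2⟩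
  tensor f g := ⟨P.tensor f.1 g.1, h_tensor _ _ _ _ _ _ f.2 g.2⟩
  symm n m := ⟨P.symm n m, h_symm n m⟩
  cup := ⟨P.cup, h_cup⟩
  cap := ⟨P.cap, h_cap⟩
  id_comp f := Subtype.ext (P.id_comp f.1)
  comp_id f := Subtype.ext (P.comp_id f.1)
  comp_assoc f g h := Subtype.ext (P.comp_assoc f.1 g.1 h.1)
  tensor_id n m := Subtype.ext (P.tensor_id n m)
  tensor_comp f g f' g' := Subtype.ext (P.tensor_comp f.1 g.1 f'.1 g'.1)
  tensor_assoc f g h := Subtype.ext (by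
    rw [castHom_subtype]; exact P.tensor_assoc f.1 g.1 h.1)
  id_tensor f := Subtype.ext (by rw [castHom_subtype]; exact P.id_tensor f.1)
  tensor_id_zero f := Subtype.ext (P.tensor_id_zero f.1)
  symm_natural f g := Subtype.ext (P.symm_natural f.1 g.1)
  symm_symm n m := Subtype.ext (P.symm_symm n m)
  hexagon n m k := Subtype.ext (by
    dsimp only
    rw [castHom_subtype, castHom_subtype]; exact P.hexagon n m k)
  snake_left := Subtype.ext P.snake_left
  snake_right := Subtype.ext P.snake_right
  cup_symm := Subtype.ext P.cup_symm
  symm_cap := Subtype.ext P.symm_cap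

/-! ### Compact props presented by generators and equations -/

/-- String diagrams over a family of generators, as formal terms. -/
inductive Diagram (G : ℕ → ℕ → Type) : ℕ → ℕ → Type
  | gen {n m : ℕ} (g : G n m) : Diagram G n m
  | id (n : ℕ) : Diagram G n n
  | comp {n m k : ℕ} (f : Diagram G n m) (g : Diagram G m k) : Diagram G n k
  | tensor {n m n' m' : ℕ} (f : Diagram G n m) (g : Diagram G n' m') :
      Diagram G (n + n') (m + m')
  | symm (n m : ℕ) : Diagram G (n + m) (m + n)
  | cup : Diagram G 0 2
  | cap : Diagram G 2 0

infixl:70 " ⨟ " => Diagram.comp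
infixl:75 " ⊕ₚ " => Diagram.tensor

/-- Renaming of generators. -/
def Diagram.map {G G' : ℕ → ℕ → Type} (φ : ∀ n m, G n m → G' n m) :
    ∀ {n m : ℕ}, Diagram G n m → Diagram G' n m
  | _, _, .gen g => .gen (φ _ _ g)
  | _, _, .id n => .id n
  | _, _, .comp f g => f.map φ ⨟ g.map φ
  | _, _, .tensor f g => f.map φ ⊕ₚ g.map φ
  | _, _, .symm n m => .symm n m
  | _, _, .cup => .cup
  | _, _, .cap => .cap

/-- The congruence generated by the laws of a compact prop and a family of equations `E`. -/
inductive Diagram.Eqv {G : ℕ → ℕ → Type}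
    (E : ∀ n m, Diagram G n m → Diagram G n m → Prop) :
    ∀ {n m : ℕ}, Diagram G n m → Diagram G n m → Prop
  | ax {n m : ℕ} {f g : Diagram G n m} : E n m f g → Eqv E f g
  | refl {n m : ℕ} (f : Diagram G n m) : Eqv E f f
  | symm {n m : ℕ} {f g : Diagram G n m} : Eqv E f g → Eqv E g f
  | trans {n m : ℕ} {f g h : Diagram G n m} : Eqv E f g → Eqv E g h → Eqv E f h
  | comp {n m k : ℕ} {f f' : Diagram G n m} {g g' : Diagram G m k} :
      Eqv E f f' → Eqv E g g' → Eqv E (f ⨟ g) (f' ⨟ g')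
  | tensor {n m n' m' : ℕ} {f f' : Diagram G n m} {g g' : Diagram G n' m'} :
      Eqv E f f' → Eqv E g g' → Eqv E (f ⊕ₚ g) (f' ⊕ₚ g')
  | id_comp {n m : ℕ} (f : Diagram G n m) : Eqv E (.id n ⨟ f) f
  | comp_id {n m : ℕ} (f : Diagram G n m) : Eqv E (f ⨟ .id m) f
  | comp_assoc {n m k l : ℕ} (f : Diagram G n m) (g : Diagram G m k) (h : Diagram G k l) :
      Eqv E (f ⨟ g ⨟ h) (f ⨟ (g ⨟ h))
  | tensor_id (n m : ℕ) : Eqv E (.id n ⊕ₚ .id m) (.id (n + m))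
  | tensor_comp {n m k n' m' k' : ℕ} (f : Diagram G n m) (g : Diagram G m k)
      (f' : Diagram G n' m') (g' : Diagram G m' k') :
      Eqv E ((f ⨟ g) ⊕ₚ (f' ⨟ g')) ((f ⊕ₚ f') ⨟ (g ⊕ₚ g'))
  | tensor_assoc {n m n' m' n'' m'' : ℕ} (f : Diagram G n m) (g : Diagram G n' m')
      (h : Diagram G n'' m'') :
      Eqv E (castHom (Diagram G) (Nat.add_assoc n n' n'') (Nat.add_assoc m m' m'') (f ⊕ₚ g ⊕ₚ h))
        (f ⊕ₚ (g ⊕ₚ h))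
  | id_tensor {n m : ℕ} (f : Diagram G n m) :
      Eqv E (castHom (Diagram G) (Nat.zero_add n) (Nat.zero_add m) (.id 0 ⊕ₚ f)) f
  | tensor_id_zero {n m : ℕ} (f : Diagram G n m) : Eqv E (f ⊕ₚ .id 0) f
  | symm_natural {n m n' m' : ℕ} (f : Diagram G n m) (g : Diagram G n' m') :
      Eqv E ((f ⊕ₚ g) ⨟ .symm m m') (.symm n n' ⨟ (g ⊕ₚ f))
  | symm_symm (n m : ℕ) : Eqv E (.symm n m ⨟ .symm m n) (.id (n + m))
  | hexagon (n m k : ℕ) :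
      Eqv E (.symm n (m + k))
        (castHom (Diagram G) (Nat.add_assoc n m k) rfl (.symm n m ⊕ₚ .id k) ⨟
          castHom (Diagram G) (Nat.add_assoc m n k).symm (Nat.add_assoc m k n).symm
            (.id m ⊕ₚ .symm n k))
  | snake_left : Eqv E (.comp (m := 3) (.cup ⊕ₚ .id 1) (.id 1 ⊕ₚ .cap)) (.id 1)
  | snake_right : Eqv E (.comp (m := 3) (.id 1 ⊕ₚ .cup) (.cap ⊕ₚ .id 1)) (.id 1)
  | cup_symm : Eqv E (.cup ⨟ .symm 1 1) .cup
  | symm_cap : Eqv E (.symm 1 1 ⨟ .cap) .cap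

/-- Diagrams modulo the generated congruence. -/
def Diagram.setoid {G : ℕ → ℕ → Type} (E : ∀ n m, Diagram G n m → Diagram G n m → Prop)
    (n m : ℕ) : Setoid (Diagram G n m) :=
  ⟨Diagram.Eqv E, ⟨Diagram.Eqv.refl, Diagram.Eqv.symm, Diagram.Eqv.trans⟩⟩

theorem castHom_quotient {H : ℕ → ℕ → Type} (s : ∀ n m, Setoid (H n m)) {n n' m m' : ℕ}
    (hn : n = n') (hm : m = m') (f : H n m) :
    castHom (fun n m => Quotient (s n m)) hn hm (Quotient.mk (s n m) f) =
      Quotient.mk (s n' m') (castHom H hn hm f) := by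
  subst hn hm; rfl

/-- The compact prop with generators `G` and equations `E`. -/
def CompactProp.presented (G : ℕ → ℕ → Type)
    (E : ∀ n m, Diagram G n m → Diagram G n m → Prop) : CompactProp where
  Hom n m := Quotient (Diagram.setoid E n m)
  id n := Quotient.mk _ (.id n)
  comp := Quotient.map₂ Diagram.comp (fun _ _ h _ _ h' => Diagram.Eqv.comp h h')
  tensor := Quotient.map₂ Diagram.tensor (fun _ _ h _ _ h' => Diagram.Eqv.tensor h h')
  symm n m := Quotient.mk _ (.symm n m)
  cup := Quotient.mk _ .cup
  cap := Quotient.mk _ .cap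
  id_comp f := by
    induction f using Quotient.inductionOn; exact Quotient.sound (.id_comp _)
  comp_id f := by
    induction f using Quotient.inductionOn; exact Quotient.sound (.comp_id _)
  comp_assoc f g h := by
    induction f using Quotient.inductionOn; induction g using Quotient.inductionOn
    induction h using Quotient.inductionOn; exact Quotient.sound (.comp_assoc _ _ _)
  tensor_id n m := Quotient.sound (.tensor_id n m)
  tensor_comp f g f' g' := by
    induction f using Quotient.inductionOn; induction g using Quotient.inductionOn
    induction f' using Quotient.inductionOn; induction g' using Quotient.inductionOn
    exact Quotient.sound (.tensor_comp _ _ _ _)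
  tensor_assoc f g h := by
    induction f using Quotient.inductionOn; induction g using Quotient.inductionOn
    induction h using Quotient.inductionOn
    exact (castHom_quotient (Diagram.setoid E) _ _ _).trans (Quotient.sound (.tensor_assoc _ _ _))
  id_tensor f := by
    induction f using Quotient.inductionOn
    exact (castHom_quotient (Diagram.setoid E) _ _ _).trans (Quotient.sound (.id_tensor _))
  tensor_id_zero f := by
    induction f using Quotient.inductionOn; exact Quotient.sound (.tensor_id_zero _)
  symm_natural f g := by
    induction f using Quotient.inductionOn; induction g using Quotient.inductionOn
    exact Quotient.sound (.symm_natural _ _)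
  symm_symm n m := Quotient.sound (.symm_symm n m)
  hexagon n m k := by
    have h1 := castHom_quotient (Diagram.setoid E) (Nat.add_assoc n m k) rfl
      (Diagram.symm n m ⊕ₚ .id k : Diagram G _ _)
    have h2 := castHom_quotient (Diagram.setoid E) (Nat.add_assoc m n k).symm
      (Nat.add_assoc m k n).symm (.id m ⊕ₚ Diagram.symm n k : Diagram G _ _)
    refine (Quotient.sound (s := Diagram.setoid E _ _) (Diagram.Eqv.hexagon n m k)).trans ?_
    exact (congrArg₂ (Quotient.map₂ Diagram.comp
      (fun _ _ h _ _ h' => Diagram.Eqv.comp h h')) h1 h2).symm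
  snake_left := Quotient.sound .snake_left
  snake_right := Quotient.sound .snake_right
  cup_symm := Quotient.sound .cup_symm
  symm_cap := Quotient.sound .symm_cap

/-! ### Graphical affine algebra -/

/-- Generators of graphical affine algebra over `K`: grey spiders, white spiders with an affine
phase, and scalar multiplications. -/
inductive GAA.Gen (K : Type) : ℕ → ℕ → Type
  | grey (n m : ℕ) : GAA.Gen K n m
  | white (n m : ℕ) (a : K) : GAA.Gen K n m
  | scalar (a : K) : GAA.Gen K 1 1

namespace GAA

/-- The grey spider, read as `x₁ = ⋯ = xₙ = y₁ = ⋯ = yₘ`. -/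
abbrev grey (K : Type) (n m : ℕ) : Diagram (Gen K) n m := .gen (.grey n m)

/-- The white spider, read as `∑ xᵢ + ∑ yⱼ = a`. -/
abbrev white {K : Type} (n m : ℕ) (a : K) : Diagram (Gen K) n m := .gen (.white n m a)

/-- Scalar multiplication, read as `y = a x`. -/
abbrev scalar {K : Type} (a : K) : Diagram (Gen K) 1 1 := .gen (.scalar a)

/-- The derived reversed scalar multiplication, read as `x = a y`. -/
abbrev scalarRev {K : Type} (a : K) : Diagram (Gen K) 1 1 :=
  .comp (m := 3) (.comp (m := 3) (.id 1 ⊕ₚ .cup) (.id 1 ⊕ₚ scalar a ⊕ₚ .id 1)) (.cap ⊕ₚ .id 1)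

/-- The interchange of the two middle wires among four. -/
abbrev middle (K : Type) : Diagram (Gen K) 4 4 := .id 1 ⊕ₚ .symm 1 1 ⊕ₚ .id 1

/-- The derived addition, read as `y = x₁ + x₂`. -/
abbrev add (K : Type) [Field K] : Diagram (Gen K) 2 1 := white 2 1 (0 : K) ⨟ scalar (-1)

/-- The equations of graphical affine algebra. -/
inductive Axiom (K : Type) [Field K] :
    ∀ n m, Diagram (Gen K) n m → Diagram (Gen K) n m → Prop
  -- flexsymmetry: legs can be permuted, and bent from the input to the output side
  | grey_swap (n a b : ℕ) : Axiom K _ _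
      (grey K n (a + 2 + b) ⨟ (.id a ⊕ₚ .symm 1 1 ⊕ₚ .id b)) (grey K n (a + 2 + b))
  | grey_bend (n m : ℕ) : Axiom K _ _
      (.comp (m := n + 2) (.id n ⊕ₚ .cup) (.tensor (n := n + 1) (n' := 1) (grey K (n + 1) m) (.id 1))) (grey K n (m + 1))
  | white_swap (n a b : ℕ) (c : K) : Axiom K _ _
      (white n (a + 2 + b) c ⨟ (.id a ⊕ₚ .symm 1 1 ⊕ₚ .id b)) (white n (a + 2 + b) c)
  | white_bend (n m : ℕ) (a : K) : Axiom K _ _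
      (.comp (m := n + 2) (.id n ⊕ₚ .cup) (.tensor (n := n + 1) (n' := 1) (white (n + 1) m a) (.id 1))) (white n (m + 1) a)
  -- grey spiders: fusion, and the wires are grey spiders
  | grey_fuse (n m k : ℕ) : Axiom K _ _
      (grey K n (m + 1) ⨟ (.id m ⊕ₚ grey K 1 k)) (grey K n (m + k))
  | grey_special : Axiom K _ _ (grey K 1 2 ⨟ grey K 2 1) (.id 1)
  | grey_bone : Axiom K _ _ (grey K 0 1 ⨟ grey K 1 0) (.id 0)
  | grey_id : Axiom K _ _ (grey K 1 1) (.id 1)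
  | grey_cup : Axiom K _ _ (grey K 0 2) .cup
  | grey_cap : Axiom K _ _ (grey K 2 0) .cap
  -- white spiders: fusion along an antipode
  | white_fuse (n m k : ℕ) (a b : K) : Axiom K _ _
      (white n (m + 1) a ⨟ (.id m ⊕ₚ (scalar (-1) ⨟ white 1 k b))) (white n (m + k) (a + b))
  | white_special : Axiom K _ _ (white 1 2 (0 : K) ⨟ white 2 1 0) (.id 1)
  | white_bone : Axiom K _ _ (white 0 1 (0 : K) ⨟ white 1 0 0) (.id 0)
  | white_antipode : Axiom K _ _ (white 1 1 (0 : K)) (scalar (-1))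
  -- interaction of the two colours
  | bialgebra : Axiom K _ _ (white 2 1 (0 : K) ⨟ grey K 1 2)
      ((grey K 1 2 ⊕ₚ grey K 1 2) ⨟ middle K ⨟ (white 2 1 0 ⊕ₚ white 2 1 0))
  | white_discard : Axiom K _ _ (white 2 1 (0 : K) ⨟ grey K 1 0) (grey K 1 0 ⊕ₚ grey K 1 0)
  | point_copy (a : K) : Axiom K _ _ (white 0 1 a ⨟ grey K 1 2) (white 0 1 a ⊕ₚ white 0 1 a)
  | point_discard (a : K) : Axiom K _ _ (white 0 1 a ⨟ grey K 1 0) (.id 0)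
  -- scalar multiplication
  | scalar_one : Axiom K _ _ (scalar (1 : K)) (.id 1)
  | scalar_zero : Axiom K _ _ (scalar (0 : K)) (grey K 1 0 ⨟ white 0 1 0)
  | scalar_mul (a b : K) : Axiom K _ _ (scalar a ⨟ scalar b) (scalar (a * b))
  | scalar_add (a b : K) : Axiom K _ _
      (grey K 1 2 ⨟ (scalar a ⊕ₚ scalar b) ⨟ add K) (scalar (a + b))
  | scalar_copy (a : K) : Axiom K _ _
      (scalar a ⨟ grey K 1 2) (grey K 1 2 ⨟ (scalar a ⊕ₚ scalar a))
  | scalar_discard (a : K) : Axiom K _ _ (scalar a ⨟ grey K 1 0) (grey K 1 0)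
  | scalar_white (a : K) : Axiom K _ _
      ((scalar a ⊕ₚ scalar a) ⨟ white 2 1 0) (white 2 1 0 ⨟ scalar a)
  | scalar_point (a b : K) : Axiom K _ _ (white 0 1 b ⨟ scalar a) (white 0 1 (a * b))
  | scalar_inv (c : K) (hc : c ≠ 0) : Axiom K _ _ (scalarRev c) (scalar c⁻¹)
  -- an inconsistent scalar disconnects every wire
  | empty (c : K) (hc : c ≠ 0) : Axiom K _ _
      (white 0 0 c ⊕ₚ .id 1) (white 0 0 c ⊕ₚ (grey K 1 0 ⨟ grey K 0 1))

end GAA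

/-- Graphical affine algebra over a field. -/
def GAA (K : Type) [Field K] : CompactProp := .presented (GAA.Gen K) (GAA.Axiom K)

/-! ### Graphical Gaussian algebra -/

/-- The generators of graphical affine algebra over `ℝ` together with the vacuum. -/
inductive GGA.Gen : ℕ → ℕ → Type
  | affine {n m : ℕ} (g : GAA.Gen ℝ n m) : GGA.Gen n m
  | vacuum : GGA.Gen 0 1

namespace GGA

/-- Diagrams of graphical affine algebra as diagrams of graphical Gaussian algebra. -/
abbrev incl {n m : ℕ} (f : Diagram (GAA.Gen ℝ) n m) : Diagram Gen n m :=
  f.map fun _ _ g => .affine g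

/-- The scalable vacuum: the tensor product of `n` vacua. -/
def vacua : ∀ n : ℕ, Diagram Gen 0 n
  | 0 => .id 0
  | n + 1 => vacua n ⊕ₚ .gen .vacuum

/-- The effect `x = v` on `n` wires. -/
def pointEffect : ∀ n : ℕ, (Fin n → ℝ) → Diagram (GAA.Gen ℝ) n 0
  | 0, _ => .id 0
  | n + 1, v => pointEffect n (fun i => v i.castSucc) ⊕ₚ GAA.white 1 0 (v (Fin.last n))

/-- The discarding effect on `n` wires. -/
def discard : ∀ n : ℕ, Diagram (GAA.Gen ℝ) n 0
  | 0 => .id 0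
  | n + 1 => discard n ⊕ₚ GAA.grey ℝ 1 0

/-- The rotation `(x₁, x₂) ↦ (cos θ x₁ - sin θ x₂, sin θ x₁ + cos θ x₂)`. -/
noncomputable def rotation (θ : ℝ) : Diagram (GAA.Gen ℝ) 2 2 :=
  .comp (m := 4) (GAA.grey ℝ 1 2 ⊕ₚ GAA.grey ℝ 1 2)
      (GAA.scalar (Real.cos θ) ⊕ₚ GAA.scalar (Real.sin θ) ⊕ₚ
        GAA.scalar (-Real.sin θ) ⊕ₚ GAA.scalar (Real.cos θ)) ⨟
    GAA.middle ℝ ⨟ (GAA.add ℝ ⊕ₚ GAA.add ℝ)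

/-- The equations of graphical affine algebra, and those saying that the vacuum codiscards
rotations and effects. -/
inductive Axiom : ∀ n m, Diagram Gen n m → Diagram Gen n m → Prop
  | affine {n m : ℕ} {f g : Diagram (GAA.Gen ℝ) n m} (h : GAA.Axiom ℝ n m f g) :
      Axiom n m (incl f) (incl g)
  | rotation (θ : ℝ) (h₀ : 0 ≤ θ) (h₁ : θ < 2 * Real.pi) :
      Axiom _ _ (vacua 2 ⨟ incl (rotation θ)) (vacua 2)
  | point (n : ℕ) (v : Fin n → ℝ) : Axiom _ _ (vacua n ⨟ incl (pointEffect n v)) (.id 0)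
  | discard (n : ℕ) : Axiom _ _ (vacua n ⨟ incl (discard n)) (.id 0)

end GGA

/-- Graphical Gaussian algebra. -/
def GGA : CompactProp := .presented GGA.Gen GGA.Axiom

/-- The arrow of graphical Gaussian algebra represented by a generator. -/
def GGA.arrow {n m : ℕ} (g : GGA.Gen n m) : GGA.Hom n m :=
  Quotient.mk (Diagram.setoid GGA.Axiom n m) (.gen g)

/-! ### Relations between phase spaces -/

/-- The phase space `K²ⁿ`, whose elements are pairs `(z, x)`. -/
abbrev Phase (K : Type) (n : ℕ) : Type := (Fin n → K) × (Fin n → K)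

namespace Phase

variable {K : Type}

/-- The first `n` modes. -/
def left {n m : ℕ} (v : Phase K (n + m)) : Phase K n :=
  (fun i => v.1 (Fin.castAdd m i), fun i => v.2 (Fin.castAdd m i))

/-- The last `m` modes. -/
def right {n m : ℕ} (v : Phase K (n + m)) : Phase K m :=
  (fun i => v.1 (Fin.natAdd n i), fun i => v.2 (Fin.natAdd n i))

/-- Juxtaposition of modes. -/
def append {n m : ℕ} (v : Phase K n) (w : Phase K m) : Phase K (n + m) :=
  (Fin.append v.1 w.1, Fin.append v.2 w.2)

/-- Transport along an equality of dimensions. -/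
def cast {n m : ℕ} (h : n = m) (v : Phase K n) : Phase K m :=
  (fun i => v.1 (Fin.cast h.symm i), fun i => v.2 (Fin.cast h.symm i))

@[simp] theorem left_append {n m : ℕ} (v : Phase K n) (w : Phase K m) :
    (append v w).left = v := by
  ext i <;> simp [left, append]

@[simp] theorem right_append {n m : ℕ} (v : Phase K n) (w : Phase K m) :
    (append v w).right = w := by
  ext i <;> simp [right, append]

theorem ext_append {n m : ℕ} {v w : Phase K (n + m)} (hl : v.left = w.left)
    (hr : v.right = w.right) : v = w := by
  have h1 := congrArg Prod.fst hl
  have h2 := congrArg Prod.snd hl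
  have h3 := congrArg Prod.fst hr
  have h4 := congrArg Prod.snd hr
  ext i
  · refine Fin.addCases (fun j => congrFun h1 j) (fun j => congrFun h3 j) i
  · refine Fin.addCases (fun j => congrFun h2 j) (fun j => congrFun h4 j) i

theorem append_iff {n m : ℕ} {v w : Phase K (n + m)} :
    v = w ↔ v.left = w.left ∧ v.right = w.right :=
  ⟨fun h => h ▸ ⟨rfl, rfl⟩, fun h => ext_append h.1 h.2⟩

end Phase

theorem castHom_rel {K : Type} {n n' m m' : ℕ} (hn : n = n') (hm : m = m')
    (R : Set (Phase K n × Phase K m)) :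
    castHom (fun n m => Set (Phase K n × Phase K m)) hn hm R =
      {p | (p.1.cast hn.symm, p.2.cast hm.symm) ∈ R} := by
  subst hn hm; rfl

/-- Relational composition. -/
def relComp {K : Type} {n m k : ℕ} (R : Set (Phase K n × Phase K m))
    (S : Set (Phase K m × Phase K k)) : Set (Phase K n × Phase K k) :=
  {p | ∃ q, (p.1, q) ∈ R ∧ (q, p.2) ∈ S}

/-- Direct sum of relations. -/
def relTensor {K : Type} {n m n' m' : ℕ} (R : Set (Phase K n × Phase K m))
    (S : Set (Phase K n' × Phase K m')) : Set (Phase K (n + n') × Phase K (m + m')) :=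
  {p | (p.1.left, p.2.left) ∈ R ∧ (p.1.right, p.2.right) ∈ S}

/-- The compact prop of all relations between phase spaces, with relational composition, the
direct sum of modes, and the cup `{(z, z, x, -x)}`. -/
def PhaseRel (K : Type) [Field K] : CompactProp where
  Hom n m := Set (Phase K n × Phase K m)
  id n := {p | p.1 = p.2}
  comp := relComp
  tensor := relTensor
  symm n m := {p | p.2.left = p.1.right ∧ p.2.right = p.1.left}
  cup := {p | p.2.1 0 = p.2.1 1 ∧ p.2.2 0 = -p.2.2 1}
  cap := {p | p.1.1 0 = p.1.1 1 ∧ p.1.2 0 = -p.1.2 1}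
  id_comp R := by ext ⟨a, b⟩; simp [relComp]
  comp_id R := by ext ⟨a, b⟩; simp [relComp]
  comp_assoc R S T := by
    ext ⟨a, b⟩
    constructor
    · rintro ⟨q, ⟨r, h1, h2⟩, h3⟩; exact ⟨r, h1, q, h2, h3⟩
    · rintro ⟨q, h1, r, h2, h3⟩; exact ⟨r, ⟨q, h1, h2⟩, h3⟩
  tensor_id n m := by
    ext ⟨a, b⟩
    exact Phase.append_iff.symm
  tensor_comp R S R' S' := by
    ext ⟨a, b⟩
    constructor
    · rintro ⟨⟨q, h1, h2⟩, ⟨q', h1', h2'⟩⟩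
      refine ⟨Phase.append q q', ⟨?_, ?_⟩, ⟨?_, ?_⟩⟩ <;> simpa
    · rintro ⟨q, ⟨h1, h1'⟩, ⟨h2, h2'⟩⟩
      exact ⟨⟨q.left, h1, h2⟩, ⟨q.right, h1', h2'⟩⟩
  tensor_assoc R S T := by
    rw [castHom_rel]
    ext ⟨a, b⟩
    have hl : ∀ {i j k : ℕ} (v : Phase K (i + (j + k))),
        (v.cast (Nat.add_assoc i j k).symm).left.left = v.left := fun v => rfl
    have hm : ∀ {i j k : ℕ} (v : Phase K (i + (j + k))),
        (v.cast (Nat.add_assoc i j k).symm).left.right = v.right.left := fun v => rfl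
    have hr : ∀ {i j k : ℕ} (v : Phase K (i + (j + k))),
        (v.cast (Nat.add_assoc i j k).symm).right = v.right.right := fun v => by
      ext x
      · exact congrArg v.1 (Fin.ext (Nat.add_assoc _ _ _))
      · exact congrArg v.2 (Fin.ext (Nat.add_assoc _ _ _))
    simp only [relTensor, Set.mem_ofPred_eq, hl, hm, hr, and_assoc]
  id_tensor R := by
    rw [castHom_rel]
    ext ⟨a, b⟩
    have hr : ∀ {i : ℕ} (v : Phase K i),
        (v.cast (Nat.zero_add i).symm).right = v := fun v => by
      ext x
      · exact congrArg v.1 (Fin.ext (Nat.zero_add _))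
      · exact congrArg v.2 (Fin.ext (Nat.zero_add _))
    have hz : ∀ v w : Phase K 0, v = w := fun v w => Subsingleton.elim v w
    simp only [relTensor, Set.mem_ofPred_eq, hr]
    exact ⟨fun h => h.2, fun h => ⟨hz _ _, h⟩⟩
  tensor_id_zero R := by
    ext ⟨a, b⟩
    exact ⟨fun h => h.1, fun h => ⟨h, Subsingleton.elim _ _⟩⟩
  symm_natural R S := by
    ext ⟨a, b⟩
    constructor
    · rintro ⟨q, ⟨h1, h2⟩, ⟨h3, h4⟩⟩
      refine ⟨Phase.append a.right a.left, ⟨by simp, by simp⟩, ?_, ?_⟩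
      · simpa using h3 ▸ h2
      · simpa using h4 ▸ h1
    · rintro ⟨q, ⟨h3, h4⟩, ⟨h1, h2⟩⟩
      refine ⟨Phase.append b.right b.left, ⟨?_, ?_⟩, ⟨by simp, by simp⟩⟩
      · simpa using h4 ▸ h2
      · simpa using h3 ▸ h1
  symm_symm n m := by
    ext ⟨a, b⟩
    constructor
    · rintro ⟨q, ⟨h1, h2⟩, ⟨h3, h4⟩⟩
      exact Phase.ext_append (by rw [h3, h2]) (by rw [h4, h1])
    · rintro h
      change a = b at h
      subst h
      exact ⟨Phase.append a.right a.left, ⟨by simp, by simp⟩, ⟨by simp, by simp⟩⟩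
  hexagon n m k := by
    rw [castHom_rel, castHom_rel]
    ext ⟨a, b⟩
    have hl : ∀ {i j k : ℕ} (v : Phase K (i + (j + k))),
        (v.cast (Nat.add_assoc i j k).symm).left.left = v.left := fun v => rfl
    have hm : ∀ {i j k : ℕ} (v : Phase K (i + (j + k))),
        (v.cast (Nat.add_assoc i j k).symm).left.right = v.right.left := fun v => rfl
    have hr : ∀ {i j k : ℕ} (v : Phase K (i + (j + k))),
        (v.cast (Nat.add_assoc i j k).symm).right = v.right.right := fun v => by
      ext x
      · exact congrArg v.1 (Fin.ext (Nat.add_assoc _ _ _))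
      · exact congrArg v.2 (Fin.ext (Nat.add_assoc _ _ _))
    have hl' : ∀ {i j k : ℕ} (v : Phase K (i + j + k)),
        (v.cast (Nat.add_assoc i j k)).left = v.left.left := fun v => rfl
    have hm' : ∀ {i j k : ℕ} (v : Phase K (i + j + k)),
        (v.cast (Nat.add_assoc i j k)).right.left = v.left.right := fun v => rfl
    have hr' : ∀ {i j k : ℕ} (v : Phase K (i + j + k)),
        (v.cast (Nat.add_assoc i j k)).right.right = v.right := fun v => by
      ext x
      · exact congrArg v.1 (Fin.ext (Nat.add_assoc _ _ _).symm)
      · exact congrArg v.2 (Fin.ext (Nat.add_assoc _ _ _).symm)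
    have hc : ∀ {i : ℕ} (v : Phase K i), v.cast rfl = v := fun v => rfl
    simp only [relTensor, relComp, Set.mem_ofPred_eq, hc]
    constructor
    · rintro ⟨h1, h2⟩
      refine ⟨Phase.append (Phase.append b.left.left a.left) b.left.right, ?_, ?_⟩
      · simp only [Phase.left_append, Phase.right_append, hl, hm, hr, h1, and_self]
      · simp only [hl', hm', hr', Phase.left_append, Phase.right_append, h2, and_self]
    · rintro ⟨q, ⟨⟨h1, h2⟩, h3⟩, ⟨h4, h5, h6⟩⟩
      simp only [hl, hm, hr, hl', hm', hr'] at h1 h2 h3 h4 h5 h6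
      refine ⟨Phase.ext_append ?_ ?_, ?_⟩
      · rw [← h4, h1]
      · rw [h5, ← h3]
      · rw [h6, h2]
  snake_left := by
    ext ⟨a, b⟩
    constructor
    · rintro ⟨q, ⟨⟨h1, h2⟩, h3⟩, ⟨h4, ⟨h5, h6⟩⟩⟩
      have e1 := congrFun (congrArg Prod.fst h3) 0
      have e2 := congrFun (congrArg Prod.snd h3) 0
      have e3 := congrFun (congrArg Prod.fst h4) 0
      have e4 := congrFun (congrArg Prod.snd h4) 0
      change q.1 0 = q.1 1 at h1
      change q.2 0 = -q.2 1 at h2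
      change q.1 1 = q.1 2 at h5
      change q.2 1 = -q.2 2 at h6
      change a.1 0 = q.1 2 at e1
      change a.2 0 = q.2 2 at e2
      change q.1 0 = b.1 0 at e3
      change q.2 0 = b.2 0 at e4
      refine Prod.ext (funext fun i : Fin 1 => ?_) (funext fun i : Fin 1 => ?_)
      · change a.1 i = b.1 i; rw [Subsingleton.elim i 0, e1, ← e3, h1, h5]
      · change a.2 i = b.2 i; rw [Subsingleton.elim i 0, e2, ← e4, h2, h6, neg_neg]
    · intro h
      change a = b at h
      subst h
      refine ⟨(![a.1 0, a.1 0, a.1 0], ![a.2 0, -a.2 0, a.2 0]), ⟨⟨rfl, (neg_neg _).symm⟩, ?_⟩,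
        ⟨?_, ⟨rfl, rfl⟩⟩⟩
      · ext i <;> rw [Subsingleton.elim i 0] <;> rfl
      · ext i <;> rw [Subsingleton.elim i 0] <;> rfl
  snake_right := by
    ext ⟨a, b⟩
    constructor
    · rintro ⟨q, ⟨h3, ⟨h1, h2⟩⟩, ⟨⟨h5, h6⟩, h4⟩⟩
      have e1 := congrFun (congrArg Prod.fst h3) 0
      have e2 := congrFun (congrArg Prod.snd h3) 0
      have e3 := congrFun (congrArg Prod.fst h4) 0
      have e4 := congrFun (congrArg Prod.snd h4) 0
      change q.1 1 = q.1 2 at h1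
      change q.2 1 = -q.2 2 at h2
      change q.1 0 = q.1 1 at h5
      change q.2 0 = -q.2 1 at h6
      change a.1 0 = q.1 0 at e1
      change a.2 0 = q.2 0 at e2
      change q.1 2 = b.1 0 at e3
      change q.2 2 = b.2 0 at e4
      refine Prod.ext (funext fun i : Fin 1 => ?_) (funext fun i : Fin 1 => ?_)
      · change a.1 i = b.1 i; rw [Subsingleton.elim i 0, e1, ← e3, h5, h1]
      · change a.2 i = b.2 i; rw [Subsingleton.elim i 0, e2, ← e4, h6, h2, neg_neg]
    · intro h
      change a = b at h
      subst h
      refine ⟨(![a.1 0, a.1 0, a.1 0], ![a.2 0, -a.2 0, a.2 0]), ⟨?_, ⟨rfl, rfl⟩⟩,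
        ⟨⟨rfl, (neg_neg _).symm⟩, ?_⟩⟩
      · ext i <;> rw [Subsingleton.elim i 0] <;> rfl
      · ext i <;> rw [Subsingleton.elim i 0] <;> rfl
  cup_symm := by
    ext ⟨a, b⟩
    constructor
    · rintro ⟨q, ⟨h1, h2⟩, ⟨h3, h4⟩⟩
      have e1 := congrFun (congrArg Prod.fst h3) 0
      have e2 := congrFun (congrArg Prod.snd h3) 0
      have e3 := congrFun (congrArg Prod.fst h4) 0
      have e4 := congrFun (congrArg Prod.snd h4) 0
      change b.1 0 = q.1 1 at e1
      change b.2 0 = q.2 1 at e2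
      change b.1 1 = q.1 0 at e3
      change b.2 1 = q.2 0 at e4
      change q.1 0 = q.1 1 at h1
      change q.2 0 = -q.2 1 at h2
      exact ⟨by change b.1 0 = b.1 1; rw [e1, e3, h1],
        by change b.2 0 = -b.2 1; rw [e2, e4, h2, neg_neg]⟩
    · rintro ⟨h1, h2⟩
      change b.1 0 = b.1 1 at h1
      change b.2 0 = -b.2 1 at h2
      refine ⟨(![b.1 1, b.1 0], ![b.2 1, b.2 0]), ⟨h1.symm, ?_⟩, ⟨?_, ?_⟩⟩
      · change b.2 1 = -b.2 0; rw [h2, neg_neg]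
      · ext i <;> rw [Subsingleton.elim i 0] <;> rfl
      · ext i <;> rw [Subsingleton.elim i 0] <;> rfl
  symm_cap := by
    ext ⟨a, b⟩
    constructor
    · rintro ⟨q, ⟨h3, h4⟩, ⟨h1, h2⟩⟩
      have e1 := congrFun (congrArg Prod.fst h3) 0
      have e2 := congrFun (congrArg Prod.snd h3) 0
      have e3 := congrFun (congrArg Prod.fst h4) 0
      have e4 := congrFun (congrArg Prod.snd h4) 0
      change q.1 0 = a.1 1 at e1
      change q.2 0 = a.2 1 at e2
      change q.1 1 = a.1 0 at e3
      change q.2 1 = a.2 0 at e4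
      change q.1 0 = q.1 1 at h1
      change q.2 0 = -q.2 1 at h2
      exact ⟨by change a.1 0 = a.1 1; rw [← e1, ← e3, h1],
        by change a.2 0 = -a.2 1; rw [← e2, ← e4, h2, neg_neg]⟩
    · rintro ⟨h1, h2⟩
      change a.1 0 = a.1 1 at h1
      change a.2 0 = -a.2 1 at h2
      refine ⟨(![a.1 1, a.1 0], ![a.2 1, a.2 0]), ⟨?_, ?_⟩, ⟨h1.symm, ?_⟩⟩
      · ext i <;> rw [Subsingleton.elim i 0] <;> rfl
      · ext i <;> rw [Subsingleton.elim i 0] <;> rfl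
      · change a.2 1 = -a.2 0; rw [h2, neg_neg]

/-! ### Affine Lagrangian relations -/

section Symplectic

variable {K : Type} [Field K]

/-- The standard symplectic form on the phase space. -/
def symp {n : ℕ} (v w : Phase K n) : K := ∑ j, (v.1 j * w.2 j - v.2 j * w.1 j)

/-- The twisted symplectic form on `K²ⁿ ⊕ K²ᵐ`. -/
def sympRel {n m : ℕ} (p q : Phase K n × Phase K m) : K := symp p.2 q.2 - symp p.1 q.1

/-- Lagrangian subspaces for the twisted symplectic form. -/
structure IsLagrangian {n m : ℕ} (S : Submodule K (Phase K n × Phase K m)) : Prop where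
  dim : 2 * Module.finrank K S = Module.finrank K (Phase K n × Phase K m)
  isotropic : ∀ v ∈ S, ∀ w ∈ S, sympRel v w = 0

/-- Affine Lagrangian relations: the empty relation and the translates of Lagrangian
subspaces. -/
def IsAffineLagrangian {n m : ℕ} (R : Set (Phase K n × Phase K m)) : Prop :=
  R = ∅ ∨ ∃ (S : Submodule K (Phase K n × Phase K m)) (a : Phase K n × Phase K m),
    IsLagrangian S ∧ R = {v | v - a ∈ S}

theorem symp_add_left {n : ℕ} (u v w : Phase K n) : symp (u + v) w = symp u w + symp v w := by
  simp only [symp, ← Finset.sum_add_distrib, Prod.fst_add, Prod.snd_add, Pi.add_apply]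
  exact Finset.sum_congr rfl fun _ _ => by ring

theorem symp_smul_left {n : ℕ} (c : K) (v w : Phase K n) : symp (c • v) w = c * symp v w := by
  simp only [symp, Finset.mul_sum, Prod.smul_fst, Prod.smul_snd, Pi.smul_apply, smul_eq_mul]
  exact Finset.sum_congr rfl fun _ _ => by ring

theorem symp_swap {n : ℕ} (v w : Phase K n) : symp v w = -symp w v := by
  simp only [symp, ← Finset.sum_neg_distrib]
  exact Finset.sum_congr rfl fun _ _ => by ring

theorem symp_add_right {n : ℕ} (u v w : Phase K n) : symp u (v + w) = symp u v + symp u w := by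
  rw [symp_swap, symp_add_left, symp_swap v, symp_swap w]; ring

theorem symp_smul_right {n : ℕ} (c : K) (v w : Phase K n) : symp v (c • w) = c * symp v w := by
  rw [symp_swap, symp_smul_left, symp_swap w]; ring

theorem symp_zero_left {n : ℕ} (v : Phase K n) : symp 0 v = 0 := by simp [symp]

theorem symp_zero_right {n : ℕ} (v : Phase K n) : symp v 0 = 0 := by simp [symp]

theorem symp_sub_right {n : ℕ} (u v w : Phase K n) : symp u (v - w) = symp u v - symp u w := by
  have := symp_add_right u (v - w) w
  rw [sub_add_cancel] at this
  rw [this]; ring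

theorem symp_nondegenerate {n : ℕ} (v : Phase K n) (h : ∀ w, symp v w = 0) : v = 0 := by
  ext j
  · simpa [symp, Pi.single_apply] using h (0, Pi.single j 1)
  · simpa [symp, Pi.single_apply] using h (Pi.single j 1, 0)

theorem symp_split {n m : ℕ} (v w : Phase K (n + m)) :
    symp v w = symp v.left w.left + symp v.right w.right := by
  simp only [symp, Fin.sum_univ_add]; rfl

theorem sympRel_swap {n m : ℕ} (v w : Phase K n × Phase K m) : sympRel v w = -sympRel w v := by
  simp only [sympRel]
  rw [symp_swap v.2, symp_swap v.1]; ring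

/-- The twisted symplectic form as a bilinear form. -/
def sympForm (K : Type) [Field K] (n m : ℕ) :
    LinearMap.BilinForm K (Phase K n × Phase K m) :=
  LinearMap.mk₂ K sympRel
    (fun u v w => by simp only [sympRel, Prod.fst_add, Prod.snd_add, symp_add_left]; ring)
    (fun c v w => by
      simp only [sympRel, Prod.smul_fst, Prod.smul_snd, symp_smul_left, smul_eq_mul]; ring)
    (fun u v w => by simp only [sympRel, Prod.fst_add, Prod.snd_add, symp_add_right]; ring)
    (fun c v w => by
      simp only [sympRel, Prod.smul_fst, Prod.smul_snd, symp_smul_right, smul_eq_mul]; ring)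

@[simp] theorem sympForm_apply {n m : ℕ} (v w : Phase K n × Phase K m) :
    sympForm K n m v w = sympRel v w := rfl

theorem sympForm_isRefl (n m : ℕ) : (sympForm K n m).IsRefl := fun v w h => by
  rw [sympForm_apply] at h ⊢; rw [sympRel_swap, h, neg_zero]

theorem sympRel_nondegenerate {n m : ℕ} (v : Phase K n × Phase K m)
    (h : ∀ w, sympRel v w = 0) : v = 0 := by
  refine Prod.ext (symp_nondegenerate _ fun w => ?_) (symp_nondegenerate _ fun w => ?_)
  · simpa [sympRel, symp_zero_right] using h (w, 0)
  · simpa [sympRel, symp_zero_right] using h (0, w)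

theorem sympForm_nondegenerate (n m : ℕ) : (sympForm K n m).Nondegenerate :=
  (LinearMap.IsRefl.nondegenerate_iff_separatingLeft (B := sympForm K n m)
    (sympForm_isRefl n m)).2 fun v h =>
    sympRel_nondegenerate v h

theorem mem_sup_of_orthogonal {V : Type} [AddCommGroup V] [Module K V] [FiniteDimensional K V]
    {B : LinearMap.BilinForm K V} (hB : B.Nondegenerate) (hr : B.IsRefl) (U W : Submodule K V)
    (v : V) (h : ∀ u, (∀ x ∈ U, B x u = 0) → (∀ x ∈ W, B x u = 0) → B u v = 0) :
    v ∈ U ⊔ W := by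
  rw [← LinearMap.BilinForm.orthogonal_orthogonal hB hr (U ⊔ W)]
  intro u hu
  exact h u (fun x hx => hu x (Submodule.mem_sup_left hx))
    (fun x hx => hu x (Submodule.mem_sup_right hx))

theorem isLagrangian_iff {n m : ℕ} {S : Submodule K (Phase K n × Phase K m)} :
    IsLagrangian S ↔ ∀ v, v ∈ S ↔ ∀ w ∈ S, sympRel v w = 0 := by
  have hd := LinearMap.BilinForm.finrank_orthogonal (sympForm_nondegenerate (K := K) n m) S
  have hle := Submodule.finrank_le S
  have hmem : ∀ v, v ∈ (sympForm K n m).orthogonal S ↔ ∀ w ∈ S, sympRel v w = 0 := fun v =>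
    ⟨fun h w hw => by rw [sympRel_swap, show sympRel w v = 0 from h w hw, neg_zero],
      fun h w hw => by
        change sympRel w v = 0
        rw [sympRel_swap, h w hw, neg_zero]⟩
  constructor
  · intro hS
    have : S = (sympForm K n m).orthogonal S :=
      Submodule.eq_of_le_of_finrank_eq (fun v hv => (hmem v).2 fun w hw => hS.isotropic v hv w hw)
        (by have := hS.dim; omega)
    intro v
    rw [← hmem, ← this]
  · intro h
    have : S = (sympForm K n m).orthogonal S := by
      ext v; rw [hmem, h]
    rw [← this] at hd
    exact ⟨by omega, fun v hv w hw => (h v).1 hv w hw⟩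

/-- Relational composition of subspaces. -/
def linComp {n m k : ℕ} (S : Submodule K (Phase K n × Phase K m))
    (T : Submodule K (Phase K m × Phase K k)) : Submodule K (Phase K n × Phase K k) where
  carrier := {p | ∃ q, (p.1, q) ∈ S ∧ (q, p.2) ∈ T}
  add_mem' := by
    rintro a b ⟨q, h1, h2⟩ ⟨r, h3, h4⟩
    exact ⟨q + r, S.add_mem h1 h3, T.add_mem h2 h4⟩
  zero_mem' := ⟨0, S.zero_mem, T.zero_mem⟩
  smul_mem' := by
    rintro c a ⟨q, h1, h2⟩
    exact ⟨c • q, S.smul_mem c h1, T.smul_mem c h2⟩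

theorem mem_linComp {n m k : ℕ} {S : Submodule K (Phase K n × Phase K m)}
    {T : Submodule K (Phase K m × Phase K k)} {p : Phase K n × Phase K k} :
    p ∈ linComp S T ↔ ∃ q, (p.1, q) ∈ S ∧ (q, p.2) ∈ T := Iff.rfl

/-- Direct sum of subspaces. -/
def linTensor {n m n' m' : ℕ} (S : Submodule K (Phase K n × Phase K m))
    (T : Submodule K (Phase K n' × Phase K m')) :
    Submodule K (Phase K (n + n') × Phase K (m + m')) where
  carrier := {p | (p.1.left, p.2.left) ∈ S ∧ (p.1.right, p.2.right) ∈ T}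
  add_mem' := fun ⟨h1, h2⟩ ⟨h3, h4⟩ => ⟨S.add_mem h1 h3, T.add_mem h2 h4⟩
  zero_mem' := ⟨S.zero_mem, T.zero_mem⟩
  smul_mem' := fun c _ ⟨h1, h2⟩ => ⟨S.smul_mem c h1, T.smul_mem c h2⟩

theorem mem_linTensor {n m n' m' : ℕ} {S : Submodule K (Phase K n × Phase K m)}
    {T : Submodule K (Phase K n' × Phase K m')} {p : Phase K (n + n') × Phase K (m + m')} :
    p ∈ linTensor S T ↔ (p.1.left, p.2.left) ∈ S ∧ (p.1.right, p.2.right) ∈ T := Iff.rfl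

theorem IsLagrangian.comp {n m k : ℕ} {S : Submodule K (Phase K n × Phase K m)}
    {T : Submodule K (Phase K m × Phase K k)} (hS : IsLagrangian S) (hT : IsLagrangian T) :
    IsLagrangian (linComp S T) := by
  rw [isLagrangian_iff]
  intro v
  constructor
  · rintro ⟨q, h1, h2⟩ w ⟨r, h3, h4⟩
    have e1 := hS.isotropic _ h1 _ h3
    have e2 := hT.isotropic _ h2 _ h4
    simp only [sympRel] at e1 e2 ⊢
    linear_combination e1 + e2
  · intro hv
    let B : LinearMap.BilinForm K ((Phase K n × Phase K m) × (Phase K m × Phase K k)) :=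
      (sympForm K n m).compl₁₂ (LinearMap.fst K _ _) (LinearMap.fst K _ _) +
        (sympForm K m k).compl₁₂ (LinearMap.snd K _ _) (LinearMap.snd K _ _)
    have hBa : ∀ x y, B x y = sympRel x.1 y.1 + sympRel x.2 y.2 := fun x y => rfl
    have hr : B.IsRefl := fun x y h => by
      rw [hBa] at h ⊢
      rw [sympRel_swap y.1, sympRel_swap y.2]
      linear_combination -h
    have hB : B.Nondegenerate := by
      refine (LinearMap.IsRefl.nondegenerate_iff_separatingLeft hr).2 fun x hx => ?_
      refine Prod.ext (sympRel_nondegenerate _ fun w => ?_) (sympRel_nondegenerate _ fun w => ?_)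
      · simpa [hBa, sympRel, symp_zero_right] using hx (w, 0)
      · simpa [hBa, sympRel, symp_zero_right] using hx (0, w)
    let Δ : Submodule K ((Phase K n × Phase K m) × (Phase K m × Phase K k)) :=
      LinearMap.range (LinearMap.prod
        (LinearMap.inr K (Phase K n) (Phase K m)) (LinearMap.inl K (Phase K m) (Phase K k)))
    have key : ((v.1, 0), (0, v.2)) ∈ S.prod T ⊔ Δ := by
      refine mem_sup_of_orthogonal hB hr _ _ _ fun u h1 h2 => ?_
      obtain ⟨⟨a, b⟩, ⟨b', c⟩⟩ := u
      have hab : (a, b) ∈ S := (isLagrangian_iff.1 hS _).2 fun w hw => by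
        have := h1 (w, 0) ⟨hw, T.zero_mem⟩
        rw [hBa] at this
        rw [sympRel_swap, neg_eq_zero]
        simpa [sympRel, symp_zero_left] using this
      have hbc : (b', c) ∈ T := (isLagrangian_iff.1 hT _).2 fun w hw => by
        have := h1 (0, w) ⟨S.zero_mem, hw⟩
        rw [hBa] at this
        rw [sympRel_swap, neg_eq_zero]
        simpa [sympRel, symp_zero_left] using this
      have hbb : b = b' := by
        refine sub_eq_zero.1 (symp_nondegenerate _ fun w => ?_)
        have := h2 ((0, w), (w, 0)) ⟨w, rfl⟩
        rw [hBa] at this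
        simp only [sympRel, symp_zero_left] at this
        rw [symp_swap, symp_sub_right]
        linear_combination -this
      subst hbb
      have := hv (a, c) ⟨b, hab, hbc⟩
      rw [hBa]
      simp only [sympRel, symp_zero_right] at this ⊢
      rw [symp_swap v.2, symp_swap v.1] at this
      linear_combination -this
    obtain ⟨y, hy, z, ⟨b, rfl⟩, hyz⟩ := Submodule.mem_sup.1 key
    obtain ⟨⟨y1, y2⟩, ⟨y3, y4⟩⟩ := y
    have e1 : y1 + 0 = v.1 := congrArg (fun u => u.1.1) hyz
    have e2 : y2 + b = 0 := congrArg (fun u => u.1.2) hyz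
    have e3 : y3 + b = 0 := congrArg (fun u => u.2.1) hyz
    have e4 : y4 + 0 = v.2 := congrArg (fun u => u.2.2) hyz
    rw [add_zero] at e1 e4
    have e23 : y2 = y3 := add_right_cancel (e2.trans e3.symm)
    subst e23
    rw [e1, e4] at hy
    exact ⟨y2, hy.1, hy.2⟩

theorem IsLagrangian.tensor {n m n' m' : ℕ} {S : Submodule K (Phase K n × Phase K m)}
    {T : Submodule K (Phase K n' × Phase K m')} (hS : IsLagrangian S) (hT : IsLagrangian T) :
    IsLagrangian (linTensor S T) := by
  rw [isLagrangian_iff]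
  have hz : ∀ {i j : ℕ}, (0 : Phase K (i + j)).left = 0 := rfl
  intro v
  constructor
  · rintro ⟨h1, h2⟩ w ⟨h3, h4⟩
    have e1 := hS.isotropic _ h1 _ h3
    have e2 := hT.isotropic _ h2 _ h4
    simp only [sympRel] at e1 e2 ⊢
    rw [symp_split v.2, symp_split v.1]
    linear_combination e1 + e2
  · intro h
    refine ⟨(isLagrangian_iff.1 hS _).2 fun w hw => ?_,
      (isLagrangian_iff.1 hT _).2 fun w hw => ?_⟩
    · have := h (Phase.append w.1 0, Phase.append w.2 0)
        ⟨by simpa using hw, by simp only [Phase.right_append]; exact T.zero_mem⟩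
      simp only [sympRel] at this ⊢
      rw [symp_split v.2, symp_split v.1] at this
      simpa [symp_zero_right] using this
    · have := h (Phase.append 0 w.1, Phase.append 0 w.2)
        ⟨by simp only [Phase.left_append]; exact S.zero_mem, by simpa using hw⟩
      simp only [sympRel] at this ⊢
      rw [symp_split v.2, symp_split v.1] at this
      simpa [symp_zero_right] using this

/-- The diagonal. -/
def linId (K : Type) [Field K] (n : ℕ) : Submodule K (Phase K n × Phase K n) where
  carrier := {p | p.1 = p.2}
  add_mem' := fun {a b} (h1 : a.1 = a.2) (h2 : b.1 = b.2) => by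
    change a.1 + b.1 = a.2 + b.2; rw [h1, h2]
  zero_mem' := rfl
  smul_mem' := fun c a (h : a.1 = a.2) => by change c • a.1 = c • a.2; rw [h]

/-- The symmetry. -/
def linSymm (K : Type) [Field K] (n m : ℕ) :
    Submodule K (Phase K (n + m) × Phase K (m + n)) where
  carrier := {p | p.2.left = p.1.right ∧ p.2.right = p.1.left}
  add_mem' := fun {a b} ⟨h1, h2⟩ ⟨h3, h4⟩ =>
    ⟨show a.2.left + b.2.left = a.1.right + b.1.right by rw [h1, h3],
      show a.2.right + b.2.right = a.1.left + b.1.left by rw [h2, h4]⟩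
  zero_mem' := ⟨rfl, rfl⟩
  smul_mem' := fun c a ⟨h1, h2⟩ =>
    ⟨show c • a.2.left = c • a.1.right by rw [h1],
      show c • a.2.right = c • a.1.left by rw [h2]⟩

/-- The cup. -/
def linCup (K : Type) [Field K] : Submodule K (Phase K 0 × Phase K 2) where
  carrier := {p | p.2.1 0 = p.2.1 1 ∧ p.2.2 0 = -p.2.2 1}
  add_mem' := fun {a b} ⟨h1, h2⟩ ⟨h3, h4⟩ =>
    ⟨show a.2.1 0 + b.2.1 0 = a.2.1 1 + b.2.1 1 by rw [h1, h3],
      show a.2.2 0 + b.2.2 0 = -(a.2.2 1 + b.2.2 1) by rw [h2, h4]; ring⟩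
  zero_mem' := ⟨rfl, neg_zero.symm⟩
  smul_mem' := fun c a ⟨h1, h2⟩ =>
    ⟨show c * a.2.1 0 = c * a.2.1 1 by rw [h1],
      show c * a.2.2 0 = -(c * a.2.2 1) by rw [h2]; ring⟩

/-- The cap. -/
def linCap (K : Type) [Field K] : Submodule K (Phase K 2 × Phase K 0) where
  carrier := {p | p.1.1 0 = p.1.1 1 ∧ p.1.2 0 = -p.1.2 1}
  add_mem' := fun {a b} ⟨h1, h2⟩ ⟨h3, h4⟩ =>
    ⟨show a.1.1 0 + b.1.1 0 = a.1.1 1 + b.1.1 1 by rw [h1, h3],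
      show a.1.2 0 + b.1.2 0 = -(a.1.2 1 + b.1.2 1) by rw [h2, h4]; ring⟩
  zero_mem' := ⟨rfl, neg_zero.symm⟩
  smul_mem' := fun c a ⟨h1, h2⟩ =>
    ⟨show c * a.1.1 0 = c * a.1.1 1 by rw [h1],
      show c * a.1.2 0 = -(c * a.1.2 1) by rw [h2]; ring⟩

theorem isLagrangian_linId (n : ℕ) : IsLagrangian (linId K n) := by
  rw [isLagrangian_iff]
  intro v
  constructor
  · intro (h : v.1 = v.2) w (h' : w.1 = w.2)
    simp [sympRel, h, h']
  · intro h
    change v.1 = v.2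
    refine (sub_eq_zero.1 (symp_nondegenerate _ fun w => ?_)).symm
    have := h (w, w) rfl
    simp only [sympRel] at this
    rw [symp_swap, symp_sub_right, symp_swap w, symp_swap w]
    linear_combination this

theorem isLagrangian_linSymm (n m : ℕ) : IsLagrangian (linSymm K n m) := by
  rw [isLagrangian_iff]
  intro v
  constructor
  · rintro ⟨h1, h2⟩ w ⟨h3, h4⟩
    simp only [sympRel]
    rw [symp_split v.2, symp_split v.1, h1, h2, h3, h4]
    ring
  · intro h
    refine ⟨(sub_eq_zero.1 (symp_nondegenerate _ fun w => ?_)),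
      (sub_eq_zero.1 (symp_nondegenerate _ fun w => ?_))⟩
    · have := h (Phase.append 0 w, Phase.append w 0) ⟨by simp, by simp⟩
      simp only [sympRel] at this
      rw [symp_split v.2, symp_split v.1] at this
      simp only [Phase.left_append, Phase.right_append, symp_zero_right] at this
      rw [symp_swap, symp_sub_right, symp_swap w, symp_swap w]
      linear_combination this
    · have := h (Phase.append w 0, Phase.append 0 w) ⟨by simp, by simp⟩
      simp only [sympRel] at this
      rw [symp_split v.2, symp_split v.1] at this
      simp only [Phase.left_append, Phase.right_append, symp_zero_right] at this
      rw [symp_swap, symp_sub_right, symp_swap w, symp_swap w]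
      linear_combination this

theorem isLagrangian_linCup : IsLagrangian (linCup K) := by
  rw [isLagrangian_iff]
  intro v
  constructor
  · rintro ⟨h1, h2⟩ w ⟨h3, h4⟩
    simp only [sympRel, symp, Fin.sum_univ_two, Finset.univ_eq_empty, Finset.sum_empty]
    rw [h1, h2, h3, h4]
    ring
  · intro h
    have e1 := h (0, (![0, 0], ![1, -1])) ⟨rfl, by simp⟩
    have e2 := h (0, (![1, 1], ![0, 0])) ⟨rfl, by simp⟩
    simp [sympRel, symp, Fin.sum_univ_two] at e1 e2
    exact ⟨by linear_combination e1, by linear_combination -e2⟩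

theorem isLagrangian_linCap : IsLagrangian (linCap K) := by
  rw [isLagrangian_iff]
  intro v
  constructor
  · rintro ⟨h1, h2⟩ w ⟨h3, h4⟩
    simp only [sympRel, symp, Fin.sum_univ_two, Finset.univ_eq_empty, Finset.sum_empty]
    rw [h1, h2, h3, h4]
    ring
  · intro h
    have e1 := h ((![0, 0], ![1, -1]), 0) ⟨rfl, by simp⟩
    have e2 := h ((![1, 1], ![0, 0]), 0) ⟨rfl, by simp⟩
    simp [sympRel, symp, Fin.sum_univ_two] at e1 e2
    exact ⟨by linear_combination -e1, by linear_combination e2⟩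

/-- A translate of a subspace is a translate by each of its points. -/
theorem translate_eq {V : Type} [AddCommGroup V] [Module K V] (S : Submodule K V) {a b : V}
    (h : b - a ∈ S) : {v | v - a ∈ S} = {v | v - b ∈ S} := by
  ext v
  constructor
  · intro (hv : v - a ∈ S)
    have := S.sub_mem hv h
    rwa [sub_sub_sub_cancel_right] at this
  · intro (hv : v - b ∈ S)
    have := S.add_mem hv h
    rwa [sub_add_sub_cancel] at this

theorem relComp_translate {n m k : ℕ} (S : Submodule K (Phase K n × Phase K m))
    (T : Submodule K (Phase K m × Phase K k)) (p : Phase K n) (q : Phase K m) (r : Phase K k) :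
    relComp {v | v - (p, q) ∈ S} {v | v - (q, r) ∈ T} =
      {v | v - (p, r) ∈ linComp S T} := by
  ext v
  constructor
  · rintro ⟨y, h1, h2⟩
    exact ⟨y - q, h1, h2⟩
  · rintro ⟨y, h1, h2⟩
    refine ⟨y + q, ?_, ?_⟩
    · change (v.1 - p, y + q - q) ∈ S
      rwa [add_sub_cancel_right]
    · change (y + q - q, v.2 - r) ∈ T
      rwa [add_sub_cancel_right]

theorem relTensor_translate {n m n' m' : ℕ} (S : Submodule K (Phase K n × Phase K m))
    (T : Submodule K (Phase K n' × Phase K m')) (a : Phase K n × Phase K m)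
    (b : Phase K n' × Phase K m') :
    relTensor {v | v - a ∈ S} {v | v - b ∈ T} =
      {v | v - (Phase.append a.1 b.1, Phase.append a.2 b.2) ∈ linTensor S T} := by
  have hl : ∀ {i j : ℕ} (v w : Phase K (i + j)), (v - w).left = v.left - w.left :=
    fun v w => rfl
  have hr : ∀ {i j : ℕ} (v w : Phase K (i + j)), (v - w).right = v.right - w.right :=
    fun v w => rfl
  ext v
  change ((v.1.left, v.2.left) - a ∈ S ∧ (v.1.right, v.2.right) - b ∈ T) ↔ _ ∧ _
  simp only [Prod.fst_sub, Prod.snd_sub, hl, hr, Phase.left_append, Phase.right_append]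
  rfl

theorem IsAffineLagrangian.comp {n m k : ℕ} {R : Set (Phase K n × Phase K m)}
    {R' : Set (Phase K m × Phase K k)} (h : IsAffineLagrangian R) (h' : IsAffineLagrangian R') :
    IsAffineLagrangian (relComp R R') := by
  rcases Set.eq_empty_or_nonempty (relComp R R') with he | ⟨⟨p, r⟩, q, h1, h2⟩
  · exact Or.inl he
  · right
    obtain rfl | ⟨S, a, hS, rfl⟩ := h
    · exact h1.elim
    obtain rfl | ⟨T, b, hT, rfl⟩ := h'
    · exact h2.elim
    refine ⟨linComp S T, (p, r), hS.comp hT, ?_⟩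
    rw [translate_eq S h1, translate_eq T h2, relComp_translate]

theorem IsAffineLagrangian.tensor {n m n' m' : ℕ} {R : Set (Phase K n × Phase K m)}
    {R' : Set (Phase K n' × Phase K m')} (h : IsAffineLagrangian R)
    (h' : IsAffineLagrangian R') : IsAffineLagrangian (relTensor R R') := by
  rcases Set.eq_empty_or_nonempty (relTensor R R') with he | ⟨v, h1, h2⟩
  · exact Or.inl he
  · right
    obtain rfl | ⟨S, a, hS, rfl⟩ := h
    · exact h1.elim
    obtain rfl | ⟨T, b, hT, rfl⟩ := h'
    · exact h2.elim
    exact ⟨_, _, hS.tensor hT, relTensor_translate S T a b⟩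

theorem IsLagrangian.affine {n m : ℕ} {S : Submodule K (Phase K n × Phase K m)}
    (hS : IsLagrangian S) : IsAffineLagrangian (S : Set (Phase K n × Phase K m)) :=
  Or.inr ⟨S, 0, hS, by ext v; simp⟩

end Symplectic

/-- The compact prop of affine Lagrangian relations over a field. -/
def AffLagRel (K : Type) [Field K] : CompactProp :=
  (PhaseRel K).sub (fun _ _ R => IsAffineLagrangian R)
    (fun n => (isLagrangian_linId n).affine)
    (fun _ _ _ _ _ h h' => h.comp h')
    (fun _ _ _ _ _ _ h h' => h.tensor h')
    (fun n m => (isLagrangian_linSymm n m).affine)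
    isLagrangian_linCup.affine isLagrangian_linCap.affine

/-! ### Gaussian relations -/

section QuasiReal

open scoped ComplexConjugate ComplexOrder

/-- Complex conjugation on the phase space. -/
def Phase.conj {n : ℕ} (v : Phase ℂ n) : Phase ℂ n :=
  (fun j => (starRingEnd ℂ) (v.1 j), fun j => (starRingEnd ℂ) (v.2 j))

/-- The form `χ(v, w) = z̄₀ᵀ x₁ + x̄₀ᵀ z₁`. -/
noncomputable def chi {n : ℕ} (v w : Phase ℂ n) : ℂ :=
  ∑ j, ((starRingEnd ℂ) (v.1 j) * w.2 j + (starRingEnd ℂ) (v.2 j) * w.1 j)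

/-- Positivity of a complex Lagrangian relation: `i ω(v̄, v) ≥ 0`. -/
def IsPositive {n m : ℕ} (S : Submodule ℂ (Phase ℂ n × Phase ℂ m)) : Prop :=
  ∀ v ∈ S, 0 ≤ Complex.I * sympRel (v.1.conj, v.2.conj) v

/-- Quasi-reality of a complex Lagrangian relation. -/
def IsQuasiRealLinear {n m : ℕ} (S : Submodule ℂ (Phase ℂ n × Phase ℂ m)) : Prop :=
  IsPositive S ∧ ∀ v ∈ S, ∀ w ∈ S, chi v.2 w.2 - chi v.1 w.1 = 0

/-- A real displacement of the `z`-coordinates, the `x`-coordinates not being displaced. -/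
def IsRealShift {n : ℕ} (a : Phase ℂ n) : Prop :=
  (∀ j, (a.1 j).im = 0) ∧ a.2 = 0

/-- Quasi-reality of a complex affine Lagrangian relation: it is empty, or the translate of a
quasi-real Lagrangian relation by a real displacement. -/
def IsQuasiReal {n m : ℕ} (R : Set (Phase ℂ n × Phase ℂ m)) : Prop :=
  R = ∅ ∨ ∃ (S : Submodule ℂ (Phase ℂ n × Phase ℂ m)) (a : Phase ℂ n × Phase ℂ m),
    IsLagrangian S ∧ IsQuasiRealLinear S ∧ IsRealShift a.1 ∧ IsRealShift a.2 ∧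
      R = {v | v - a ∈ S}

/-- The involution `(z, x) ↦ (z̄, -x̄)`. -/
def Phase.twist {n : ℕ} (v : Phase ℂ n) : Phase ℂ n :=
  (fun j => (starRingEnd ℂ) (v.1 j), fun j => -(starRingEnd ℂ) (v.2 j))

theorem chi_eq {n : ℕ} (v w : Phase ℂ n) : chi v w = symp v.twist w := by
  simp only [chi, symp, Phase.twist]
  exact Finset.sum_congr rfl fun _ _ => by ring

theorem symp_conj_conj {n : ℕ} (v w : Phase ℂ n) :
    symp v.conj w.conj = (starRingEnd ℂ) (symp v w) := by
  simp [symp, Phase.conj]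

theorem conj_conj_phase {n : ℕ} (v : Phase ℂ n) : v.conj.conj = v := by
  ext j <;> simp [Phase.conj]

theorem conj_add_phase {n : ℕ} (v w : Phase ℂ n) : (v + w).conj = v.conj + w.conj := by
  ext j <;> simp [Phase.conj]

theorem conj_smul_phase {n : ℕ} (c : ℂ) (v : Phase ℂ n) :
    (c • v).conj = (starRingEnd ℂ) c • v.conj := by
  ext j <;> simp [Phase.conj]

theorem conj_append {n m : ℕ} (v : Phase ℂ (n + m)) :
    v.conj.left = v.left.conj ∧ v.conj.right = v.right.conj := ⟨rfl, rfl⟩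

theorem chi_split {n m : ℕ} (v w : Phase ℂ (n + m)) :
    chi v w = chi v.left w.left + chi v.right w.right := by
  simp only [chi, Fin.sum_univ_add]; rfl

/-- The sesquilinear form `i ω(v̄, w)`. -/
noncomputable def herm {n m : ℕ} (v w : Phase ℂ n × Phase ℂ m) : ℂ :=
  Complex.I * sympRel (v.1.conj, v.2.conj) w

theorem herm_add_left {n m : ℕ} (u v w : Phase ℂ n × Phase ℂ m) :
    herm (u + v) w = herm u w + herm v w := by
  simp only [herm, sympRel, Prod.fst_add, Prod.snd_add, conj_add_phase, symp_add_left]; ring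

theorem herm_add_right {n m : ℕ} (u v w : Phase ℂ n × Phase ℂ m) :
    herm u (v + w) = herm u v + herm u w := by
  simp only [herm, sympRel, Prod.fst_add, Prod.snd_add, symp_add_right]; ring

theorem herm_smul_left {n m : ℕ} (c : ℂ) (v w : Phase ℂ n × Phase ℂ m) :
    herm (c • v) w = (starRingEnd ℂ) c * herm v w := by
  simp only [herm, sympRel, Prod.smul_fst, Prod.smul_snd, conj_smul_phase, symp_smul_left]; ring

theorem herm_smul_right {n m : ℕ} (c : ℂ) (v w : Phase ℂ n × Phase ℂ m) :
    herm v (c • w) = c * herm v w := by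
  simp only [herm, sympRel, Prod.smul_fst, Prod.smul_snd, symp_smul_right]; ring

theorem herm_swap {n m : ℕ} (v w : Phase ℂ n × Phase ℂ m) :
    herm w v = (starRingEnd ℂ) (herm v w) := by
  simp only [herm, sympRel, map_mul, map_sub, Complex.conj_I, ← symp_conj_conj, conj_conj_phase]
  rw [symp_swap w.2.conj, symp_swap w.1.conj]; ring

/-- Null vectors of a positive subspace lie in the radical of the Hermitian form. -/
theorem herm_eq_zero {n m : ℕ} {S : Submodule ℂ (Phase ℂ n × Phase ℂ m)} (hp : IsPositive S)
    {v w : Phase ℂ n × Phase ℂ m} (hv : v ∈ S) (hw : w ∈ S) (h0 : herm v v = 0) :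
    herm v w = 0 := by
  by_contra hne
  have hww : 0 ≤ herm w w := hp w hw
  obtain ⟨r, hr⟩ : ∃ r : ℝ, herm w w = r := ⟨(herm w w).re, by
    rw [Complex.le_def] at hww
    exact Complex.ext rfl (by simpa using hww.2.symm)⟩
  have hr0 : 0 ≤ r := by rw [hr] at hww; exact_mod_cast hww
  have key : ∀ ε : ℝ, 0 ≤ -2 * ε * Complex.normSq (herm v w) +
      ε ^ 2 * Complex.normSq (herm v w) * r := fun ε => by
    have h := hp _ (S.add_mem hv (S.smul_mem (-(ε : ℂ) * (starRingEnd ℂ) (herm v w)) hw))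
    change 0 ≤ herm _ _ at h
    rw [herm_add_left, herm_add_right, herm_add_right, herm_smul_left, herm_smul_left,
      herm_smul_right, herm_smul_right, h0, hr, herm_swap v w] at h
    simp only [map_mul, map_neg, Complex.conj_conj, Complex.conj_ofReal] at h
    have e := Complex.mul_conj (herm v w)
    have : (0 : ℂ) ≤ ((-2 * ε * Complex.normSq (herm v w) +
        ε ^ 2 * Complex.normSq (herm v w) * r : ℝ) : ℂ) := by
      refine h.trans_eq ?_
      push_cast
      rw [← e]; ring
    exact_mod_cast this
  have hpos : 0 < Complex.normSq (herm v w) := Complex.normSq_pos.2 hne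
  have h1 := key (1 / (r + 1))
  have hr1 : 0 < r + 1 := by linarith
  have : -2 * (1 / (r + 1)) * Complex.normSq (herm v w) +
      (1 / (r + 1)) ^ 2 * Complex.normSq (herm v w) * r =
      -(Complex.normSq (herm v w) * (r + 2) / (r + 1) ^ 2) := by
    field_simp; ring
  rw [this] at h1
  have : 0 < Complex.normSq (herm v w) * (r + 2) / (r + 1) ^ 2 := by positivity
  linarith

theorem twist_mem {n m : ℕ} {S : Submodule ℂ (Phase ℂ n × Phase ℂ m)} (hS : IsLagrangian S)
    (hq : IsQuasiRealLinear S) {v : Phase ℂ n × Phase ℂ m} (hv : v ∈ S) :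
    (v.1.twist, v.2.twist) ∈ S :=
  (isLagrangian_iff.1 hS _).2 fun w hw => by
    have := hq.2 v hv w hw
    rw [chi_eq, chi_eq] at this
    exact this

/-- The vector with the same `z`-coordinates and vanishing `x`-coordinates. -/
def Phase.zpart {n : ℕ} (v : Phase ℂ n) : Phase ℂ n := (v.1, 0)

theorem zpart_mem {n m : ℕ} {S : Submodule ℂ (Phase ℂ n × Phase ℂ m)} (hS : IsLagrangian S)
    (hq : IsQuasiRealLinear S) {v : Phase ℂ n × Phase ℂ m} (hv : v ∈ S) (h0 : herm v v = 0) :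
    (v.1.zpart, v.2.zpart) ∈ S := by
  have hc : (v.1.conj, v.2.conj) ∈ S := (isLagrangian_iff.1 hS _).2 fun w hw => by
    have := herm_eq_zero hq.1 hv hw h0
    exact (mul_eq_zero.1 this).resolve_left Complex.I_ne_zero
  have h := twist_mem hS hq hc
  have := S.smul_mem (1 / 2 : ℂ) (S.add_mem hv h)
  convert this using 1
  ext j <;> simp [Phase.zpart, Phase.twist, Phase.conj] <;> ring

theorem symp_eq_zero_of_snd {n : ℕ} {v w : Phase ℂ n} (hv : v.2 = 0) (hw : w.2 = 0) :
    symp v w = 0 := by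
  simp [symp, hv, hw]

theorem IsPositive.comp {n m k : ℕ} {S : Submodule ℂ (Phase ℂ n × Phase ℂ m)}
    {T : Submodule ℂ (Phase ℂ m × Phase ℂ k)} (hS : IsPositive S) (hT : IsPositive T) :
    IsPositive (linComp S T) := by
  rintro v ⟨q, h1, h2⟩
  refine (add_nonneg (hS _ h1) (hT _ h2)).trans_eq ?_
  simp only [sympRel]; ring

theorem IsQuasiRealLinear.comp {n m k : ℕ} {S : Submodule ℂ (Phase ℂ n × Phase ℂ m)}
    {T : Submodule ℂ (Phase ℂ m × Phase ℂ k)} (hS : IsQuasiRealLinear S)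
    (hT : IsQuasiRealLinear T) : IsQuasiRealLinear (linComp S T) := by
  refine ⟨hS.1.comp hT.1, ?_⟩
  rintro v ⟨q, h1, h2⟩ w ⟨r, h3, h4⟩
  have e1 := hS.2 _ h1 _ h3
  have e2 := hT.2 _ h2 _ h4
  simp only at e1 e2
  linear_combination e1 + e2

theorem IsQuasiReal.comp {n m k : ℕ} {R : Set (Phase ℂ n × Phase ℂ m)}
    {R' : Set (Phase ℂ m × Phase ℂ k)} (h : IsQuasiReal R) (h' : IsQuasiReal R') :
    IsQuasiReal (relComp R R') := by
  rcases Set.eq_empty_or_nonempty (relComp R R') with he | ⟨⟨p, r⟩, q, h1, h2⟩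
  · exact Or.inl he
  right
  obtain rfl | ⟨S, a, hS, hqS, ha1, ha2, rfl⟩ := h
  · exact h1.elim
  obtain rfl | ⟨T, b, hT, hqT, hb1, hb2, rfl⟩ := h'
  · exact h2.elim
  have hC := hS.comp hT
  have hqC := hqS.comp hqT
  have hcomp : relComp {v | v - a ∈ S} {v | v - b ∈ T} = {v | v - (p, r) ∈ linComp S T} := by
    rw [translate_eq S h1, translate_eq T h2, relComp_translate]
  -- the linear composite attains the `x`-coordinates of the point `(p, r)`
  let Z : Submodule ℂ (Phase ℂ n × Phase ℂ k) :=
    { carrier := {u | u.1.2 = 0 ∧ u.2.2 = 0}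
      add_mem' := fun {u v} ⟨h1, h2⟩ ⟨h3, h4⟩ =>
        ⟨show u.1.2 + v.1.2 = 0 by rw [h1, h3, add_zero],
          show u.2.2 + v.2.2 = 0 by rw [h2, h4, add_zero]⟩
      zero_mem' := ⟨rfl, rfl⟩
      smul_mem' := fun c u ⟨h1, h2⟩ =>
        ⟨show c • u.1.2 = 0 by rw [h1, smul_zero], show c • u.2.2 = 0 by rw [h2, smul_zero]⟩ }
  have key : (p, r) ∈ linComp S T ⊔ Z := by
    refine mem_sup_of_orthogonal (sympForm_nondegenerate n k) (sympForm_isRefl n k) _ _ _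
      fun u hu1 hu2 => ?_
    have huC : u ∈ linComp S T := (isLagrangian_iff.1 hC u).2 fun w hw => by
      rw [sympRel_swap, neg_eq_zero]; exact hu1 w hw
    have hu12 : u.1.2 = 0 := by
      funext j
      have := hu2 ((Pi.single j 1, 0), 0) ⟨rfl, rfl⟩
      simpa [sympRel, symp, Pi.single_apply] using this
    have hu22 : u.2.2 = 0 := by
      funext j
      have := hu2 (0, (Pi.single j 1, 0)) ⟨rfl, rfl⟩
      simpa [sympRel, symp, Pi.single_apply] using this
    obtain ⟨y, hy1, hy2⟩ := huC
    have hcz : ∀ {i : ℕ} {v : Phase ℂ i}, v.2 = 0 → symp v.conj v = 0 := fun {i v} hv =>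
      symp_eq_zero_of_snd (by funext j; simp [Phase.conj, hv]) hv
    have p1 := hqS.1 _ hy1
    have p2 := hqT.1 _ hy2
    have y0 : Complex.I * symp y.conj y = 0 := by
      simp only [sympRel, hcz hu12, hcz hu22, sub_zero, zero_sub, mul_neg] at p1 p2
      exact le_antisymm (neg_nonneg.1 p2) p1
    have z1 := zpart_mem hS hqS hy1 (by
      simp only [herm, sympRel, hcz hu12, sub_zero]; exact y0)
    have z2 := zpart_mem hT hqT hy2 (by
      simp only [herm, sympRel, hcz hu22, zero_sub, mul_neg, y0, neg_zero])
    have e1 := hS.isotropic _ z1 _ h1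
    have e2 := hT.isotropic _ z2 _ h2
    have hz : ∀ {i : ℕ} (v w c : Phase ℂ i), c.2 = 0 →
        symp v.zpart (w - c) = symp v.zpart w := fun v w c hc => by
      rw [symp_sub_right, symp_eq_zero_of_snd (v := v.zpart) rfl hc, sub_zero]
    have hzz : ∀ {i : ℕ} (v : Phase ℂ i), v.2 = 0 → v.zpart = v := fun v hv =>
      Prod.ext rfl hv.symm
    simp only [sympRel, Prod.fst_sub, Prod.snd_sub] at e1 e2
    rw [hz _ _ _ ha2.2, hz _ _ _ ha1.2, hzz _ hu12] at e1
    rw [hz _ _ _ hb2.2, hz _ _ _ hb1.2, hzz _ hu22] at e2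
    change sympRel u (p, r) = 0
    simp only [sympRel]
    linear_combination e1 + e2
  obtain ⟨c, hc, z, ⟨hz1, hz2⟩, hcz⟩ := Submodule.mem_sup.1 key
  have hzmem : z - (p, r) ∈ linComp S T := by
    rw [← hcz, sub_add_cancel_right]; exact (linComp S T).neg_mem hc
  have hzR : z ∈ relComp {v | v - a ∈ S} {v | v - b ∈ T} := by rw [hcomp]; exact hzmem
  obtain ⟨y, hy1, hy2⟩ := hzR
  have htw : ∀ {i : ℕ} (v c : Phase ℂ i), IsRealShift c → (v - c).twist = v.twist - c := by
    intro i v c hc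
    have h1 : ∀ j, (starRingEnd ℂ) (c.1 j) = c.1 j := fun j => Complex.conj_eq_iff_im.2 (hc.1 j)
    have h2 := hc.2
    ext j <;> simp [Phase.twist, h1, h2]
  have t1 := twist_mem hS hqS hy1
  have t2 := twist_mem hT hqT hy2
  simp only [Prod.fst_sub, Prod.snd_sub, htw _ _ ha1, htw _ _ ha2, htw _ _ hb1,
    htw _ _ hb2] at t1 t2
  have hz' : (z.1.twist, z.2.twist) - (p, r) ∈ linComp S T := by
    have : (z.1.twist, z.2.twist) ∈ relComp {v | v - a ∈ S} {v | v - b ∈ T} :=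
      ⟨y.twist, t1, t2⟩
    rw [hcomp] at this
    exact this
  let s : Phase ℂ n × Phase ℂ k := (1 / 2 : ℂ) • (z + (z.1.twist, z.2.twist))
  have hs : s - (p, r) ∈ linComp S T := by
    have := (linComp S T).smul_mem (1 / 2 : ℂ) ((linComp S T).add_mem hzmem hz')
    convert this using 1
    simp only [s]
    module
  refine ⟨linComp S T, s, hC, hqC, ⟨fun j => ?_, ?_⟩, ⟨fun j => ?_, ?_⟩, ?_⟩
  · simp [s, Phase.twist]
  · funext j; simp [s, Phase.twist, hz1]
  · simp [s, Phase.twist]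
  · funext j; simp [s, Phase.twist, hz2]
  · rw [hcomp, translate_eq _ hs]

theorem IsQuasiReal.tensor {n m n' m' : ℕ} {R : Set (Phase ℂ n × Phase ℂ m)}
    {R' : Set (Phase ℂ n' × Phase ℂ m')} (h : IsQuasiReal R) (h' : IsQuasiReal R') :
    IsQuasiReal (relTensor R R') := by
  rcases Set.eq_empty_or_nonempty (relTensor R R') with he | ⟨v, h1, h2⟩
  · exact Or.inl he
  right
  obtain rfl | ⟨S, a, hS, hqS, ha1, ha2, rfl⟩ := h
  · exact h1.elim
  obtain rfl | ⟨T, b, hT, hqT, hb1, hb2, rfl⟩ := h'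
  · exact h2.elim
  have happ : ∀ {i j : ℕ} {v : Phase ℂ i} {w : Phase ℂ j}, IsRealShift v → IsRealShift w →
      IsRealShift (Phase.append v w) := fun {i j v w} hv hw => by
    refine ⟨fun l => ?_, funext fun l => ?_⟩
    · refine Fin.addCases (fun l => ?_) (fun l => ?_) l
      · simpa [Phase.append] using hv.1 l
      · simpa [Phase.append] using hw.1 l
    · refine Fin.addCases (fun l => ?_) (fun l => ?_) l
      · simp [Phase.append, hv.2]
      · simp [Phase.append, hw.2]
  refine ⟨_, _, hS.tensor hT, ⟨fun v hv => ?_, fun v hv w hw => ?_⟩, happ ha1 hb1, happ ha2 hb2,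
    relTensor_translate S T a b⟩
  · refine (add_nonneg (hqS.1 _ hv.1) (hqT.1 _ hv.2)).trans_eq ?_
    simp only [sympRel]
    rw [symp_split v.2.conj, symp_split v.1.conj]
    simp only [conj_append]
    ring
  · have e1 := hqS.2 _ hv.1 _ hw.1
    have e2 := hqT.2 _ hv.2 _ hw.2
    simp only at e1 e2
    rw [chi_split v.2, chi_split v.1]
    linear_combination e1 + e2

theorem IsLagrangian.quasiReal {n m : ℕ} {S : Submodule ℂ (Phase ℂ n × Phase ℂ m)}
    (hS : IsLagrangian S) (hq : IsQuasiRealLinear S) :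
    IsQuasiReal (S : Set (Phase ℂ n × Phase ℂ m)) :=
  Or.inr ⟨S, 0, hS, hq, ⟨fun _ => rfl, rfl⟩, ⟨fun _ => rfl, rfl⟩, by ext v; simp⟩

theorem isQuasiRealLinear_linId (n : ℕ) : IsQuasiRealLinear (linId ℂ n) := by
  refine ⟨fun v (hv : v.1 = v.2) => ?_, fun v (hv : v.1 = v.2) w (hw : w.1 = w.2) => ?_⟩
  · simp [sympRel, hv]
  · rw [hv, hw, sub_self]

theorem isQuasiRealLinear_linSymm (n m : ℕ) : IsQuasiRealLinear (linSymm ℂ n m) := by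
  refine ⟨fun v ⟨h1, h2⟩ => ?_, fun v ⟨h1, h2⟩ w ⟨h3, h4⟩ => ?_⟩
  · simp only [sympRel]
    rw [symp_split v.2.conj, symp_split v.1.conj]
    simp only [conj_append, h1, h2]
    exact le_of_eq (by ring)
  · rw [chi_split v.2, chi_split v.1, h1, h2, h3, h4]; ring

theorem isQuasiRealLinear_linCup : IsQuasiRealLinear (linCup ℂ) := by
  refine ⟨fun v ⟨h1, h2⟩ => ?_, fun v ⟨h1, h2⟩ w ⟨h3, h4⟩ => ?_⟩
  · simp only [sympRel, symp, Phase.conj, Fin.sum_univ_two, Finset.univ_eq_empty,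
      Finset.sum_empty, h1, h2, map_neg]
    exact le_of_eq (by ring)
  · simp only [chi, Fin.sum_univ_two, Finset.univ_eq_empty, Finset.sum_empty, h1, h2, h3, h4,
      map_neg]
    ring

theorem isQuasiRealLinear_linCap : IsQuasiRealLinear (linCap ℂ) := by
  refine ⟨fun v ⟨h1, h2⟩ => ?_, fun v ⟨h1, h2⟩ w ⟨h3, h4⟩ => ?_⟩
  · simp only [sympRel, symp, Phase.conj, Fin.sum_univ_two, Finset.univ_eq_empty,
      Finset.sum_empty, h1, h2, map_neg]
    exact le_of_eq (by ring)
  · simp only [chi, Fin.sum_univ_two, Finset.univ_eq_empty, Finset.sum_empty, h1, h2, h3, h4,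
      map_neg]
    ring

end QuasiReal

/-- The compact prop of Gaussian relations: the sub-prop of complex affine Lagrangian relations
whose arrows are quasi-real. -/
noncomputable def GaussRel : CompactProp :=
  (AffLagRel ℂ).sub (fun _ _ R => IsQuasiReal R.1)
    (fun n => (isLagrangian_linId n).quasiReal (isQuasiRealLinear_linId n))
    (fun _ _ _ _ _ h h' => h.comp h')
    (fun _ _ _ _ _ _ h h' => h.tensor h')
    (fun n m => (isLagrangian_linSymm n m).quasiReal (isQuasiRealLinear_linSymm n m))
    (isLagrangian_linCup.quasiReal isQuasiRealLinear_linCup)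
    (isLagrangian_linCap.quasiReal isQuasiRealLinear_linCap)

/-- The set of pairs of phase space vectors underlying a Gaussian relation. -/
def GaussRel.graph {n m : ℕ} (R : GaussRel.Hom n m) : Set (Phase ℂ n × Phase ℂ m) := R.1.1

/-! ### Interpretation of the generators -/

/-- The complex affine Lagrangian relation of a generator.  An affine relation `A` over `ℝ` is
sent to the set of all `((z, x), (z', x'))` such that `(z, z')` lies in the complexification of
`A` and `zᵀ x = z'ᵀ x'` holds for all `(z, z')` in the direction of `A`; the vacuum is sent to
the white spider with phase `(0, i)`. -/
def GGA.interp : ∀ {n m : ℕ}, GGA.Gen n m → Set (Phase ℂ n × Phase ℂ m)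
  | _, _, .affine (.grey _ _) =>
      {p | (∃ c, (∀ i, p.1.1 i = c) ∧ ∀ j, p.2.1 j = c) ∧ ∑ i, p.1.2 i = ∑ j, p.2.2 j}
  | _, _, .affine (.white _ _ a) =>
      {p | ∑ i, p.1.1 i + ∑ j, p.2.1 j = (a : ℂ) ∧
        ∃ c, (∀ i, p.1.2 i = c) ∧ ∀ j, p.2.2 j = -c}
  | _, _, .affine (.scalar a) => {p | p.2.1 0 = (a : ℂ) * p.1.1 0 ∧ p.1.2 0 = (a : ℂ) * p.2.2 0}
  | _, _, .vacuum => {p | p.2.1 0 = Complex.I * p.2.2 0}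

-- A diagram is sent to the relation obtained by evaluating it on the relations `GGA.interp` of the
-- generators. The equations hold in `PhaseRel ℂ` by computation in coordinates (`rel_sound`), and
-- the generators are quasi-real (`isQuasiReal_interp`). So evaluation descends to a
-- structure-preserving map `sem` with the prescribed values on generators, and only bijectivity is
-- left. Both props have cups and caps, so bending wires (`unbend_bend`) reduces bijectivity to
-- states, the arrows `0 → n` (`bijective_sem`).
--
-- States on `n` wires form a commutative monoid under addition of values, on which matrices act by
-- homomorphisms. The normal form `nf L K a` is a sum of one vacuum along each vector of `L`, one
-- free line along each vector of `K`, and the point `a`. It stands for the Gaussian with mean `a`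
-- and covariance `∑ v vᵀ` over `L`, left undetermined along the span of `K`. Every state is of this
-- form or inconsistent (`nf_state`), because all the structure preserves this class. The building
-- blocks are linear arrows, the adjunction of a new summand, and one effect: conditioning a wire to
-- be zero (`good_test`). If a line moves that wire, it clears the wire from all other summands,
-- since a free value absorbs whatever is added to it. Otherwise the vacua are rotated until at most
-- one of them moves the wire. A single summand moving the wire is solved for and disappears into
-- the mean. If none moves it, the test yields a scalar, trivial or inconsistent.
--
-- Injectivity: `nf L K a` depends only on the span of `K`, on `a` modulo that span, and on the
-- covariance restricted to the orthogonal complement of `K` (`nf_congr`). Lines absorb their span,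
-- and rotations identify families of vacua with equal Gram matrices (`nu_sum_congr`). The relation
-- of `nf L K a` consists of the `(z, x)` with `x ⊥ K` and `z - a - i Σ x` in the complex span of
-- `K`, where `Σ` is the covariance (`den_nf`). Evaluating it at `x = 0` and at real `x ⊥ K`
-- recovers exactly these data (`nf_eq_of_gauss_eq`).
--
-- Surjectivity: a quasi-real Lagrangian state is stable under `(z, x) ↦ (z̄, -x̄)`. Hence its part
-- with `x = 0` is the complexification of a real space `D`, and over every real `x ⊥ D` it contains
-- some `(i y, x)` with `y` real. Isotropy makes the resulting form `y · x'` symmetric and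
-- positivity makes it positive semidefinite. A Gram factorisation of this form gives `L`, and a
-- spanning set of `D` gives `K` (`exists_gaussSub`).

local notation:75 f:75 " ⊠ " g:76 => (CompactProp.tensor _ f g :)
local notation:70 f:70 " ⟫ " g:71 => (CompactProp.comp _ f g :)

open CompactProp
open scoped ComplexOrder

/-! ### The symmetric monoidal category underlying a compact prop -/

namespace CompactProp

open CategoryTheory MonoidalCategory

variable {P : CompactProp}

/-- The identity arrow read as an arrow between equal objects. -/
def idCast (P : CompactProp) {n m : ℕ} (h : n = m) : P.Hom n m := castHom P.Hom rfl h (P.id n)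

theorem idCast_rfl {n : ℕ} (h : n = n) : P.idCast h = P.id n := rfl

theorem idCast_comp {n m k : ℕ} (h : n = m) (h' : m = k) :
    P.comp (P.idCast h) (P.idCast h') = P.idCast (h.trans h') := by
  subst h h'; exact P.id_comp _

theorem idCast_tensor {n m n' m' : ℕ} (h : n = m) (h' : n' = m') :
    P.tensor (P.idCast h) (P.idCast h') = P.idCast (congrArg₂ (· + ·) h h') := by
  subst h h'; exact P.tensor_id _ _

/-- Transport becomes composition with arrows `idCast`, so that the strict laws turn into naturality
and coherence laws with `idCast` as associator and left unitor. -/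
theorem castHom_eq {n n' m m' : ℕ} (hn : n = n') (hm : m = m') (f : P.Hom n m) :
    castHom P.Hom hn hm f = P.comp (P.comp (P.idCast hn.symm) f) (P.idCast hm) := by
  subst hn hm
  exact ((P.comp_id _).trans (P.id_comp _)).symm

theorem tensor_assoc_idCast {n m n' m' n'' m'' : ℕ} (f : P.Hom n m) (g : P.Hom n' m')
    (h : P.Hom n'' m'') :
    P.comp (P.tensor (P.tensor f g) h) (P.idCast (Nat.add_assoc m m' m'')) =
      P.comp (P.idCast (Nat.add_assoc n n' n'')) (P.tensor f (P.tensor g h)) := by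
  rw [← P.tensor_assoc f g h, castHom_eq, P.comp_assoc, ← P.comp_assoc, ← P.comp_assoc,
    idCast_comp, idCast_rfl, P.id_comp]

/-- The objects of a compact prop. -/
def Wires (_ : CompactProp) : Type := ℕ

instance wiresCategory (P : CompactProp) : Category (Wires P) where
  Hom n m := P.Hom n m
  id n := P.id n
  comp f g := P.comp f g
  id_comp := P.id_comp
  comp_id := P.comp_id
  assoc := P.comp_assoc

/-- The right unitor is a plain identity because `n + 0` reduces to `n`; `0 + n = n` and
associativity are only propositional equalities and need `idCast`. -/
instance wiresMonoidalStruct (P : CompactProp) : MonoidalCategoryStruct (Wires P) where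
  tensorObj (n m : ℕ) := (n + m : ℕ)
  whiskerLeft n _ _ f := P.tensor (P.id n) f
  whiskerRight f n := P.tensor f (P.id n)
  tensorHom f g := P.tensor f g
  tensorUnit := (0 : ℕ)
  associator (n m k : ℕ) :=
    { hom := P.idCast (Nat.add_assoc n m k)
      inv := P.idCast (Nat.add_assoc n m k).symm
      hom_inv_id := P.idCast_comp _ _
      inv_hom_id := P.idCast_comp _ _ }
  leftUnitor (n : ℕ) :=
    { hom := P.idCast (Nat.zero_add n)
      inv := P.idCast (Nat.zero_add n).symm
      hom_inv_id := P.idCast_comp _ _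
      inv_hom_id := P.idCast_comp _ _ }
  rightUnitor (n : ℕ) :=
    { hom := P.id n
      inv := P.id n
      hom_inv_id := P.id_comp _
      inv_hom_id := P.id_comp _ }

theorem id_tensor_idCast {n m : ℕ} (f : P.Hom n m) :
    P.comp (P.tensor (P.id 0) f) (P.idCast (Nat.zero_add m)) =
      P.comp (P.idCast (Nat.zero_add n)) f := by
  conv_rhs => rw [← P.id_tensor f]
  rw [castHom_eq, P.comp_assoc, ← P.comp_assoc, ← P.comp_assoc,
    idCast_comp, idCast_rfl, P.id_comp]

theorem pentagon_idCast (a b c d : ℕ) :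
    P.comp (P.tensor (P.idCast (Nat.add_assoc a b c)) (P.id d))
        (P.comp (P.idCast (Nat.add_assoc a (b + c) d))
          (P.tensor (P.id a) (P.idCast (Nat.add_assoc b c d)))) =
      P.comp (P.idCast (Nat.add_assoc (a + b) c d)) (P.idCast (Nat.add_assoc a b (c + d))) := by
  rw [← idCast_rfl (rfl : a = a), ← idCast_rfl (rfl : d = d), idCast_tensor, idCast_tensor,
    idCast_comp, idCast_comp, idCast_comp]

theorem triangle_idCast (a b : ℕ) :
    P.comp (P.idCast (Nat.add_assoc a 0 b)) (P.tensor (P.id a) (P.idCast (Nat.zero_add b))) =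
      P.tensor (P.id a) (P.id b) := by
  rw [← idCast_rfl (rfl : a = a), ← idCast_rfl (rfl : b = b), idCast_tensor, idCast_tensor,
    idCast_comp]

instance wiresMonoidal (P : CompactProp) : MonoidalCategory (Wires P) :=
  MonoidalCategory.ofTensorHom
    (id_tensorHom_id := fun n m => P.tensor_id n m)
    (id_tensorHom := fun _ _ _ _ => rfl)
    (tensorHom_id := fun _ _ => rfl)
    (tensorHom_comp_tensorHom := fun f g f' g' => (P.tensor_comp f f' g g').symm)
    (associator_naturality := fun f g h => tensor_assoc_idCast f g h)
    (leftUnitor_naturality := fun f => id_tensor_idCast f)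
    (rightUnitor_naturality := fun f =>
      (P.comp_id _).trans ((P.tensor_id_zero f).trans (P.id_comp f).symm))
    (pentagon := fun a b c d => pentagon_idCast a b c d)
    (triangle := fun a b => triangle_idCast a b)

theorem hexagon_idCast (n m k : ℕ) :
    P.comp (P.idCast (Nat.add_assoc n m k))
        (P.comp (P.symm n (m + k)) (P.idCast (Nat.add_assoc m k n))) =
      P.comp (P.tensor (P.symm n m) (P.id k)) (P.comp (P.idCast (Nat.add_assoc m n k))
        (P.tensor (P.id m) (P.symm n k))) := by
  rw [P.hexagon n m k, castHom_eq, castHom_eq]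
  simp only [P.comp_assoc, idCast_comp, idCast_rfl, P.comp_id]
  rw [← P.comp_assoc, idCast_comp, idCast_rfl, P.id_comp]

theorem eq_of_inverse {n m : ℕ} {f g : P.Hom n m} {f' g' : P.Hom m n}
    (hf : P.comp f f' = P.id n) (hg : P.comp g' g = P.id m) (h : f = g) : f' = g' := by
  rw [← P.id_comp f', ← hg, P.comp_assoc, ← h, hf, P.comp_id]

/-- The two sides are inverse to the two sides of the first hexagon at `(k, n, m)`, and inverses are
unique. -/
theorem hexagon_idCast' (n m k : ℕ) :
    P.comp (P.idCast (Nat.add_assoc n m k).symm)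
        (P.comp (P.symm (n + m) k) (P.idCast (Nat.add_assoc k n m).symm)) =
      P.comp (P.tensor (P.id n) (P.symm m k)) (P.comp (P.idCast (Nat.add_assoc n k m).symm)
        (P.tensor (P.symm n k) (P.id m))) := by
  refine eq_of_inverse ?_ ?_ (P.hexagon_idCast k n m)
  · rw [P.comp_assoc, P.comp_assoc, ← P.comp_assoc (P.idCast _) (P.idCast _), idCast_comp,
      idCast_rfl, P.id_comp, ← P.comp_assoc (P.symm _ _), P.symm_symm, P.id_comp, idCast_comp,
      idCast_rfl]
  · rw [P.comp_assoc, P.comp_assoc, ← P.comp_assoc (P.tensor (P.symm n k) _), ← P.tensor_comp,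
      P.symm_symm, P.id_comp, P.tensor_id, P.id_comp, ← P.comp_assoc (P.idCast _), idCast_comp,
      idCast_rfl, P.id_comp, ← P.tensor_comp, P.id_comp, P.symm_symm, P.tensor_id]

instance wiresBraided (P : CompactProp) : BraidedCategory (Wires P) where
  braiding (n m : ℕ) := ⟨P.symm n m, P.symm m n, P.symm_symm n m, P.symm_symm m n⟩
  braiding_naturality_right (n : ℕ) _ _ f := P.symm_natural (P.id n) f
  braiding_naturality_left f (n : ℕ) := P.symm_natural f (P.id n)
  hexagon_forward n m k := P.hexagon_idCast n m k
  hexagon_reverse n m k := P.hexagon_idCast' n m k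

instance wiresSymmetric (P : CompactProp) : SymmetricCategory (Wires P) where
  symmetry n m := P.symm_symm n m

end CompactProp

/-! ### Bending wires -/

namespace CompactProp

variable {P : CompactProp}

/-- The unit law of the symmetry is not among the axioms of a compact prop; in a braided category it
follows from the hexagons. -/
theorem symm_zero_right (n : ℕ) : P.symm n 0 = P.idCast (Nat.zero_add n).symm :=
  (CategoryTheory.braiding_tensorUnit_right (C := Wires P) n).trans (P.id_comp _)

theorem symm_zero_left (n : ℕ) : P.symm 0 n = P.idCast (Nat.zero_add n) :=
  (CategoryTheory.braiding_tensorUnit_left (C := Wires P) n).trans (P.comp_id _)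

theorem tensor_eq_left {n m n' m' : ℕ} (f : P.Hom n m) (g : P.Hom n' m') :
    f ⊠ g = (f ⊠ P.id n') ⟫ (P.id m ⊠ g) := by
  rw [← P.tensor_comp, P.comp_id, P.id_comp]

theorem tensor_eq_right {n m n' m' : ℕ} (f : P.Hom n m) (g : P.Hom n' m') :
    f ⊠ g = (P.id n ⊠ g) ⟫ (f ⊠ P.id m') := by
  rw [← P.tensor_comp, P.comp_id, P.id_comp]

theorem comp_tensor_id {n m k : ℕ} (f : P.Hom n m) (g : P.Hom m k) (l : ℕ) :
    (f ⟫ g) ⊠ P.id l = (f ⊠ P.id l) ⟫ (g ⊠ P.id l) := by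
  rw [← P.tensor_comp, P.comp_id]

theorem id_tensor_comp {n m k : ℕ} (f : P.Hom n m) (g : P.Hom m k) (l : ℕ) :
    P.id l ⊠ (f ⟫ g) = (P.id l ⊠ f) ⟫ (P.id l ⊠ g) := by
  rw [← P.tensor_comp, P.comp_id]

/-- Bending the last output to the input side. -/
def unbend {n m : ℕ} (f : P.Hom n (m + 1)) : P.Hom (n + 1) m :=
  (f ⊠ P.id 1) ⟫ (P.id m ⊠ P.cap)

/-- Bending the last input to the output side. -/
def bend {n m : ℕ} (f : P.Hom (n + 1) m) : P.Hom n (m + 1) :=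
  (P.id n ⊠ P.cup) ⟫ (f ⊠ P.id 1)

/-- By interchange the cap slides past `f` and meets the cup, where a snake equation straightens the
wire. -/
theorem unbend_bend {n m : ℕ} (f : P.Hom (n + 1) m) : unbend (bend f) = f := by
  have e1 : f ⊠ P.id 1 ⊠ P.id 1 = f ⊠ P.id 2 := by
    rw [← P.tensor_id 1 1]; exact P.tensor_assoc f (P.id 1) (P.id 1)
  have e2 : P.id n ⊠ P.cup ⊠ P.id 1 = P.id n ⊠ (P.cup ⊠ P.id 1) :=
    P.tensor_assoc (P.id n) P.cup (P.id 1)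
  have e3 : P.id (n + 1) ⊠ P.cap = P.id n ⊠ (P.id 1 ⊠ P.cap) := by
    rw [← P.tensor_id n 1]; exact P.tensor_assoc (P.id n) (P.id 1) P.cap
  unfold unbend bend
  rw [comp_tensor_id, P.comp_assoc, e1, ← tensor_eq_left f P.cap, tensor_eq_right f P.cap,
    P.tensor_id_zero, ← P.comp_assoc, e2, e3, ← id_tensor_comp]
  rw [P.snake_left, P.tensor_id, P.id_comp]

theorem unbend_comp_right {n m m' : ℕ} (f : P.Hom n (m + 1)) (h : P.Hom m m') :
    unbend (f ⟫ (h ⊠ P.id 1)) = unbend f ⟫ h := by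
  have e1 : h ⊠ P.id 1 ⊠ P.id 1 = h ⊠ P.id 2 := by
    rw [← P.tensor_id 1 1]; exact P.tensor_assoc h (P.id 1) (P.id 1)
  unfold unbend
  rw [comp_tensor_id, P.comp_assoc, e1, ← tensor_eq_left h P.cap, tensor_eq_right h P.cap,
    ← P.comp_assoc, P.tensor_id_zero]

theorem unbend_comp_left {n' n m : ℕ} (h : P.Hom n' n) (f : P.Hom n (m + 1)) :
    unbend (h ⟫ f) = (h ⊠ P.id 1) ⟫ unbend f := by
  unfold unbend
  rw [comp_tensor_id, P.comp_assoc]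

/-- Naturality moves the cap across the third wire through `symm 1 2`, which factors by the hexagon
into two swaps; one of them cancels. -/
theorem symm_cap_slide :
    (P.symm 1 1 ⊠ P.id 1) ⟫ (P.id 1 ⊠ P.cap) = (P.id 1 ⊠ P.symm 1 1) ⟫ (P.cap ⊠ P.id 1) := by
  have h1 : (P.id 1 ⊠ P.cap) ⟫ P.symm 1 0 = P.symm 1 2 ⟫ (P.cap ⊠ P.id 1) :=
    P.symm_natural (P.id 1) P.cap
  have h2 : P.symm 1 2 = (P.symm 1 1 ⊠ P.id 1) ⟫ (P.id 1 ⊠ P.symm 1 1) := P.hexagon 1 1 1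
  have h3 : P.symm 1 0 = P.id 1 := P.symm_zero_right 1
  rw [h3, P.comp_id] at h1
  rw [h1, h2, ← P.comp_assoc, ← P.comp_assoc, ← comp_tensor_id, P.symm_symm, P.tensor_id,
    P.id_comp]

/-- The nested cap on four wires. -/
def nestedCap (P : CompactProp) : P.Hom 4 0 := (P.id 1 ⊠ P.cap ⊠ P.id 1) ⟫ P.cap

theorem nestedCap_swap :
    (P.symm 1 1 ⊠ P.id 2) ⟫ P.nestedCap = (P.id 2 ⊠ P.symm 1 1) ⟫ P.nestedCap := by
  have e1 : P.symm 1 1 ⊠ P.id 2 = P.symm 1 1 ⊠ P.id 1 ⊠ P.id 1 := by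
    rw [← P.tensor_id 1 1]; exact (P.tensor_assoc (P.symm 1 1) (P.id 1) (P.id 1)).symm
  have e2 : P.id 2 ⊠ P.symm 1 1 = P.id 1 ⊠ (P.id 1 ⊠ P.symm 1 1) := by
    rw [← P.tensor_id 1 1]; exact P.tensor_assoc (P.id 1) (P.id 1) (P.symm 1 1)
  have e3 : P.id 1 ⊠ P.cap ⊠ P.id 1 = P.id 1 ⊠ (P.cap ⊠ P.id 1) :=
    P.tensor_assoc (P.id 1) P.cap (P.id 1)
  have e4 : P.cap ⊠ P.id 1 ⊠ P.id 1 = P.cap ⊠ P.id 2 := by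
    rw [← P.tensor_id 1 1]; exact P.tensor_assoc P.cap (P.id 1) (P.id 1)
  have e5 : P.id 1 ⊠ (P.id 1 ⊠ P.cap) = P.id 2 ⊠ P.cap := by
    rw [← P.tensor_id 1 1]; exact (P.tensor_assoc (P.id 1) (P.id 1) P.cap).symm
  have e6 : P.id 1 ⊠ (P.symm 1 1 ⊠ P.id 1) = P.id 1 ⊠ P.symm 1 1 ⊠ P.id 1 :=
    (P.tensor_assoc (P.id 1) (P.symm 1 1) (P.id 1)).symm
  have e7 : P.id 0 ⊠ P.cap = P.cap := P.id_tensor P.cap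
  have h1 : (P.cap ⊠ P.id 2) ⟫ P.cap = P.cap ⊠ P.cap := by
    conv_rhs => rw [tensor_eq_left, e7]
  have h2 : (P.id 2 ⊠ P.cap) ⟫ P.cap = P.cap ⊠ P.cap := by
    conv_rhs => rw [tensor_eq_right, P.tensor_id_zero]
  have l1 : (P.symm 1 1 ⊠ P.id 2) ⟫ P.nestedCap =
      (P.id 1 ⊠ P.symm 1 1 ⊠ P.id 1) ⟫ (P.cap ⊠ P.cap) := by
    unfold nestedCap
    rw [e1, ← P.comp_assoc, ← comp_tensor_id, symm_cap_slide, comp_tensor_id, P.comp_assoc, e4, h1]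
  rw [l1]
  unfold nestedCap
  rw [e2, e3, ← P.comp_assoc, ← id_tensor_comp, ← symm_cap_slide, id_tensor_comp, P.comp_assoc, e5,
    h2, e6]

theorem unbend_unbend {n m : ℕ} (f : P.Hom n (m + 2)) :
    unbend (unbend f) = (f ⊠ P.id 2) ⟫ (P.id m ⊠ P.nestedCap) := by
  have e1 : f ⊠ P.id 1 ⊠ P.id 1 = f ⊠ P.id 2 := by
    rw [← P.tensor_id 1 1]; exact P.tensor_assoc f (P.id 1) (P.id 1)
  have e2 : P.id (m + 1) ⊠ P.cap ⊠ P.id 1 = P.id m ⊠ (P.id 1 ⊠ P.cap ⊠ P.id 1) := by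
    have : P.id (m + 1) ⊠ P.cap = P.id m ⊠ (P.id 1 ⊠ P.cap) := by
      rw [← P.tensor_id m 1]; exact P.tensor_assoc (P.id m) (P.id 1) P.cap
    rw [this]
    exact P.tensor_assoc (P.id m) (P.id 1 ⊠ P.cap) (P.id 1)
  unfold unbend nestedCap
  rw [comp_tensor_id, e1, e2, P.comp_assoc, ← id_tensor_comp]

/-- Swapping two outputs before bending them is swapping the two resulting inputs. This carries the
flexsymmetry axioms, stated for outputs only, over to inputs. -/
theorem unbend_unbend_swap {n m : ℕ} (f : P.Hom n (m + 2)) :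
    unbend (unbend (f ⟫ (P.id m ⊠ P.symm 1 1))) =
      (P.id n ⊠ P.symm 1 1) ⟫ unbend (unbend f) := by
  have e1 : P.id m ⊠ P.symm 1 1 ⊠ P.id 2 = P.id m ⊠ (P.symm 1 1 ⊠ P.id 2) :=
    P.tensor_assoc (P.id m) (P.symm 1 1) (P.id 2)
  have e2 : P.id m ⊠ (P.id 2 ⊠ P.symm 1 1) = P.id (m + 2) ⊠ P.symm 1 1 := by
    rw [← P.tensor_id m 2]; exact (P.tensor_assoc (P.id m) (P.id 2) (P.symm 1 1)).symm
  rw [unbend_unbend, unbend_unbend, comp_tensor_id, P.comp_assoc, e1, ← id_tensor_comp,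
    nestedCap_swap, id_tensor_comp, e2, ← P.comp_assoc, ← P.comp_assoc, ← tensor_eq_left f,
    ← tensor_eq_right f]

end CompactProp

/-! ### Gaussian algebras in a compact prop -/

/-- A model of the equations of graphical Gaussian algebra in a compact prop. -/
structure GaussAlg (P : CompactProp) where
  grey (n m : ℕ) : P.Hom n m
  white (n m : ℕ) (a : ℝ) : P.Hom n m
  scal (a : ℝ) : P.Hom 1 1
  vacuum : P.Hom 0 1
  grey_swap (n a b : ℕ) :
    grey n (a + 2 + b) ⟫ (P.id a ⊠ P.symm 1 1 ⊠ P.id b) = grey n (a + 2 + b)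
  grey_bend (n m : ℕ) : bend (grey (n + 1) m) = grey n (m + 1)
  white_swap (n a b : ℕ) (c : ℝ) :
    white n (a + 2 + b) c ⟫ (P.id a ⊠ P.symm 1 1 ⊠ P.id b) = white n (a + 2 + b) c
  white_bend (n m : ℕ) (a : ℝ) : bend (white (n + 1) m a) = white n (m + 1) a
  grey_fuse (n m k : ℕ) : grey n (m + 1) ⟫ (P.id m ⊠ grey 1 k) = grey n (m + k)
  grey_bone : grey 0 1 ⟫ grey 1 0 = P.id 0
  grey_id : grey 1 1 = P.id 1
  grey_cup : grey 0 2 = P.cup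
  grey_cap : grey 2 0 = P.cap
  white_fuse (n m k : ℕ) (a b : ℝ) :
    white n (m + 1) a ⟫ (P.id m ⊠ (scal (-1) ⟫ white 1 k b)) = white n (m + k) (a + b)
  white_bone : white 0 1 0 ⟫ white 1 0 0 = P.id 0
  white_antipode : white 1 1 0 = scal (-1)
  bialgebra : white 2 1 0 ⟫ grey 1 2 =
    (grey 1 2 ⊠ grey 1 2) ⟫ (P.id 1 ⊠ P.symm 1 1 ⊠ P.id 1) ⟫ (white 2 1 0 ⊠ white 2 1 0)
  white_discard : white 2 1 0 ⟫ grey 1 0 = grey 1 0 ⊠ grey 1 0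
  point_copy (a : ℝ) : white 0 1 a ⟫ grey 1 2 = white 0 1 a ⊠ white 0 1 a
  point_discard (a : ℝ) : white 0 1 a ⟫ grey 1 0 = P.id 0
  scal_one : scal 1 = P.id 1
  scal_zero : scal 0 = grey 1 0 ⟫ white 0 1 0
  scal_mul (a b : ℝ) : scal a ⟫ scal b = scal (a * b)
  scal_add (a b : ℝ) :
    grey 1 2 ⟫ (scal a ⊠ scal b) ⟫ (white 2 1 0 ⟫ scal (-1)) = scal (a + b)
  scal_copy (a : ℝ) : scal a ⟫ grey 1 2 = grey 1 2 ⟫ (scal a ⊠ scal a)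
  scal_discard (a : ℝ) : scal a ⟫ grey 1 0 = grey 1 0
  scal_white (a : ℝ) : (scal a ⊠ scal a) ⟫ white 2 1 0 = white 2 1 0 ⟫ scal a
  scal_point (a b : ℝ) : white 0 1 b ⟫ scal a = white 0 1 (a * b)
  scal_inv (c : ℝ) (hc : c ≠ 0) :
    (P.id 1 ⊠ P.cup) ⟫ (P.id 1 ⊠ scal c ⊠ P.id 1) ⟫ (P.cap ⊠ P.id 1) = scal c⁻¹
  empty (c : ℝ) (hc : c ≠ 0) :
    white 0 0 c ⊠ P.id 1 = white 0 0 c ⊠ (grey 1 0 ⟫ grey 0 1)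
  vacuum_rotation (θ : ℝ) (h₀ : 0 ≤ θ) (h₁ : θ < 2 * Real.pi) :
    (vacuum ⊠ vacuum) ⟫ ((grey 1 2 ⊠ grey 1 2) ⟫ (scal (Real.cos θ) ⊠ scal (Real.sin θ) ⊠
        scal (-Real.sin θ) ⊠ scal (Real.cos θ)) ⟫ (P.id 1 ⊠ P.symm 1 1 ⊠ P.id 1) ⟫
        ((white 2 1 0 ⟫ scal (-1)) ⊠ (white 2 1 0 ⟫ scal (-1)))) =
      vacuum ⊠ vacuum
  vacuum_point (v : ℝ) : vacuum ⟫ white 1 0 v = P.id 0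
  vacuum_discard : vacuum ⟫ grey 1 0 = P.id 0

namespace GaussAlg

variable {P : CompactProp} (A : GaussAlg P)

/-- Copying. -/
def copy : P.Hom 1 2 := A.grey 1 2

/-- Discarding. -/
def disc : P.Hom 1 0 := A.grey 1 0

/-- The free wire. -/
def free : P.Hom 0 1 := A.grey 0 1

/-- Addition. -/
def add : P.Hom 2 1 := A.white 2 1 0 ⟫ A.scal (-1)

/-- The point with a given value. -/
def point (a : ℝ) : P.Hom 0 1 := A.white 0 1 a

/-- The test for a given value. -/
def test (a : ℝ) : P.Hom 1 0 := A.white 1 0 a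

theorem unbend_grey (n m : ℕ) : unbend (A.grey n (m + 1)) = A.grey (n + 1) m := by
  rw [← A.grey_bend, unbend_bend]

theorem unbend_white (n m : ℕ) (a : ℝ) : unbend (A.white n (m + 1) a) = A.white (n + 1) m a := by
  rw [← A.white_bend, unbend_bend]

/-- The spider is bent out of `white 0 3 0`, whose outputs may be permuted. -/
theorem symm_comp_white : P.symm 1 1 ⟫ A.white 2 1 0 = A.white 2 1 0 := by
  -- The swap exchanges the last two of the three outputs, the ones that get bent.
  have h := A.white_swap 0 1 0 0
  have e1 : P.id 1 ⊠ P.symm 1 1 ⊠ P.id 0 = P.id 1 ⊠ P.symm 1 1 := P.tensor_id_zero _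
  have e2 : P.id 0 ⊠ P.symm 1 1 = P.symm 1 1 := P.id_tensor (P.symm 1 1)
  have h2 := congrArg (fun f => unbend (unbend f)) ((congrArg (A.white 0 3 0 ⟫ ·) e1).symm.trans h)
  have h3 := unbend_unbend_swap (A.white 0 3 0)
  rw [e2] at h3
  have e3 : unbend (A.white 0 3 0) = A.white 1 2 0 := A.unbend_white 0 2 0
  have e4 : unbend (A.white 1 2 0) = A.white 2 1 0 := A.unbend_white 1 1 0
  rw [e3, e4] at h3
  rw [← h3]
  refine h2.trans ?_
  exact (congrArg unbend e3).trans e4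

theorem symm_comp_grey : P.symm 1 1 ⟫ A.grey 2 1 = A.grey 2 1 := by
  have h := A.grey_swap 0 1 0
  have e1 : P.id 1 ⊠ P.symm 1 1 ⊠ P.id 0 = P.id 1 ⊠ P.symm 1 1 := P.tensor_id_zero _
  have e2 : P.id 0 ⊠ P.symm 1 1 = P.symm 1 1 := P.id_tensor (P.symm 1 1)
  have h2 := congrArg (fun f => unbend (unbend f)) ((congrArg (A.grey 0 3 ⟫ ·) e1).symm.trans h)
  have h3 := unbend_unbend_swap (A.grey 0 3)
  rw [e2] at h3
  have e3 : unbend (A.grey 0 3) = A.grey 1 2 := A.unbend_grey 0 2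
  have e4 : unbend (A.grey 1 2) = A.grey 2 1 := A.unbend_grey 1 1
  rw [e3, e4] at h3
  rw [← h3]
  refine h2.trans ?_
  exact (congrArg unbend e3).trans e4

theorem symm_comp_add : P.symm 1 1 ⟫ A.add = A.add := by
  unfold add
  rw [← P.comp_assoc, symm_comp_white]

theorem grey_comp_symm : A.grey 1 2 ⟫ P.symm 1 1 = A.grey 1 2 := by
  have h := A.grey_swap 1 0 0
  have e1 : P.id 0 ⊠ P.symm 1 1 ⊠ P.id 0 = P.symm 1 1 :=
    (P.tensor_id_zero _).trans (P.id_tensor (P.symm 1 1))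
  exact (congrArg (A.grey 1 2 ⟫ ·) e1).symm.trans h

theorem white_comp_symm (a : ℝ) : A.white 1 2 a ⟫ P.symm 1 1 = A.white 1 2 a := by
  have h := A.white_swap 1 0 0 a
  have e1 : P.id 0 ⊠ P.symm 1 1 ⊠ P.id 0 = P.symm 1 1 :=
    (P.tensor_id_zero _).trans (P.id_tensor (P.symm 1 1))
  exact (congrArg (A.white 1 2 a ⟫ ·) e1).symm.trans h

theorem symm_one_two : P.symm 1 2 = (P.symm 1 1 ⊠ P.id 1) ⟫ (P.id 1 ⊠ P.symm 1 1) :=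
  P.hexagon 1 1 1

theorem grey_three_comp_symm : A.grey 1 3 ⟫ P.symm 1 2 = A.grey 1 3 := by
  have h1 : A.grey 1 3 ⟫ (P.symm 1 1 ⊠ P.id 1) = A.grey 1 3 := by
    have e : P.id 0 ⊠ P.symm 1 1 = P.symm 1 1 := P.id_tensor (P.symm 1 1)
    have := A.grey_swap 1 0 1
    rwa [e] at this
  have h2 : A.grey 1 3 ⟫ (P.id 1 ⊠ P.symm 1 1) = A.grey 1 3 := by
    have e : P.id 1 ⊠ P.symm 1 1 ⊠ P.id 0 = P.id 1 ⊠ P.symm 1 1 := P.tensor_id_zero _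
    have := A.grey_swap 1 1 0
    rwa [e] at this
  rw [symm_one_two, ← P.comp_assoc, h1, h2]

theorem copy_symm : A.copy ⟫ P.symm 1 1 = A.copy := A.grey_comp_symm

theorem copy_copy_right : A.copy ⟫ (P.id 1 ⊠ A.copy) = A.grey 1 3 := A.grey_fuse 1 1 2

/-- Fusion is an axiom on the last leg only; naturality of the symmetry moves it to the first. -/
theorem copy_copy_left : A.copy ⟫ (A.copy ⊠ P.id 1) = A.grey 1 3 := by
  have h : (P.id 1 ⊠ A.copy) ⟫ P.symm 1 2 = P.symm 1 1 ⟫ (A.copy ⊠ P.id 1) :=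
    P.symm_natural (P.id 1) A.copy
  conv_lhs => rw [← A.copy_symm]
  rw [P.comp_assoc, A.copy_symm, ← h, ← P.comp_assoc, copy_copy_right, grey_three_comp_symm]

theorem copy_disc_right : A.copy ⟫ (P.id 1 ⊠ A.disc) = P.id 1 :=
  (A.grey_fuse 1 1 0).trans A.grey_id

theorem copy_disc_left : A.copy ⟫ (A.disc ⊠ P.id 1) = P.id 1 := by
  have h : (P.id 1 ⊠ A.disc) ⟫ P.symm 1 0 = P.symm 1 1 ⟫ (A.disc ⊠ P.id 1) :=
    P.symm_natural (P.id 1) A.disc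
  have h3 : P.symm 1 0 = P.id 1 := P.symm_zero_right 1
  rw [h3, P.comp_id] at h
  rw [← A.copy_symm, P.comp_assoc, ← h, copy_disc_right]

/-- Iterated copying is the spider with four outputs, which ignores permutations of its legs. -/
theorem copy_middle :
    A.copy ⟫ (A.copy ⊠ A.copy) ⟫ (P.id 1 ⊠ P.symm 1 1 ⊠ P.id 1) =
      A.copy ⟫ (A.copy ⊠ A.copy) := by
  have h : A.copy ⟫ (A.copy ⊠ A.copy) = A.grey 1 4 := by
    rw [tensor_eq_left, ← P.comp_assoc, copy_copy_left]
    exact A.grey_fuse 1 2 2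
  rw [h]
  exact A.grey_swap 1 1 1

/-- Fusion requires an antipode on the joining wire; here it is free of charge, since `-1 * 0 = 0`.
-/
theorem white_zero_comp : A.white 0 1 0 ⟫ A.white 1 2 0 = A.white 0 2 0 := by
  have h := A.white_fuse 0 0 2 0 0
  have e : P.id 0 ⊠ (A.scal (-1) ⟫ A.white 1 2 0) = A.scal (-1) ⟫ A.white 1 2 0 :=
    P.id_tensor (A.scal (-1) ⟫ A.white 1 2 0)
  have e2 : A.white 0 1 0 ⟫ A.scal (-1) = A.white 0 1 0 := by rw [A.scal_point, mul_zero]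
  rw [e] at h
  rw [add_zero] at h
  rw [← e2, P.comp_assoc]
  exact h

theorem scal_neg_one_comp : A.scal (-1) ⟫ A.scal (-1) = P.id 1 := by
  rw [A.scal_mul, ← A.scal_one]; norm_num

/-- White spiders fuse along an antipode, and the antipode inside `add` is that one. Fusion is
performed with two of the legs as outputs, where the axiom applies, and these legs are then bent
back. -/
theorem white_add : (A.add ⊠ P.id 1) ⟫ A.white 2 1 0 = A.white 3 1 0 := by
  have e1 : A.white 1 2 0 ⟫ ((A.scal (-1) ⟫ A.white 1 2 0) ⊠ P.id 1) = A.white 1 3 0 := by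
    have h : (P.id 1 ⊠ (A.scal (-1) ⟫ A.white 1 2 0)) ⟫ P.symm 1 2 =
        P.symm 1 1 ⟫ ((A.scal (-1) ⟫ A.white 1 2 0) ⊠ P.id 1) := P.symm_natural _ _
    have h0 : A.white 1 2 0 ⟫ (P.id 1 ⊠ (A.scal (-1) ⟫ A.white 1 2 0)) = A.white 1 3 0 := by
      have := A.white_fuse 1 1 2 0 0
      rwa [add_zero] at this
    have h1 : A.white 1 3 0 ⟫ (P.symm 1 1 ⊠ P.id 1) = A.white 1 3 0 := by
      have e : P.id 0 ⊠ P.symm 1 1 = P.symm 1 1 := P.id_tensor (P.symm 1 1)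
      have := A.white_swap 1 0 1 0
      rwa [e] at this
    have h2 : A.white 1 3 0 ⟫ (P.id 1 ⊠ P.symm 1 1) = A.white 1 3 0 := by
      have e : P.id 1 ⊠ P.symm 1 1 ⊠ P.id 0 = P.id 1 ⊠ P.symm 1 1 := P.tensor_id_zero _
      have := A.white_swap 1 1 0 0
      rwa [e] at this
    rw [← A.white_comp_symm, P.comp_assoc, A.white_comp_symm, ← h, ← P.comp_assoc, h0, symm_one_two,
      ← P.comp_assoc, h1, h2]
  have e2 : unbend (A.white 1 3 0) = A.white 2 2 0 := A.unbend_white 1 2 0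
  have e3 : unbend (A.white 2 2 0) = A.white 3 1 0 := A.unbend_white 2 1 0
  have e4 : unbend (A.white 1 2 0) = A.white 2 1 0 := A.unbend_white 1 1 0
  rw [← e3, ← e2, ← e1, unbend_comp_right, e4, ← P.comp_assoc, unbend_comp_left, e4]
  rfl

end GaussAlg

/-! ### Laws of addition, points, tests and free wires -/

namespace GaussAlg

variable {P : CompactProp} (A : GaussAlg P)

theorem symm_one_zero : P.symm 1 0 = P.id 1 := P.symm_zero_right 1

theorem symm_comp_white_three : P.symm 1 2 ⟫ A.white 3 1 0 = A.white 3 1 0 := by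
  have h1 : (P.symm 1 1 ⊠ P.id 1) ⟫ A.white 3 1 0 = A.white 3 1 0 := by
    rw [← white_add, ← P.comp_assoc, ← comp_tensor_id, symm_comp_add]
  have h2 : (P.id 1 ⊠ P.symm 1 1) ⟫ A.white 3 1 0 = A.white 3 1 0 := by
    have e2 : unbend (A.white 1 3 0) = A.white 2 2 0 := A.unbend_white 1 2 0
    have e3 : unbend (A.white 2 2 0) = A.white 3 1 0 := A.unbend_white 2 1 0
    have h := unbend_unbend_swap (A.white 1 3 0)
    have h3 : A.white 1 3 0 ⟫ (P.id 1 ⊠ P.symm 1 1) = A.white 1 3 0 := by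
      have e : P.id 1 ⊠ P.symm 1 1 ⊠ P.id 0 = P.id 1 ⊠ P.symm 1 1 := P.tensor_id_zero _
      have := A.white_swap 1 1 0 0
      rwa [e] at this
    rw [h3, e2, e3] at h
    exact h.symm
  rw [symm_one_two, P.comp_assoc, h2, h1]

/-- Both sides are the three-legged white spider followed by an antipode. -/
theorem add_assoc : (A.add ⊠ P.id 1) ⟫ A.add = (P.id 1 ⊠ A.add) ⟫ A.add := by
  have h : (P.id 1 ⊠ A.add) ⟫ P.symm 1 1 = P.symm 1 2 ⟫ (A.add ⊠ P.id 1) :=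
    P.symm_natural (P.id 1) A.add
  have h1 : (P.id 1 ⊠ A.add) ⟫ A.white 2 1 0 = A.white 3 1 0 := by
    rw [← symm_comp_white, ← P.comp_assoc, h, P.comp_assoc, white_add, symm_comp_white_three]
  conv_lhs => enter [3]; unfold add
  conv_rhs => enter [3]; unfold add
  rw [← P.comp_assoc, ← P.comp_assoc, white_add, h1]

theorem zero_add : (A.point 0 ⊠ P.id 1) ⟫ A.add = P.id 1 := by
  have e4 : unbend (A.white 1 2 0) = A.white 2 1 0 := A.unbend_white 1 1 0
  have e5 : unbend (A.white 0 2 0) = A.white 1 1 0 := A.unbend_white 0 1 0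
  unfold add
  rw [← P.comp_assoc, ← e4, ← unbend_comp_left]
  unfold point
  rw [white_zero_comp, e5, A.white_antipode, scal_neg_one_comp]

theorem add_zero : (P.id 1 ⊠ A.point 0) ⟫ A.add = P.id 1 := by
  have h : (P.id 1 ⊠ A.point 0) ⟫ P.symm 1 1 = P.symm 1 0 ⟫ (A.point 0 ⊠ P.id 1) :=
    P.symm_natural (P.id 1) (A.point 0)
  rw [← symm_comp_add, ← P.comp_assoc, h, P.comp_assoc, zero_add, symm_one_zero, P.id_comp]

theorem add_scal (a : ℝ) : A.add ⟫ A.scal a = (A.scal a ⊠ A.scal a) ⟫ A.add := by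
  unfold add
  rw [P.comp_assoc, A.scal_mul, ← P.comp_assoc, A.scal_white, P.comp_assoc, A.scal_mul, mul_comm]

theorem point_scal (a b : ℝ) : A.point b ⟫ A.scal a = A.point (a * b) := A.scal_point a b

theorem add_disc : A.add ⟫ A.disc = A.disc ⊠ A.disc := by
  unfold add disc
  rw [P.comp_assoc, A.scal_discard, A.white_discard]

theorem add_copy : A.add ⟫ A.copy =
    (A.copy ⊠ A.copy) ⟫ (P.id 1 ⊠ P.symm 1 1 ⊠ P.id 1) ⟫ (A.add ⊠ A.add) := by
  unfold add copy
  rw [P.comp_assoc, A.scal_copy, ← P.comp_assoc, A.bialgebra, P.comp_assoc, ← P.tensor_comp]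

theorem point_disc (a : ℝ) : A.point a ⟫ A.disc = P.id 0 := A.point_discard a

theorem free_disc : A.free ⟫ A.disc = P.id 0 := A.grey_bone

theorem cup_disc : P.cup ⟫ (A.disc ⊠ P.id 1) = A.free := by
  have h := A.grey_bend 0 0
  have e : P.id 0 ⊠ P.cup = P.cup := P.id_tensor P.cup
  unfold bend at h
  rwa [e] at h

theorem point_cap (a : ℝ) : (A.point a ⊠ P.id 1) ⟫ P.cap = A.test a := by
  have h := A.unbend_white 0 0 a
  have e : P.id 0 ⊠ P.cap = P.cap := P.id_tensor P.cap
  unfold unbend at h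
  rwa [e] at h

theorem state_cap (s : P.Hom 0 1) : (P.id 1 ⊠ s) ⟫ P.cap = (s ⊠ P.id 1) ⟫ P.cap := by
  have h : (P.id 1 ⊠ s) ⟫ P.symm 1 1 = P.symm 1 0 ⟫ (s ⊠ P.id 1) :=
    P.symm_natural (P.id 1) s
  conv_lhs => rw [← P.symm_cap]
  rw [← P.comp_assoc, h, symm_one_zero, P.id_comp]

theorem free_cap : (A.free ⊠ P.id 1) ⟫ P.cap = A.disc := by
  have h := A.unbend_grey 0 0
  have e : P.id 0 ⊠ P.cap = P.cap := P.id_tensor P.cap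
  unfold unbend at h
  rwa [e] at h

theorem state_tensor_eq {n m k : ℕ} (f : P.Hom n m) (s : P.Hom 0 k) :
    f ⊠ s = f ⟫ (P.id m ⊠ s) := by
  rw [tensor_eq_left, P.tensor_id_zero]

/-- Plugging a state into the last input of a bent arrow. -/
theorem plug_unbend {n m : ℕ} (f : P.Hom n (m + 1)) (s : P.Hom 0 1) :
    (P.id n ⊠ s) ⟫ unbend f = f ⟫ (P.id m ⊠ ((s ⊠ P.id 1) ⟫ P.cap)) := by
  have e : P.id (m + 1) ⊠ s = P.id m ⊠ (P.id 1 ⊠ s) := by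
    rw [← P.tensor_id m 1]; exact P.tensor_assoc (P.id m) (P.id 1) s
  unfold unbend
  rw [← P.comp_assoc, ← P.tensor_comp, P.id_comp, P.comp_id, state_tensor_eq, P.comp_assoc, e,
    ← id_tensor_comp, state_cap]

/-- Bending exchanges `point` with `test` and `free` with `disc`, so testing a free wire is
discarding a point. -/
theorem free_test (a : ℝ) : A.free ⟫ A.test a = P.id 0 := by
  rw [← point_cap, ← P.comp_assoc]
  have e : P.id 0 ⊠ A.free = A.free := P.id_tensor A.free
  have h : A.free ⟫ (A.point a ⊠ P.id 1) = A.point a ⟫ (P.id 1 ⊠ A.free) := by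
    rw [← P.tensor_id_zero (A.point a)]
    conv_lhs => rw [← e]
    conv_rhs => rw [← P.tensor_comp]
    rw [← P.tensor_comp, P.tensor_id_zero]
    simp only [P.id_comp, P.comp_id]
  rw [h, P.comp_assoc, state_cap, free_cap, point_disc]

/-- This is `white_discard` with one of the inputs bent to the output side: a white spider with a
discarded leg falls apart. -/
theorem white_disc_left : A.white 1 2 0 ⟫ (A.disc ⊠ P.id 1) = A.disc ⟫ A.free := by
  have h1 : A.white 1 2 0 = bend (A.white 2 1 0) := (A.white_bend 1 1 0).symm
  have e : A.disc ⊠ A.disc ⊠ P.id 1 = A.disc ⊠ (A.disc ⊠ P.id 1) :=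
    P.tensor_assoc A.disc A.disc (P.id 1)
  have e2 : P.id 0 ⊠ A.free = A.free := P.id_tensor A.free
  rw [h1]
  unfold bend
  rw [P.comp_assoc, ← comp_tensor_id]
  conv_lhs => enter [3, 2]; unfold disc
  rw [A.white_discard]
  change _ ⟫ (A.disc ⊠ A.disc ⊠ P.id 1) = _
  rw [e, ← P.tensor_comp, P.id_comp, cup_disc, tensor_eq_left, P.tensor_id_zero, e2]

theorem white_disc_right : A.white 1 2 0 ⟫ (P.id 1 ⊠ A.disc) = A.disc ⟫ A.free := by
  have h : (P.id 1 ⊠ A.disc) ⟫ P.symm 1 0 = P.symm 1 1 ⟫ (A.disc ⊠ P.id 1) :=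
    P.symm_natural (P.id 1) A.disc
  rw [symm_one_zero, P.comp_id] at h
  rw [h, ← P.comp_assoc, white_comp_symm, white_disc_left]

theorem free_antipode : A.free ⟫ A.scal (-1) = A.free := by
  have e5 : unbend (A.white 0 2 0) = A.white 1 1 0 := A.unbend_white 0 1 0
  have e : P.id 0 ⊠ A.free = A.free := P.id_tensor A.free
  have h := plug_unbend (A.white 0 2 0) A.free
  rw [e, e5, free_cap, ← white_zero_comp, P.comp_assoc, white_disc_right, ← P.comp_assoc] at h
  rw [← A.white_antipode, h]
  have := A.point_disc 0
  unfold point at this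
  rw [this, P.id_comp]

/-- A free summand absorbs the other one. All absorption laws for lines come from here. -/
theorem add_free : (P.id 1 ⊠ A.free) ⟫ A.add = A.disc ⟫ A.free := by
  have e4 : unbend (A.white 1 2 0) = A.white 2 1 0 := A.unbend_white 1 1 0
  have h := plug_unbend (A.white 1 2 0) A.free
  rw [e4, free_cap, white_disc_right] at h
  unfold add
  rw [← P.comp_assoc, h, P.comp_assoc, free_antipode]

/-- The bent form of `point_copy`: testing one copy fixes the value of the other. This is what lets
a conditioned variable be solved for. -/
theorem copy_test (a : ℝ) : A.copy ⟫ (P.id 1 ⊠ A.test a) = A.test a ⟫ A.point a := by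
  have e4 : unbend A.copy = A.grey 2 1 := A.unbend_grey 1 1
  have h := plug_unbend A.copy (A.point a)
  have e5 : (P.id 1 ⊠ A.point a) ⟫ P.symm 1 1 = P.symm 1 0 ⟫ (A.point a ⊠ P.id 1) :=
    P.symm_natural (P.id 1) (A.point a)
  have e6 : A.point a ⊠ A.point a ⊠ P.id 1 = A.point a ⊠ (A.point a ⊠ P.id 1) :=
    P.tensor_assoc (A.point a) (A.point a) (P.id 1)
  have e7 : P.id 0 ⊠ A.test a = A.test a := P.id_tensor (A.test a)
  rw [point_cap, e4, ← symm_comp_grey, ← P.comp_assoc, e5, symm_one_zero, P.id_comp, ← e4,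
    ← unbend_comp_left] at h
  rw [← h]
  have h2 : A.point a ⟫ A.copy = A.point a ⊠ A.point a := A.point_copy a
  rw [h2]
  unfold unbend
  rw [e6, ← P.tensor_comp, point_cap, P.comp_id, tensor_eq_right, e7, P.tensor_id_zero]

/-- `scal_inv` says that the transpose of a nonzero scalar is its inverse; a snake equation moves
this across the cap. -/
theorem scal_cap (c : ℝ) (hc : c ≠ 0) :
    (P.id 1 ⊠ A.scal c) ⟫ P.cap = (A.scal c⁻¹ ⊠ P.id 1) ⟫ P.cap := by
  have e0 : P.id 0 ⊠ P.cap = P.cap := P.id_tensor P.cap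
  have e1 : P.cap ⊠ P.id 1 ⊠ P.id 1 = P.cap ⊠ P.id 2 := by
    rw [← P.tensor_id 1 1]; exact P.tensor_assoc P.cap (P.id 1) (P.id 1)
  have e2 : P.id 1 ⊠ A.scal c ⊠ P.id 1 ⊠ P.id 1 = P.id 1 ⊠ A.scal c ⊠ P.id 2 := by
    rw [← P.tensor_id 1 1]; exact P.tensor_assoc (P.id 1 ⊠ A.scal c) (P.id 1) (P.id 1)
  have e3 : P.id 1 ⊠ P.cup ⊠ P.id 1 = P.id 1 ⊠ (P.cup ⊠ P.id 1) :=
    P.tensor_assoc (P.id 1) P.cup (P.id 1)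
  have e4 : P.id 2 ⊠ P.cap = P.id 1 ⊠ (P.id 1 ⊠ P.cap) := by
    rw [← P.tensor_id 1 1]; exact P.tensor_assoc (P.id 1) (P.id 1) P.cap
  have h1 : (P.cap ⊠ P.id 2) ⟫ P.cap = (P.id 2 ⊠ P.cap) ⟫ P.cap := by
    conv_lhs => enter [3]; rw [← e0]
    rw [← tensor_eq_left, tensor_eq_right, P.tensor_id_zero]
  rw [← A.scal_inv c hc, comp_tensor_id, comp_tensor_id, P.comp_assoc, P.comp_assoc, e1, h1, e2,
    ← P.comp_assoc (P.id 1 ⊠ A.scal c ⊠ P.id 2), ← tensor_eq_left (P.id 1 ⊠ A.scal c),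
    tensor_eq_right (P.id 1 ⊠ A.scal c), P.tensor_id_zero, ← P.comp_assoc, ← P.comp_assoc, e3, e4,
    ← P.tensor_comp]
  rw [P.snake_left, P.id_comp, P.tensor_id, P.id_comp]

theorem scal_test (c v : ℝ) (hc : c ≠ 0) : A.scal c ⟫ A.test v = A.test (c⁻¹ * v) := by
  have e : P.id 0 ⊠ A.scal c = A.scal c := P.id_tensor (A.scal c)
  rw [← point_cap, ← point_cap, ← point_scal, comp_tensor_id, P.comp_assoc, ← scal_cap _ _ hc,
    ← P.comp_assoc, ← P.comp_assoc, ← tensor_eq_left, tensor_eq_right (A.point v) (A.scal c), e]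

/-- Two wires agree when their difference vanishes. The cap is thereby reduced to linear arrows and
the single effect `test 0`. -/
theorem cap_eq : P.cap = (A.scal (-1) ⊠ P.id 1) ⟫ A.add ⟫ A.test 0 := by
  have h1 : A.add ⟫ A.test 0 = A.white 2 0 0 := by
    have h := A.white_fuse 2 0 0 0 0
    have e : P.id 0 ⊠ (A.scal (-1) ⟫ A.white 1 0 0) = A.scal (-1) ⟫ A.white 1 0 0 :=
      P.id_tensor (A.scal (-1) ⟫ A.white 1 0 0)
    rw [e, _root_.add_zero (0 : ℝ)] at h
    unfold add test
    rw [P.comp_assoc]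
    exact h
  have h2 : A.white 2 0 0 = (A.scal (-1) ⊠ P.id 1) ⟫ P.cap := by
    have h := A.unbend_white 1 0 0
    have e : P.id 0 ⊠ P.cap = P.cap := P.id_tensor P.cap
    unfold unbend at h
    rw [e] at h
    rw [← h, ← A.white_antipode]
  rw [P.comp_assoc, h1, h2, ← P.comp_assoc, ← comp_tensor_id, scal_neg_one_comp, P.tensor_id,
    P.id_comp]

theorem cup_eq : P.cup = A.free ⟫ A.copy := by
  have h := A.grey_fuse 0 0 2
  have e : P.id 0 ⊠ A.grey 1 2 = A.grey 1 2 := P.id_tensor (A.grey 1 2)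
  rw [e] at h
  rw [← A.grey_cup]
  exact h.symm

end GaussAlg

/-! ### Addition on several wires -/

namespace CompactProp

open CategoryTheory MonoidalCategory

variable (P : CompactProp)

/-- The interchange of the two middle blocks among four. -/
def middle (a b c d : ℕ) : P.Hom (a + b + (c + d)) (a + c + (b + d)) :=
  tensorμ (C := Wires P) a b c d

variable {P}

theorem middle_natural {a b c d a' b' c' d' : ℕ} (f : P.Hom a a') (g : P.Hom b b')
    (h : P.Hom c c') (k : P.Hom d d') :
    (f ⊠ g) ⊠ (h ⊠ k) ⟫ P.middle a' b' c' d' = P.middle a b c d ⟫ ((f ⊠ h) ⊠ (g ⊠ k)) :=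
  tensorμ_natural (C := Wires P) f g h k

theorem middle_one : P.middle 1 1 1 1 = P.id 1 ⊠ P.symm 1 1 ⊠ P.id 1 := by
  have e : P.id 1 ⊠ (P.symm 1 1 ⊠ P.id 1) = P.id 1 ⊠ P.symm 1 1 ⊠ P.id 1 :=
    (P.tensor_assoc (P.id 1) (P.symm 1 1) (P.id 1)).symm
  have h : P.middle 1 1 1 1 = P.id 4 ⟫ ((P.id 1 ⊠ P.id 3) ⟫ ((P.id 1 ⊠ (P.symm 1 1 ⊠ P.id 1)) ⟫
    ((P.id 1 ⊠ P.id 3) ⟫ P.id 4))) := rfl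
  rw [h, P.tensor_id, P.id_comp, P.id_comp, P.id_comp, P.comp_id, e]

theorem middle_zero_one (n : ℕ) : P.middle n 0 0 1 = P.id (n + 1) := by
  have e0 : P.symm 0 0 = P.id 0 := P.symm_zero_right 0
  have h : P.middle n 0 0 1 = P.id (n + 1) ⟫ ((P.id n ⊠ P.id 1) ⟫ ((P.id n ⊠ (P.symm 0 0 ⊠ P.id 1)) ⟫
    ((P.id n ⊠ P.id 1) ⟫ P.id (n + 1)))) := rfl
  rw [h, P.tensor_id, P.id_comp, P.id_comp, P.id_comp, P.comp_id, e0, P.tensor_id, P.tensor_id]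

/-- This explicit form serves to read off the relation of `middle`. Only the source needs a
transport, the two targets being equal by definition. -/
theorem middle_eq (n : ℕ) : P.middle n 1 n 1 =
    castHom P.Hom (congrArg (· + 1) (Nat.add_assoc n 1 n).symm) rfl
      (P.id n ⊠ P.symm 1 n ⊠ P.id 1) := by
  have e : P.id n ⊠ (P.symm 1 n ⊠ P.id 1) = P.id n ⊠ P.symm 1 n ⊠ P.id 1 :=
    (P.tensor_assoc (P.id n) (P.symm 1 n) (P.id 1)).symm
  rw [castHom_eq, idCast_rfl, P.comp_id, ← e]
  have h : P.middle n 1 n 1 = P.idCast (Nat.add_assoc n 1 (n + 1)) ⟫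
    ((P.id n ⊠ P.idCast (Nat.add_assoc 1 n 1).symm) ⟫ ((P.id n ⊠ (P.symm 1 n ⊠ P.id 1)) ⟫
    ((P.id n ⊠ P.idCast (Nat.add_assoc n 1 1)) ⟫ P.idCast (Nat.add_assoc n n 2).symm))) := rfl
  have e1 : P.idCast (Nat.add_assoc n n 2).symm = P.id (n + n + 2) := rfl
  have e2 : P.idCast (Nat.add_assoc n 1 1) = P.id (n + 2) := rfl
  have e3 : P.id n ⊠ P.idCast (Nat.add_assoc 1 n 1).symm = P.id (n + (1 + n + 1)) :=
    P.tensor_id n (1 + n + 1)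
  rw [h, e1, e2, e3, P.tensor_id]
  exact congrArg (P.comp _) ((P.id_comp _).trans ((congrArg (P.comp _) (P.comp_id _)).trans
    (P.comp_id _)))

/-- The trivial monoid structure on no wires. -/
abbrev unitMon : MonObj (MonoidalCategoryStruct.tensorUnit (Wires P)) := inferInstance

/-- The monoid structure on a tensor product of wires. -/
abbrev tensorMon {X Y : Wires P} (hX : MonObj X) (hY : MonObj Y) : MonObj (X ⊗ Y) :=
  MonObj.tensorObj.instTensorObj

end CompactProp

namespace GaussAlg

open CategoryTheory MonoidalCategory

variable {P : CompactProp} (A : GaussAlg P)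

/-- Addition as a monoid structure on one wire. -/
abbrev monOne : MonObj (C := Wires P) (1 : ℕ) where
  one := A.point 0
  mul := A.add
  one_mul := A.zero_add
  mul_one := A.add_zero
  mul_assoc := A.add_assoc.trans (P.id_comp _).symm

/-- Addition as a monoid structure on several wires. -/
@[reducible]
def mon : ∀ n : ℕ, MonObj (C := Wires P) n
  | 0 => unitMon
  | n + 1 => tensorMon (mon n) A.monOne

/-- Addition on several wires. -/
def addn (n : ℕ) : P.Hom (n + n) n := (A.mon n).mul

/-- The zero vector on several wires. -/
def zeron (n : ℕ) : P.Hom 0 n := (A.mon n).one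

theorem zeron_zero : A.zeron 0 = P.id 0 := rfl

theorem zeron_succ (n : ℕ) : A.zeron (n + 1) = A.zeron n ⊠ A.point 0 := P.id_comp _

theorem addn_zero : A.addn 0 = P.id 0 := rfl

theorem addn_succ (n : ℕ) :
    A.addn (n + 1) = P.middle n 1 n 1 ⟫ (A.addn n ⊠ A.add) := rfl

theorem add_zeron (n : ℕ) : (P.id n ⊠ A.zeron n) ⟫ A.addn n = P.id n := (A.mon n).mul_one

theorem zeron_add (n : ℕ) : (A.zeron n ⊠ P.id n) ⟫ A.addn n = P.idCast (Nat.zero_add n) :=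
  (A.mon n).one_mul

theorem addn_assoc (n : ℕ) : (A.addn n ⊠ P.id n) ⟫ A.addn n =
    P.idCast (Nat.add_assoc n n n) ⟫ ((P.id n ⊠ A.addn n) ⟫ A.addn n) := (A.mon n).mul_assoc

theorem tensorMon_comm {X Y : Wires P} (hX : MonObj X) (hY : MonObj Y) (cX : IsCommMonObj X)
    (cY : IsCommMonObj Y) : (β_ (X ⊗ Y) (X ⊗ Y)).hom ≫ (tensorMon hX hY).mul =
      (tensorMon hX hY).mul :=
  IsCommMonObj.mul_comm (X ⊗ Y)

theorem symm_addn : ∀ n : ℕ, P.symm n n ⟫ A.addn n = A.addn n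
  | 0 => by
    have e0 : P.symm 0 0 = P.id 0 := P.symm_zero_right 0
    rw [e0, P.id_comp]
  | n + 1 => tensorMon_comm (A.mon n) A.monOne
      (@IsCommMonObj.mk (Wires P) _ _ _ _ (A.mon n) (symm_addn n))
      (@IsCommMonObj.mk (Wires P) _ _ _ _ A.monOne A.symm_comp_add)

theorem tensorMon_unit {X : Wires P} (hX : MonObj X) :
    (tensorMon hX unitMon).mul = hX.mul := by
  have h := MonObj.mul_rightUnitor (M := X)
  exact (P.comp_id _).symm.trans (h.trans
    ((congrArg (P.comp · hX.mul) (P.tensor_id X X)).trans (P.id_comp _)))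

theorem tensorMon_assoc {X Y : Wires P} (hX : MonObj X) (hY : MonObj Y)
    (h : MonObj (C := Wires P) (1 : ℕ)) :
    (tensorMon (tensorMon hX hY) h).mul = (tensorMon hX (tensorMon hY h)).mul := by
  have := MonObj.mul_associator (M := X) (N := Y) (P := ((1 : ℕ) : Wires P))
  exact (P.comp_id _).symm.trans (this.trans
    ((congrArg (P.comp · (tensorMon hX (tensorMon hY h)).mul) (P.tensor_id _ _)).trans (P.id_comp _)))

/-- The monoid is built one wire at a time, so its splitting as a tensor product rests on
associativity of tensor products of monoids. It makes additivity stable under `tensor` and under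
symmetries. -/
theorem mon_add (n : ℕ) : ∀ m : ℕ, A.mon (n + m) = tensorMon (A.mon n) (A.mon m)
  | 0 => MonObj.ext _ _ (tensorMon_unit (A.mon n)).symm
  | m + 1 => by
    have h : A.mon (n + (m + 1)) = tensorMon (A.mon (n + m)) A.monOne := rfl
    rw [h, mon_add n m]
    exact MonObj.ext _ _ (tensorMon_assoc (A.mon n) (A.mon m) A.monOne)

/-- Arrows that preserve addition and zero. -/
structure Additive {n m : ℕ} (f : P.Hom n m) : Prop where
  zero : A.zeron n ⟫ f = A.zeron m
  add : A.addn n ⟫ f = (f ⊠ f) ⟫ A.addn m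

variable {A}

theorem additive_id (n : ℕ) : A.Additive (P.id n) :=
  ⟨P.comp_id _, by rw [P.comp_id, P.tensor_id, P.id_comp]⟩

theorem Additive.comp {n m k : ℕ} {f : P.Hom n m} {g : P.Hom m k} (hf : A.Additive f)
    (hg : A.Additive g) : A.Additive (f ⟫ g) :=
  ⟨by rw [← P.comp_assoc, hf.zero, hg.zero],
    by rw [← P.comp_assoc, hf.add, P.comp_assoc, hg.add, ← P.comp_assoc, ← P.tensor_comp]⟩

theorem isMonHom_tensor {X Y Z W : Wires P} (hX : MonObj X) (hY : MonObj Y) (hZ : MonObj Z)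
    (hW : MonObj W) {f : X ⟶ Y} {g : Z ⟶ W} (hf : IsMonHom f) (hg : IsMonHom g) :
    @IsMonHom _ _ _ _ _ (tensorMon hX hZ) (tensorMon hY hW) (f ⊗ₘ g) :=
  inferInstance

theorem Additive.tensor {n m n' m' : ℕ} {f : P.Hom n m} {g : P.Hom n' m'} (hf : A.Additive f)
    (hg : A.Additive g) : A.Additive (f ⊠ g) := by
  have h := isMonHom_tensor (A.mon n) (A.mon m) (A.mon n') (A.mon m')
    (@IsMonHom.mk _ _ _ _ _ (A.mon n) (A.mon m) f hf.zero hf.add)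
    (@IsMonHom.mk _ _ _ _ _ (A.mon n') (A.mon m') g hg.zero hg.add)
  have h' : @IsMonHom (Wires P) _ _ ((n + n' : ℕ) : Wires P) ((m + m' : ℕ) : Wires P) (A.mon (n + n'))
      (A.mon (m + m')) (f ⊠ g) := by
    rw [A.mon_add, A.mon_add]; exact h
  exact ⟨h'.one_hom, h'.mul_hom⟩

theorem isMonHom_symm {X Y : Wires P} (hX : MonObj X) (hY : MonObj Y) :
    @IsMonHom _ _ _ _ _ (tensorMon hX hY) (tensorMon hY hX) (β_ X Y).hom :=
  inferInstance

theorem additive_symm (n m : ℕ) : A.Additive (P.symm n m) := by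
  have h := isMonHom_symm (A.mon n) (A.mon m)
  have h' : @IsMonHom (Wires P) _ _ ((n + m : ℕ) : Wires P) ((m + n : ℕ) : Wires P) (A.mon (n + m))
      (A.mon (m + n)) (P.symm n m) := by
    rw [A.mon_add, A.mon_add]; exact h
  exact ⟨h'.one_hom, h'.mul_hom⟩

theorem zeron_add_eq (n m : ℕ) : A.zeron (n + m) = A.zeron n ⊠ A.zeron m := by
  unfold zeron
  rw [A.mon_add]
  exact P.id_comp _

theorem addn_one : A.addn 1 = A.add := by
  have e0 : P.symm 1 0 = P.id 1 := P.symm_zero_right 1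
  have e1 : P.id 0 ⊠ A.add = A.add := P.id_tensor A.add
  have h : A.addn 1 = P.id 2 ⟫ ((P.id 0 ⊠ P.id 2) ⟫ ((P.id 0 ⊠ (P.symm 1 0 ⊠ P.id 1)) ⟫
    ((P.id 0 ⊠ P.id 2) ⟫ P.id 2))) ⟫ (P.id 0 ⊠ A.add) := rfl
  rw [h, e0, e1]
  simp only [P.tensor_id, P.id_comp]

theorem zeron_one : A.zeron 1 = A.point 0 := by
  have h := A.zeron_succ 0
  have e1 : P.id 0 ⊠ A.point 0 = A.point 0 := P.id_tensor (A.point 0)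
  rw [zeron_zero, e1] at h
  exact h

theorem addn_two : A.addn 2 = (P.id 1 ⊠ P.symm 1 1 ⊠ P.id 1) ⟫ (A.add ⊠ A.add) := by
  have h := A.addn_succ 1
  rw [addn_one, middle_one] at h
  exact h

theorem additive_zeron (n : ℕ) : A.Additive (A.zeron n) :=
  ⟨P.id_comp _, by
    rw [addn_zero, P.id_comp, state_tensor_eq, P.comp_assoc, add_zeron, P.comp_id]⟩

theorem additive_scal (a : ℝ) : A.Additive (A.scal a) :=
  ⟨by rw [zeron_one, point_scal, mul_zero], by rw [addn_one, add_scal]⟩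

theorem additive_disc : A.Additive A.disc :=
  ⟨by rw [zeron_one, point_disc, zeron_zero],
    by rw [addn_one, add_disc, addn_zero]; exact (P.comp_id _).symm⟩

theorem additive_copy : A.Additive A.copy :=
  ⟨by
    have h : A.point 0 ⟫ A.copy = A.point 0 ⊠ A.point 0 := A.point_copy 0
    have h2 := A.zeron_succ 1
    rw [zeron_one, h, h2, zeron_one],
    by rw [addn_one, add_copy, addn_two, P.comp_assoc]⟩

theorem addn_addn_middle {X : Wires P} (hX : MonObj X) (cX : IsCommMonObj X) :
    (tensorMon hX hX).mul ≫ hX.mul = (hX.mul ⊗ₘ hX.mul) ≫ hX.mul :=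
  (Category.assoc _ _ _).trans (MonObj.mul_mul_mul_comm X)

/-- In a commutative monoid the multiplication is itself a homomorphism. -/
theorem additive_addn (n : ℕ) : A.Additive (A.addn n) := by
  refine ⟨?_, ?_⟩
  · rw [zeron_add_eq, state_tensor_eq, P.comp_assoc, add_zeron, P.comp_id]
  · have h := addn_addn_middle (A.mon n)
      (@IsCommMonObj.mk (Wires P) _ _ _ _ (A.mon n) (A.symm_addn n))
    have e : A.addn (n + n) = (tensorMon (A.mon n) (A.mon n)).mul := by
      unfold addn; rw [A.mon_add]
    rw [e]
    exact h

end GaussAlg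

/-! ### Matrices as arrows -/

namespace GaussAlg

variable {P : CompactProp} (A : GaussAlg P)

/-- The linear map from one wire with a given matrix. -/
def vec : ∀ m : ℕ, (Fin m → ℝ) → P.Hom 1 m
  | 0, _ => A.disc
  | m + 1, c => A.copy ⟫ (vec m (fun j => c j.castSucc) ⊠ A.scal (c (Fin.last m)))

/-- The linear map with a given matrix, acting on row vectors. -/
def mat : ∀ (n : ℕ) {m : ℕ}, (Fin n → Fin m → ℝ) → P.Hom n m
  | 0, m, _ => A.zeron m
  | n + 1, m, M => (mat n (fun i => M i.castSucc) ⊠ A.vec m (M (Fin.last n))) ⟫ A.addn m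

variable {A}

theorem additive_vec : ∀ (m : ℕ) (c : Fin m → ℝ), A.Additive (A.vec m c)
  | 0, _ => additive_disc
  | m + 1, _ => additive_copy.comp ((additive_vec m _).tensor (additive_scal _))

theorem additive_mat : ∀ (n : ℕ) {m : ℕ} (M : Fin n → Fin m → ℝ), A.Additive (A.mat n M)
  | 0, m, _ => additive_zeron m
  | n + 1, m, _ => ((additive_mat n _).tensor (additive_vec m _)).comp (additive_addn m)

theorem scal_vec (a : ℝ) : ∀ (m : ℕ) (c : Fin m → ℝ), A.scal a ⟫ A.vec m c = A.vec m (a • c)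
  | 0, _ => A.scal_discard a
  | m + 1, c => by
    have h : A.scal a ⟫ A.copy = A.copy ⟫ (A.scal a ⊠ A.scal a) := A.scal_copy a
    simp only [vec]
    rw [← P.comp_assoc, h, P.comp_assoc, ← P.tensor_comp, scal_vec, A.scal_mul]
    rfl

theorem vec_zero : ∀ m : ℕ, A.vec m 0 = A.disc ⟫ A.zeron m
  | 0 => by rw [zeron_zero, P.comp_id]; rfl
  | m + 1 => by
    have h : A.scal 0 = A.disc ⟫ A.point 0 := A.scal_zero
    have h2 : A.disc ⊠ A.disc = (A.disc ⊠ P.id 1) ⟫ A.disc := by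
      have e : P.id 0 ⊠ A.disc = A.disc := P.id_tensor A.disc
      rw [tensor_eq_left, e]
    have h3 : A.vec m (fun j => (0 : Fin (m + 1) → ℝ) j.castSucc) = A.disc ⟫ A.zeron m :=
      vec_zero m
    simp only [vec]
    rw [h3]
    simp only [Pi.zero_apply]
    rw [h, P.tensor_comp, ← P.comp_assoc, h2, ← P.comp_assoc, copy_disc_left, P.id_comp,
      zeron_succ]

/-- The axiom `scal_add` holds in each coordinate; `copy_middle` regroups the four copies so that it
can be applied coordinate by coordinate. -/
theorem copy_vec_add : ∀ (m : ℕ) (a b : Fin m → ℝ),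
    A.copy ⟫ (A.vec m a ⊠ A.vec m b) ⟫ A.addn m = A.vec m (a + b)
  | 0, _, _ => by
    have e : P.id 0 ⊠ A.disc = A.disc := P.id_tensor A.disc
    simp only [vec]
    rw [addn_zero, P.comp_id, tensor_eq_left, e, ← P.comp_assoc, copy_disc_left, P.id_comp]
  | m + 1, a, b => by
    have h := A.scal_add (a (Fin.last m)) (b (Fin.last m))
    change A.copy ⟫ (A.scal (a (Fin.last m)) ⊠ A.scal (b (Fin.last m))) ⟫ A.add = _ at h
    have hm := A.copy_middle
    rw [← middle_one] at hm
    simp only [vec]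
    rw [P.tensor_comp, addn_succ, P.comp_assoc, P.comp_assoc, ← P.comp_assoc _ (P.middle _ _ _ _),
      middle_natural, P.comp_assoc, ← P.tensor_comp, ← P.comp_assoc, ← P.comp_assoc, hm,
      P.comp_assoc, ← P.tensor_comp, ← P.comp_assoc, ← P.comp_assoc, copy_vec_add, h]
    rfl

theorem id_zero_tensor_comp_idCast {m : ℕ} (f : P.Hom 1 m) :
    (P.id 0 ⊠ f) ⟫ P.idCast (Nat.zero_add m) = f :=
  (id_tensor_idCast f).trans (P.id_comp f)

theorem zeron_tensor_addn {m : ℕ} (f : P.Hom 1 m) : (A.zeron m ⊠ f) ⟫ A.addn m = f := by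
  rw [tensor_eq_right, P.comp_assoc, zeron_add, id_zero_tensor_comp_idCast]

theorem tensor_zeron_addn {n m : ℕ} (f : P.Hom n m) : (f ⊠ A.zeron m) ⟫ A.addn m = f := by
  rw [state_tensor_eq, P.comp_assoc, add_zeron, P.comp_id]

/-- An additive arrow is the sum of its restrictions along the two coordinate inclusions. Matrices
are recognised by comparing these restrictions. -/
theorem Additive.decompose {n m : ℕ} {f : P.Hom (n + 1) m} (hf : A.Additive f) :
    f = (((P.id n ⊠ A.point 0) ⟫ f) ⊠ ((A.zeron n ⊠ P.id 1) ⟫ f)) ⟫ A.addn m := by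
  -- The identity is the sum of its parts supported on the first `n` wires and on the last wire.
  have e : (P.id n ⊠ A.point 0) ⊠ (A.zeron n ⊠ P.id 1) ⟫ A.addn (n + 1) = P.id (n + 1) := by
    rw [addn_succ, ← P.comp_assoc, middle_natural, middle_zero_one, P.id_comp, ← P.tensor_comp,
      add_zeron, zero_add]
    exact P.tensor_id n 1
  rw [P.tensor_comp, P.comp_assoc, ← hf.add, ← P.comp_assoc, e, P.id_comp]

theorem Additive.eq_mat {n m : ℕ} {f : P.Hom (n + 1) m} (hf : A.Additive f)
    (M : Fin (n + 1) → Fin m → ℝ)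
    (h1 : (P.id n ⊠ A.point 0) ⟫ f = A.mat n (fun i => M i.castSucc))
    (h2 : (A.zeron n ⊠ P.id 1) ⟫ f = A.vec m (M (Fin.last n))) : f = A.mat (n + 1) M := by
  rw [hf.decompose, h1, h2]; rfl

theorem mat_left {n m : ℕ} (M : Fin (n + 1) → Fin m → ℝ) :
    (P.id n ⊠ A.point 0) ⟫ A.mat (n + 1) M = A.mat n (fun i => M i.castSucc) := by
  simp only [mat]
  have h := (additive_vec (A := A) m (M (Fin.last n))).zero
  rw [zeron_one] at h
  rw [← P.comp_assoc, ← P.tensor_comp, h, P.id_comp, tensor_zeron_addn]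

theorem mat_right {n m : ℕ} (M : Fin (n + 1) → Fin m → ℝ) :
    (A.zeron n ⊠ P.id 1) ⟫ A.mat (n + 1) M = A.vec m (M (Fin.last n)) := by
  simp only [mat]
  rw [← P.comp_assoc, ← P.tensor_comp, (additive_mat n _).zero, P.id_comp, zeron_tensor_addn]

theorem mat_comp_additive {m k : ℕ} {g : P.Hom m k} (hg : A.Additive g)
    (φ : (Fin m → ℝ) → Fin k → ℝ) (h : ∀ c, A.vec m c ⟫ g = A.vec k (φ c)) :
    ∀ (n : ℕ) (M : Fin n → Fin m → ℝ), A.mat n M ⟫ g = A.mat n (fun i => φ (M i))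
  | 0, _ => hg.zero
  | n + 1, M => by
    simp only [mat]
    rw [P.comp_assoc, hg.add, ← P.comp_assoc, ← P.tensor_comp, mat_comp_additive hg φ h, h]

theorem vec_mat : ∀ (m : ℕ) {k : ℕ} (c : Fin m → ℝ) (N : Fin m → Fin k → ℝ),
    A.vec m c ⟫ A.mat m N = A.vec k (fun j => ∑ i, c i * N i j)
  | 0, k, c, N => by
    have : (fun j => ∑ i, c i * N i j) = 0 := by ext; simp
    rw [this, vec_zero]; rfl
  | m + 1, k, c, N => by
    simp only [vec, mat]
    rw [P.comp_assoc, ← P.comp_assoc (A.vec m _ ⊠ A.scal _), ← P.tensor_comp, vec_mat, scal_vec,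
      ← P.comp_assoc, copy_vec_add]
    congr 1
    ext j
    simp [Fin.sum_univ_castSucc]

/-- The product of two matrices. -/
def mmul {n m k : ℕ} (M : Fin n → Fin m → ℝ) (N : Fin m → Fin k → ℝ) : Fin n → Fin k → ℝ :=
  fun i k => ∑ j, M i j * N j k

theorem mat_comp {n m k : ℕ} (M : Fin n → Fin m → ℝ) (N : Fin m → Fin k → ℝ) :
    A.mat n M ⟫ A.mat m N = A.mat n (mmul M N) :=
  mat_comp_additive (additive_mat m N) (fun c j => ∑ i, c i * N i j) (fun c => vec_mat m c N) n M

theorem vec_succ {m : ℕ} (c : Fin (m + 1) → ℝ) (c' : Fin m → ℝ) (a : ℝ)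
    (h1 : ∀ j, c j.castSucc = c' j) (h2 : c (Fin.last m) = a) :
    A.vec (m + 1) c = A.copy ⟫ (A.vec m c' ⊠ A.scal a) := by
  rw [← h2, ← show (fun j => c j.castSucc) = c' from funext h1]; rfl

theorem vec_tensor_zeron {m : ℕ} (c : Fin m → ℝ) : ∀ k : ℕ,
    A.vec m c ⊠ A.zeron k = A.vec (m + k) (Fin.append c 0)
  | 0 => by
    rw [zeron_zero, P.tensor_id_zero]
    congr 1
    ext j; exact (Fin.append_left c 0 j).symm
  | k + 1 => by
    have h : A.scal 0 = A.disc ⟫ A.point 0 := A.scal_zero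
    have e : A.vec m c ⊠ (A.zeron k ⊠ A.point 0) = A.vec m c ⊠ A.zeron k ⊠ A.point 0 :=
      (P.tensor_assoc (A.vec m c) (A.zeron k) (A.point 0)).symm
    rw [zeron_succ, e, vec_tensor_zeron c k]
    refine Eq.trans ?_ (vec_succ (m := m + k) (Fin.append c (0 : Fin (k + 1) → ℝ) :)
      (Fin.append c 0) 0 (fun j => ?_) ?_).symm
    · conv_rhs => rw [← P.id_comp (A.vec (m + k) (Fin.append c 0)), h, P.tensor_comp,
        ← P.comp_assoc, copy_disc_right, P.id_comp]
    · refine Fin.addCases (fun j => ?_) (fun j => ?_) j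
      · rw [Fin.append_left]; exact Fin.append_left c (0 : Fin (k + 1) → ℝ) j
      · rw [Fin.append_right]; exact Fin.append_right c (0 : Fin (k + 1) → ℝ) j.castSucc
    · exact Fin.append_right c (0 : Fin (k + 1) → ℝ) (Fin.last k)

theorem zeron_tensor_vec {m : ℕ} : ∀ (k : ℕ) (d : Fin k → ℝ),
    A.zeron m ⊠ A.vec k d = A.vec (m + k) (Fin.append 0 d)
  | 0, d => by
    have h : A.zeron m ⊠ A.disc = A.disc ⟫ A.zeron m := by
      have e : P.id 0 ⊠ A.disc = A.disc := P.id_tensor A.disc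
      rw [tensor_eq_right, e, P.tensor_id_zero]
    simp only [vec]
    rw [h, ← vec_zero]
    congr 1
    ext j; exact (Fin.append_left (0 : Fin m → ℝ) d j).symm
  | k + 1, d => by
    have e : A.zeron m ⊠ (A.vec k (fun j => d j.castSucc) ⊠ A.scal (d (Fin.last k))) =
        A.zeron m ⊠ A.vec k (fun j => d j.castSucc) ⊠ A.scal (d (Fin.last k)) :=
      (P.tensor_assoc _ (A.vec k (fun j => d j.castSucc)) (A.scal (d (Fin.last k)))).symm
    have e2 : P.id 0 ⊠ A.copy = A.copy := P.id_tensor A.copy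
    refine Eq.trans ?_ (vec_succ (m := m + k) (Fin.append (0 : Fin m → ℝ) d :)
      (Fin.append 0 (fun j => d j.castSucc)) (d (Fin.last k)) (fun j => ?_) ?_).symm
    · rw [← zeron_tensor_vec k, ← e]
      simp only [vec]
      conv_lhs => rw [← P.id_comp (A.zeron m), P.tensor_comp, e2]
    · refine Fin.addCases (fun j => ?_) (fun j => ?_) j
      · rw [Fin.append_left]; exact Fin.append_left (0 : Fin m → ℝ) d j
      · rw [Fin.append_right]; exact Fin.append_right (0 : Fin m → ℝ) d j.castSucc
    · exact Fin.append_right (0 : Fin m → ℝ) d (Fin.last k)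

theorem vec_one (c : Fin 1 → ℝ) : A.vec 1 c = A.scal (c 0) := by
  change A.copy ⟫ (A.disc ⊠ A.scal _) = _
  have e : P.id 0 ⊠ A.scal (c 0) = A.scal (c 0) := P.id_tensor (A.scal (c 0))
  rw [tensor_eq_left, ← P.comp_assoc, copy_disc_left, P.id_comp]
  exact e

theorem mat_one {m : ℕ} (M : Fin 1 → Fin m → ℝ) : A.mat 1 M = A.vec m (M 0) :=
  zeron_tensor_addn _

/-- The direct sum of two matrices. -/
def matSum {n m n' m' : ℕ} (M : Fin n → Fin m → ℝ) (N : Fin n' → Fin m' → ℝ) :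
    Fin (n + n') → Fin (m + m') → ℝ :=
  Fin.append (fun i => Fin.append (M i) 0) (fun i => Fin.append 0 (N i))

/-- Both sides are additive, so induction on the second factor compares them on the last wire and on
the remaining ones. -/
theorem mat_tensor {n m m' : ℕ} (M : Fin n → Fin m → ℝ) :
    ∀ (n' : ℕ) (N : Fin n' → Fin m' → ℝ),
      A.mat n M ⊠ A.mat n' N = A.mat (n + n') (matSum M N)
  | 0, N => by
    change A.mat n M ⊠ A.zeron m' = A.mat n (matSum M N)
    rw [state_tensor_eq, mat_comp_additive (g := (P.id m ⊠ A.zeron m' : P.Hom m (m + m')))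
      ((additive_id m).tensor (additive_zeron m')) (fun c : Fin m → ℝ => Fin.append c 0)
      (fun c => (state_tensor_eq (A.vec m c) (A.zeron m')).symm.trans (vec_tensor_zeron c m'))]
    congr 1
    ext i j
    exact (congrFun (Fin.append_left (fun i => Fin.append (M i) 0)
      (fun i => Fin.append 0 (N i)) i) j).symm
  | n' + 1, N => by
    refine ((additive_mat n M).tensor (additive_mat (n' + 1) N)).eq_mat (n := n + n')
      (matSum M N :) ?_ ?_
    · have e : P.id (n + n') ⊠ A.point 0 = P.id n ⊠ (P.id n' ⊠ A.point 0) := by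
        rw [← P.tensor_id n n']; exact P.tensor_assoc (P.id n) (P.id n') (A.point 0)
      rw [e, ← P.tensor_comp, mat_left, P.id_comp]
      refine (mat_tensor M n' _).trans ?_
      congr 1
      ext i j
      refine Fin.addCases (fun i => ?_) (fun i => ?_) i
      · exact (congrFun (Fin.append_left (fun i => Fin.append (M i) 0)
          (fun i => Fin.append 0 (N i.castSucc)) i) j).trans
          (congrFun (Fin.append_left (fun i => Fin.append (M i) 0)
          (fun i => Fin.append 0 (N i)) i) j).symm
      · exact (congrFun (Fin.append_right (fun i => Fin.append (M i) 0)
          (fun i => Fin.append 0 (N i.castSucc)) i) j).trans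
          (congrFun (Fin.append_right (fun i => Fin.append (M i) 0)
          (fun i => Fin.append 0 (N i)) i.castSucc) j).symm
    · have e : A.zeron (n + n') ⊠ P.id 1 = A.zeron n ⊠ (A.zeron n' ⊠ P.id 1) := by
        rw [zeron_add_eq]; exact P.tensor_assoc (A.zeron n) (A.zeron n') (P.id 1)
      rw [e, ← P.tensor_comp, mat_right, (additive_mat n M).zero, zeron_tensor_vec]
      congr 1
      exact (Fin.append_right (fun i => Fin.append (M i) 0)
          (fun i => Fin.append 0 (N i)) (Fin.last n')).symm

theorem mat_scal (a : ℝ) : A.mat 1 (fun _ _ => a : Fin 1 → Fin 1 → ℝ) = A.scal a := by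
  rw [mat_one, vec_one]

/-- The identity matrix. -/
def mone (n : ℕ) : Fin n → Fin n → ℝ := fun i j => if i = j then 1 else 0

theorem matSum_mone (n m : ℕ) : matSum (mone n) (mone m) = mone (n + m) := by
  ext i j
  refine Fin.addCases (fun i => ?_) (fun i => ?_) i <;>
    refine Fin.addCases (fun j => ?_) (fun j => ?_) j <;>
    simp [matSum, mone, Fin.ext_iff] <;> omega

theorem mat_id : ∀ n : ℕ, A.mat n (mone n) = P.id n
  | 0 => A.zeron_zero
  | n + 1 => by
    have h : A.mat 1 (mone 1) = P.id 1 := by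
      rw [mat_one, vec_one]
      exact A.scal_one
    rw [← P.tensor_id n 1, ← mat_id n, ← h, mat_tensor, matSum_mone]

end GaussAlg

/-! ### Arrows given by matrices -/

namespace GaussAlg

variable {P : CompactProp} (A : GaussAlg P)

/-- An arrow is linear if it is given by a matrix. -/
def IsMat {n m : ℕ} (f : P.Hom n m) : Prop := ∃ M, f = A.mat n M

variable {A}

theorem IsMat.additive {n m : ℕ} {f : P.Hom n m} : A.IsMat f → A.Additive f := by
  rintro ⟨M, rfl⟩; exact additive_mat n M

theorem isMat_id (n : ℕ) : A.IsMat (P.id n) := ⟨_, (mat_id n).symm⟩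

theorem isMat_idCast {n m : ℕ} (h : n = m) : A.IsMat (P.idCast h) := by
  subst h; exact isMat_id n

theorem IsMat.comp {n m k : ℕ} {f : P.Hom n m} {g : P.Hom m k} :
    A.IsMat f → A.IsMat g → A.IsMat (f ⟫ g) := by
  rintro ⟨M, rfl⟩ ⟨N, rfl⟩; exact ⟨_, mat_comp M N⟩

theorem IsMat.tensor {n m n' m' : ℕ} {f : P.Hom n m} {g : P.Hom n' m'} :
    A.IsMat f → A.IsMat g → A.IsMat (f ⊠ g) := by
  rintro ⟨M, rfl⟩ ⟨N, rfl⟩; exact ⟨_, mat_tensor M n' N⟩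

theorem isMat_zeron (m : ℕ) : A.IsMat (A.zeron m) := ⟨fun _ _ => 0, rfl⟩

theorem isMat_vec {m : ℕ} (c : Fin m → ℝ) : A.IsMat (A.vec m c) := ⟨fun _ => c, (mat_one (A := A) (fun _ => c)).symm⟩

theorem isMat_of_additive {n m : ℕ} {f : P.Hom (n + 1) m} (hf : A.Additive f)
    (h1 : A.IsMat ((P.id n ⊠ A.point 0) ⟫ f)) (h2 : A.IsMat ((A.zeron n ⊠ P.id 1) ⟫ f)) :
    A.IsMat f := by
  obtain ⟨M, h1⟩ := h1
  obtain ⟨N, h2⟩ := h2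
  have e1 : (fun i => (Fin.snoc M (N 0) : Fin (n + 1) → Fin m → ℝ) i.castSucc) = M :=
    funext fun i => Fin.snoc_castSucc (α := fun _ => Fin m → ℝ) _ _ i
  have e2 : (Fin.snoc M (N 0) : Fin (n + 1) → Fin m → ℝ) (Fin.last n) = N 0 :=
    Fin.snoc_last (α := fun _ => Fin m → ℝ) _ _
  refine ⟨Fin.snoc M (N 0), hf.eq_mat _ ?_ ?_⟩
  · exact h1.trans (congrArg (A.mat n) e1.symm)
  · exact h2.trans ((mat_one N).trans (congrArg (A.vec m) e2.symm))

theorem isMat_scal (a : ℝ) : A.IsMat (A.scal a) := ⟨_, (mat_scal a).symm⟩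

theorem isMat_disc : A.IsMat A.disc := isMat_vec (m := 0) 0

theorem isMat_point_zero : A.IsMat (A.point 0) := by
  rw [← zeron_one]; exact isMat_zeron 1

theorem isMat_copy : A.IsMat A.copy := by
  have h := isMat_vec (A := A) (m := 2) (fun _ => 1)
  simp only [vec] at h
  have e : A.copy ⟫ (A.disc ⊠ A.scal 1) = P.id 1 := by
    rw [A.scal_one]; exact A.copy_disc_left
  have e' : A.copy ⟫ ((A.copy ⟫ (A.disc ⊠ A.scal 1)) ⊠ A.scal 1) = A.copy := by
    rw [e, A.scal_one, P.tensor_id]; exact P.comp_id _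
  rw [← e']
  exact h

theorem isMat_add : A.IsMat A.add := by
  refine isMat_of_additive (n := 1) ?_ ?_ ?_
  · rw [← addn_one]; exact additive_addn 1
  · rw [A.add_zero]; exact isMat_id 1
  · rw [zeron_one, A.zero_add]; exact isMat_id 1

/-- Naturality pushes the coordinate inclusions through the symmetry and leaves a symmetry with
fewer wires on one side. -/
theorem isMat_symm (n : ℕ) : ∀ m : ℕ, A.IsMat (P.symm n m)
  | 0 => by rw [P.symm_zero_right]; exact isMat_idCast _
  | m + 1 => by
    refine isMat_of_additive (n := n + m) (additive_symm n (m + 1)) ?_ ?_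
    · have e : P.id (n + m) ⊠ A.point 0 = P.id n ⊠ (P.id m ⊠ A.point 0) := by
        rw [← P.tensor_id n m]; exact P.tensor_assoc (P.id n) (P.id m) (A.point 0)
      rw [e, P.symm_natural]
      exact (isMat_symm n m).comp (((isMat_id m).tensor isMat_point_zero).tensor (isMat_id n))
    · have e : A.zeron (n + m) ⊠ P.id 1 = A.zeron n ⊠ (A.zeron m ⊠ P.id 1) := by
        rw [zeron_add_eq]; exact P.tensor_assoc (A.zeron n) (A.zeron m) (P.id 1)
      rw [e, P.symm_natural, P.symm_zero_left]
      exact (isMat_idCast _).comp (((isMat_zeron m).tensor (isMat_id 1)).tensor (isMat_zeron n))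

theorem IsMat.vec_comp {n m : ℕ} {f : P.Hom n m} (hf : A.IsMat f) (v : Fin n → ℝ) :
    ∃ w, A.vec n v ⟫ f = A.vec m w := by
  obtain ⟨M, rfl⟩ := hf
  exact ⟨_, vec_mat n v M⟩

/-! ### The commutative monoid of states -/

theorem addn_assoc_state {n : ℕ} (s t r : P.Hom 0 n) :
    (((s ⊠ t) ⟫ A.addn n) ⊠ r) ⟫ A.addn n = (s ⊠ ((t ⊠ r) ⟫ A.addn n)) ⟫ A.addn n := by
  have h : (s ⊠ t ⊠ r) ⟫ P.idCast (Nat.add_assoc n n n) = s ⊠ (t ⊠ r) :=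
    (tensor_assoc_idCast s t r).trans (P.id_comp _)
  conv_lhs => rw [← P.comp_id r, P.tensor_comp, P.comp_assoc, addn_assoc, ← P.comp_assoc, h]
  conv_rhs => rw [← P.comp_id s, P.tensor_comp, P.comp_assoc]

theorem addn_comm_state {n : ℕ} (s t : P.Hom 0 n) :
    (s ⊠ t) ⟫ A.addn n = (t ⊠ s) ⟫ A.addn n := by
  have e0 : P.symm 0 0 = P.id 0 := P.symm_zero_right 0
  have h : (s ⊠ t) ⟫ P.symm n n = t ⊠ s := by
    rw [P.symm_natural, e0]; exact P.id_comp _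
  conv_lhs => rw [← A.symm_addn, ← P.comp_assoc, h]

theorem addn_zero_state {n : ℕ} (s : P.Hom 0 n) : (s ⊠ A.zeron n) ⟫ A.addn n = s :=
  tensor_zeron_addn s

variable (A)

/-- A state of one wire, scaled along a vector. -/
def along {n : ℕ} (x : P.Hom 0 1) (v : Fin n → ℝ) : P.Hom 0 n := x ⟫ A.vec n v

/-- The point with given coordinates. -/
def pt {n : ℕ} (a : Fin n → ℝ) : P.Hom 0 n := A.along (A.point 1) a

variable {A}

theorem along_zero {n : ℕ} {x : P.Hom 0 1} (hx : x ⟫ A.disc = P.id 0) :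
    A.along x (0 : Fin n → ℝ) = A.zeron n := by
  rw [along, vec_zero, ← P.comp_assoc, hx, P.id_comp]

theorem along_smul {n : ℕ} (x : P.Hom 0 1) (c : ℝ) (v : Fin n → ℝ) :
    A.along x (c • v) = A.along (x ⟫ A.scal c) v := by
  rw [along, along, P.comp_assoc, scal_vec]

theorem pt_zero {n : ℕ} : A.pt (0 : Fin n → ℝ) = A.zeron n := along_zero (A.point_disc 1)

theorem pt_add {n : ℕ} (a b : Fin n → ℝ) : A.pt (a + b) = (A.pt a ⊠ A.pt b) ⟫ A.addn n := by
  have h : A.point 1 ⟫ A.copy = A.point 1 ⊠ A.point 1 := A.point_copy 1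
  rw [pt, pt, pt, along, along, along, P.tensor_comp, ← h, ← copy_vec_add, P.comp_assoc,
    P.comp_assoc, P.comp_assoc]

theorem pt_smul {n : ℕ} (c : ℝ) (a : Fin n → ℝ) : A.pt (c • a) = A.along (A.point c) a := by
  rw [pt, along_smul, point_scal, mul_one]

theorem middle_one_zero (n : ℕ) : P.middle n 1 0 0 = P.id (n + 1) := by
  have e0 : P.symm 1 0 = P.id 1 := P.symm_zero_right 1
  have h : P.middle n 1 0 0 = P.id (n + 1) ⟫ ((P.id n ⊠ P.id 1) ⟫ ((P.id n ⊠ (P.symm 1 0 ⊠ P.id 0)) ⟫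
    ((P.id n ⊠ P.id 1) ⟫ P.id (n + 1)))) := rfl
  rw [h, P.tensor_id, P.id_comp, P.id_comp, P.id_comp, P.comp_id, e0, P.tensor_id, P.tensor_id]

/-- Adding a product state acts separately on the first `n` wires and on the last one. -/
theorem tensor_addn_succ {n k : ℕ} (y : P.Hom k (n + 1)) (t : P.Hom 0 n) (x : P.Hom 0 1) :
    (y ⊠ (t ⊠ x)) ⟫ A.addn (n + 1) =
      y ⟫ (((P.id n ⊠ t) ⟫ A.addn n) ⊠ ((P.id 1 ⊠ x) ⟫ A.add)) := by
  have h : ((P.id n ⊠ P.id 1) ⊠ (t ⊠ x)) ⟫ P.middle n 1 n 1 =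
      P.middle n 1 0 0 ⟫ ((P.id n ⊠ t) ⊠ (P.id 1 ⊠ x)) := middle_natural _ _ _ _
  rw [middle_one_zero, P.id_comp, P.tensor_id] at h
  rw [state_tensor_eq, addn_succ, P.comp_assoc, ← P.comp_assoc _ (P.middle _ _ _ _), h,
    ← P.tensor_comp]

theorem zeron_tensor_id (n : ℕ) :
    A.zeron n ⊠ P.id 1 = A.vec (n + 1) (Fin.append 0 (fun _ : Fin 1 => 1)) := by
  have h : A.vec 1 (fun _ => 1) = P.id 1 := by rw [vec_one, A.scal_one]
  rw [← h, zeron_tensor_vec]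

/-- The last standard basis vector. -/
def elast (n : ℕ) : Fin (n + 1) → ℝ := Fin.append 0 (fun _ : Fin 1 => 1)

theorem along_elast {n : ℕ} (x : P.Hom 0 1) : A.along x (elast n) = A.zeron n ⊠ x := by
  have e : P.id 0 ⊠ x = x := P.id_tensor x
  rw [along, elast, ← zeron_tensor_id, tensor_eq_right (A.zeron n) x, e]

/-- Adjoining an independent wire is adding a summand along a new basis vector, so tensoring with a
one-wire state reduces to the addition of states. -/
theorem tensor_state {n : ℕ} (t : P.Hom 0 n) (x : P.Hom 0 1) :
    t ⊠ x = ((t ⊠ A.point 0) ⊠ A.along x (elast n)) ⟫ A.addn (n + 1) := by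
  have e : P.id 0 ⊠ x = x := P.id_tensor x
  have e2 : (A.point 0 ⊠ x) ⟫ A.add = x := by
    rw [tensor_eq_right, e, P.comp_assoc, A.zero_add, P.comp_id]
  rw [along_elast, tensor_addn_succ, ← P.tensor_comp, add_zeron, P.comp_id, ← P.comp_assoc,
    ← state_tensor_eq, e2]

theorem tensor_comp_mat_two {n : ℕ} (x y : P.Hom 0 1) (v w : Fin n → ℝ) :
    (x ⊠ y) ⟫ A.mat 2 ![v, w] = (A.along x v ⊠ A.along y w) ⟫ A.addn n := by
  have e : A.mat 2 ![v, w] = (A.vec n v ⊠ A.vec n w) ⟫ A.addn n := by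
    rw [← mat_one (A := A) (fun _ => v)]; rfl
  rw [e, along, along, P.tensor_comp, P.comp_assoc]

theorem mat_two_comp {n : ℕ} (a b c d : ℝ) (v w : Fin n → ℝ) :
    A.mat 2 ![![a, b], ![c, d]] ⟫ A.mat 2 ![v, w] =
      A.mat 2 ![a • v + b • w, c • v + d • w] := by
  rw [mat_comp]
  congr 1
  ext i j
  fin_cases i <;> simp [mmul, Fin.sum_univ_two]

theorem vec_two (a b : ℝ) : A.vec 2 ![a, b] = A.copy ⟫ (A.scal a ⊠ A.scal b) := by
  have h := vec_succ (A := A) (m := 1) ![a, b] (fun _ => a) b (fun j => by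
    rw [Subsingleton.elim j 0]; rfl) rfl
  rw [vec_one] at h
  exact h

/-- The shear adds a multiple of the first value to a free one, which absorbs it by `add_free`. -/
theorem free_shear (x : P.Hom 0 1) (c : ℝ) :
    (x ⊠ A.free) ⟫ A.mat 2 ![![1, c], ![0, 1]] = x ⊠ A.free := by
  have e1 : A.along A.free ![0, 1] = A.zeron 1 ⊠ A.free := by
    have e : elast 1 = ![0, 1] := by ext i; fin_cases i <;> rfl
    rw [← along_elast, e]
  have h : A.scal c ⟫ A.disc = A.disc := A.scal_discard c
  rw [tensor_comp_mat_two, e1]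
  refine (tensor_addn_succ _ _ _).trans ?_
  rw [add_zeron, add_free, along, vec_two, A.scal_one, P.comp_assoc, P.comp_assoc, ← P.tensor_comp,
    ← P.comp_assoc (A.scal c), h, P.comp_id, id_tensor_comp, ← P.comp_assoc A.copy,
    copy_disc_right, P.id_comp, ← state_tensor_eq]

/-- The shear of `free_shear`, pushed forward along the matrix with rows `w` and `v`: next to a free
line along `v`, any other summand may be displaced along `v`. -/
theorem free_absorb {n : ℕ} (x : P.Hom 0 1) (c : ℝ) (v w : Fin n → ℝ) :
    (A.along x (w + c • v) ⊠ A.along A.free v) ⟫ A.addn n =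
      (A.along x w ⊠ A.along A.free v) ⟫ A.addn n := by
  have h := mat_two_comp (A := A) 1 c 0 1 w v
  rw [one_smul, one_smul, zero_smul, _root_.zero_add] at h
  rw [← tensor_comp_mat_two, ← h, ← P.comp_assoc, free_shear, tensor_comp_mat_two]

/-- The rotation axiom, pushed forward along the matrix with rows `v` and `w`. -/
theorem vacuum_rotate {n : ℕ} (θ : ℝ) (h₀ : 0 ≤ θ) (h₁ : θ < 2 * Real.pi) (v w : Fin n → ℝ) :
    (A.along A.vacuum (Real.cos θ • v + Real.sin θ • w) ⊠
      A.along A.vacuum (-Real.sin θ • v + Real.cos θ • w)) ⟫ A.addn n =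
      (A.along A.vacuum v ⊠ A.along A.vacuum w) ⟫ A.addn n := by
  have e : A.mat 2 ![![Real.cos θ, Real.sin θ], ![-Real.sin θ, Real.cos θ]] =
      (A.copy ⊠ A.copy) ⟫ (A.scal (Real.cos θ) ⊠ A.scal (Real.sin θ) ⊠
        A.scal (-Real.sin θ) ⊠ A.scal (Real.cos θ)) ⟫ (P.id 1 ⊠ P.symm 1 1 ⊠ P.id 1) ⟫
        (A.add ⊠ A.add) := by
    have e1 : A.mat 2 ![![Real.cos θ, Real.sin θ], ![-Real.sin θ, Real.cos θ]] =
      (A.vec 2 ![Real.cos θ, Real.sin θ] ⊠ A.vec 2 ![-Real.sin θ, Real.cos θ]) ⟫ A.addn 2 := by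
      rw [← mat_one (A := A) (fun _ => ![Real.cos θ, Real.sin θ])]; rfl
    have e2 : A.scal (Real.cos θ) ⊠ A.scal (Real.sin θ) ⊠
        A.scal (-Real.sin θ) ⊠ A.scal (Real.cos θ) = (A.scal (Real.cos θ) ⊠ A.scal (Real.sin θ)) ⊠
        (A.scal (-Real.sin θ) ⊠ A.scal (Real.cos θ)) :=
      P.tensor_assoc (A.scal (Real.cos θ) ⊠ A.scal (Real.sin θ)) (A.scal (-Real.sin θ))
        (A.scal (Real.cos θ))
    rw [e1, vec_two, vec_two, P.tensor_comp, e2, addn_two, ← P.comp_assoc]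
  have h := A.vacuum_rotation θ h₀ h₁
  have h' : (A.vacuum ⊠ A.vacuum) ⟫
      A.mat 2 ![![Real.cos θ, Real.sin θ], ![-Real.sin θ, Real.cos θ]] =
        A.vacuum ⊠ A.vacuum := by rw [e]; exact h
  rw [← tensor_comp_mat_two, ← mat_two_comp, ← P.comp_assoc, h', tensor_comp_mat_two]

/-! ### Testing the last wire, and inconsistent scalars -/

theorem add_test : A.add ⟫ A.test 0 = A.white 2 0 0 := by
  have h := A.white_fuse 2 0 0 0 0
  have e : P.id 0 ⊠ (A.scal (-1) ⟫ A.white 1 0 0) = A.scal (-1) ⟫ A.white 1 0 0 :=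
    P.id_tensor (A.scal (-1) ⟫ A.white 1 0 0)
  rw [e, ← P.comp_assoc] at h
  exact h.trans (congrArg (A.white 2 0) (_root_.add_zero (0 : ℝ)))

theorem point_add_test (b : ℝ) : (P.id 1 ⊠ A.point b) ⟫ A.add ⟫ A.test 0 = A.test (-b) := by
  have e4 : unbend (A.white 1 1 0) = A.white 2 0 0 := A.unbend_white 1 0 0
  have h := plug_unbend (A.white 1 1 0) (A.point b)
  have e : P.id 0 ⊠ (A.test b) = A.test b := P.id_tensor (A.test b)
  rw [e4, point_cap, e, A.white_antipode] at h
  rw [P.comp_assoc, add_test, h, A.scal_test _ _ (by norm_num)]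
  norm_num

/-- Conditioning the last wire on being zero when one summand is generic. -/
theorem condition_generic {n : ℕ} (x : P.Hom 0 1) (hx : ∀ v, x ⟫ A.test v = P.id 0)
    (r : Fin n → ℝ) (s b : ℝ) (hs : s ≠ 0) (t : P.Hom 0 n) :
    (A.along x (Fin.append r (fun _ : Fin 1 => s)) ⊠ (t ⊠ A.point b)) ⟫ A.addn (n + 1) ⟫
      (P.id n ⊠ A.test 0) = (A.pt ((s⁻¹ * -b) • r) ⊠ t) ⟫ A.addn n := by
  have e1 : A.vec (n + 1) (Fin.append r (fun _ : Fin 1 => s) :) = A.copy ⟫ (A.vec n r ⊠ A.scal s) :=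
    vec_succ (m := n) _ _ _ (fun j => Fin.append_left r _ j) (Fin.append_right r (fun _ => s) 0)
  -- The test `s * x + b = 0` reads `x = s⁻¹ * -b`. By `copy_test` this value is what remains on the
  -- other copy, and `hx` makes the leftover scalar trivial.
  have e2 : (A.copy ⟫ (P.id 1 ⊠ A.test (s⁻¹ * -b))) = A.test (s⁻¹ * -b) ⟫ A.point (s⁻¹ * -b) :=
    A.copy_test _
  have e0 : ∀ f : P.Hom 1 n, f ⊠ A.test (s⁻¹ * -b) = (P.id 1 ⊠ A.test (s⁻¹ * -b)) ⟫ f := by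
    intro f
    rw [tensor_eq_right, P.tensor_id_zero]
  rw [tensor_addn_succ, P.comp_assoc, ← P.tensor_comp, P.comp_id, along, e1,
    P.comp_assoc, P.comp_assoc, ← P.tensor_comp, point_add_test, A.scal_test _ _ hs, e0,
    ← P.comp_assoc A.copy, e2, ← P.comp_assoc, ← P.comp_assoc, ← P.comp_assoc x, hx, P.id_comp, pt_smul,
    along, state_tensor_eq (A.point _ ⟫ _), P.comp_assoc, P.comp_assoc, P.comp_assoc]

theorem point_test (b : ℝ) : A.point b ⟫ A.test 0 = A.white 0 0 b := by
  have h := A.white_fuse 0 0 0 b 0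
  have e : P.id 0 ⊠ (A.scal (-1) ⟫ A.white 1 0 0) = A.scal (-1) ⟫ A.white 1 0 0 :=
    P.id_tensor (A.scal (-1) ⟫ A.white 1 0 0)
  have e2 : A.scal (-1) ⟫ A.white 1 0 0 = A.white 1 0 0 :=
    (A.scal_test (-1) 0 (by norm_num)).trans (by rw [mul_zero]; rfl)
  rw [e, e2] at h
  exact h.trans (congrArg (A.white 0 0) (_root_.add_zero b))

theorem white_zero_zero_zero : A.white 0 0 0 = P.id 0 := by
  rw [← point_test]; exact A.white_bone

/-- A nonzero factor can be moved through the test for zero, so there is only one inconsistent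
scalar. -/
theorem white_zero_zero (b : ℝ) (hb : b ≠ 0) : A.white 0 0 b = A.white 0 0 1 := by
  have h := A.point_scal b 1
  rw [mul_one] at h
  rw [← point_test, ← h, P.comp_assoc, A.scal_test _ _ hb, mul_zero, point_test]

theorem condition_point {n : ℕ} (t : P.Hom 0 n) (b : ℝ) :
    (t ⊠ A.point b) ⟫ (P.id n ⊠ A.test 0) = t ⊠ A.white 0 0 b := by
  rw [← P.tensor_comp, P.comp_id, point_test]

end GaussAlg

/-! ### The monoid of states and its Gaussian elements -/

namespace GaussAlg

variable {P : CompactProp}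

/-- The commutative monoid of states on a given number of wires. -/
@[ext] structure St (A : GaussAlg P) (n : ℕ) where
  /-- The underlying arrow. -/
  arr : P.Hom 0 n

variable {A : GaussAlg P}

instance (n : ℕ) : Add (A.St n) := ⟨fun s t => ⟨(s.arr ⊠ t.arr) ⟫ A.addn n⟩⟩

instance (n : ℕ) : Zero (A.St n) := ⟨⟨A.zeron n⟩⟩

instance (n : ℕ) : AddCommMonoid (A.St n) where
  add_assoc s t r := St.ext (addn_assoc_state s.arr t.arr r.arr)
  zero_add s := St.ext ((addn_comm_state _ _).trans (addn_zero_state s.arr))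
  add_zero s := St.ext (addn_zero_state s.arr)
  add_comm s t := St.ext (addn_comm_state s.arr t.arr)
  nsmul := nsmulRec

/-- The action of an additive arrow on states. -/
def Additive.map {n m : ℕ} {f : P.Hom n m} (hf : A.Additive f) : A.St n →+ A.St m where
  toFun s := ⟨s.arr ⟫ f⟩
  map_zero' := St.ext hf.zero
  map_add' s t := St.ext (by
    change (s.arr ⊠ t.arr) ⟫ A.addn n ⟫ f = ((s.arr ⟫ f) ⊠ (t.arr ⟫ f)) ⟫ A.addn m
    rw [P.comp_assoc, hf.add, ← P.comp_assoc, ← P.tensor_comp])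

variable (A)

/-- The vacuum along a vector. -/
def nu {n : ℕ} (v : Fin n → ℝ) : A.St n := ⟨A.along A.vacuum v⟩

/-- The line spanned by a vector. -/
def line {n : ℕ} (v : Fin n → ℝ) : A.St n := ⟨A.along A.free v⟩

/-- The point with given coordinates. -/
def dot {n : ℕ} (a : Fin n → ℝ) : A.St n := ⟨A.pt a⟩

/-- The Gaussian state with given vacua, free directions and mean. -/
def nf {n : ℕ} (L K : Multiset (Fin n → ℝ)) (a : Fin n → ℝ) : A.St n :=
  (L.map A.nu).sum + (K.map A.line).sum + A.dot a

variable {A}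

theorem nu_zero {n : ℕ} : A.nu (0 : Fin n → ℝ) = 0 := St.ext (along_zero A.vacuum_discard)

theorem line_zero {n : ℕ} : A.line (0 : Fin n → ℝ) = 0 := St.ext (along_zero A.free_disc)

theorem dot_zero {n : ℕ} : A.dot (0 : Fin n → ℝ) = 0 := St.ext pt_zero

theorem dot_add {n : ℕ} (a b : Fin n → ℝ) : A.dot (a + b) = A.dot a + A.dot b := St.ext (pt_add a b)

theorem nu_add_line {n : ℕ} (c : ℝ) (v w : Fin n → ℝ) :
    A.nu (w + c • v) + A.line v = A.nu w + A.line v := St.ext (free_absorb _ c v w)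

theorem line_add_line {n : ℕ} (c : ℝ) (v w : Fin n → ℝ) :
    A.line (w + c • v) + A.line v = A.line w + A.line v := St.ext (free_absorb _ c v w)

theorem dot_add_line {n : ℕ} (c : ℝ) (v w : Fin n → ℝ) :
    A.dot (w + c • v) + A.line v = A.dot w + A.line v := St.ext (free_absorb _ c v w)

theorem nu_rotate {n : ℕ} (c s : ℝ) (h : c ^ 2 + s ^ 2 = 1) (v w : Fin n → ℝ) :
    A.nu (c • v + s • w) + A.nu (-s • v + c • w) = A.nu v + A.nu w := by
  obtain ⟨θ, h0, h1, rfl, rfl⟩ : ∃ θ : ℝ, 0 ≤ θ ∧ θ < 2 * Real.pi ∧ Real.cos θ = c ∧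
      Real.sin θ = s := by
    have hn : ‖(⟨c, s⟩ : ℂ)‖ = 1 := by
      rw [Complex.norm_eq_sqrt_sq_add_sq, h, Real.sqrt_one]
    have h0 : (⟨c, s⟩ : ℂ) ≠ 0 := by rw [← norm_ne_zero_iff, hn]; exact one_ne_zero
    have hc : Real.cos (Complex.arg ⟨c, s⟩) = c := by rw [Complex.cos_arg h0, hn, div_one]
    have hs : Real.sin (Complex.arg ⟨c, s⟩) = s := by rw [Complex.sin_arg, hn, div_one]
    have hp := Real.pi_pos
    have h1 := Complex.neg_pi_lt_arg ⟨c, s⟩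
    have h2 := Complex.arg_le_pi ⟨c, s⟩
    -- The argument lies in `(-π, π]`; a negative one is shifted into the range `[0, 2π)` of the
    -- axiom.
    by_cases hneg : 0 ≤ Complex.arg ⟨c, s⟩
    · exact ⟨_, hneg, by linarith, hc, hs⟩
    · exact ⟨Complex.arg ⟨c, s⟩ + 2 * Real.pi, by linarith, by linarith,
        by rw [Real.cos_add_two_pi, hc], by rw [Real.sin_add_two_pi, hs]⟩
  exact St.ext (vacuum_rotate θ h0 h1 v w)

/-- Rotation of the pair `(v, 0)` by `π`. -/
theorem nu_neg {n : ℕ} (v : Fin n → ℝ) : A.nu (-v) = A.nu v := by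
  have h := nu_rotate (A := A) (-1) 0 (by norm_num) v 0
  simpa [nu_zero] using h

theorem map_along {n m : ℕ} {f : P.Hom n m} {v : Fin n → ℝ} {w : Fin m → ℝ}
    (h : A.vec n v ⟫ f = A.vec m w) (x : P.Hom 0 1) : A.along x v ⟫ f = A.along x w := by
  rw [along, P.comp_assoc, h]; rfl

theorem Additive.map_nf {n m : ℕ} {f : P.Hom n m} (hf : A.Additive f)
    (φ : (Fin n → ℝ) → Fin m → ℝ) (h : ∀ v, A.vec n v ⟫ f = A.vec m (φ v))
    (L K : Multiset (Fin n → ℝ)) (a : Fin n → ℝ) :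
    hf.map (A.nf L K a) = A.nf (L.map φ) (K.map φ) (φ a) := by
  have h1 : ∀ v, hf.map (A.nu v) = A.nu (φ v) := fun v => St.ext (map_along (h v) _)
  have h2 : ∀ v, hf.map (A.line v) = A.line (φ v) := fun v => St.ext (map_along (h v) _)
  have h3 : ∀ v, hf.map (A.dot v) = A.dot (φ v) := fun v => St.ext (map_along (h v) _)
  simp [nf, map_multiset_sum, Multiset.map_map, h1, h2, h3]

theorem nf_add {n : ℕ} (L K L' K' : Multiset (Fin n → ℝ)) (a a' : Fin n → ℝ) :
    A.nf L K a + A.nf L' K' a' = A.nf (L + L') (K + K') (a + a') := by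
  simp only [nf, Multiset.map_add, Multiset.sum_add, dot_add]
  abel

theorem nf_zero {n : ℕ} : A.nf 0 0 (0 : Fin n → ℝ) = 0 := by simp [nf, dot_zero]

theorem nf_dot {n : ℕ} (a : Fin n → ℝ) : A.nf 0 0 a = A.dot a := by simp [nf]

theorem nf_nu {n : ℕ} (v : Fin n → ℝ) : A.nf {v} 0 0 = A.nu v := by simp [nf, dot_zero]

theorem nf_line {n : ℕ} (v : Fin n → ℝ) : A.nf 0 {v} 0 = A.line v := by simp [nf, dot_zero]

variable (A)

/-- The inconsistent scalar. -/
def bot : P.Hom 0 0 := A.white 0 0 1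

/-- States in normal form. -/
def NF {n : ℕ} (t : P.Hom 0 n) : Prop :=
  (∃ L K a, t = (A.nf L K a).arr) ∨ t = A.zeron n ⊠ A.bot

variable {A}

theorem NF.comp_of_nf {n m : ℕ} {f : P.Hom n m} (hf : A.IsMat f) (L K : Multiset (Fin n → ℝ))
    (a : Fin n → ℝ) : A.NF ((A.nf L K a).arr ⟫ f) := by
  choose φ hφ using hf.vec_comp
  exact Or.inl ⟨_, _, _, congrArg St.arr (hf.additive.map_nf φ hφ L K a)⟩

/-! #### Inconsistent states -/

theorem tensor_scalar_comp {n m : ℕ} (t : P.Hom 0 n) (b : P.Hom 0 0) (f : P.Hom n m) :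
    (t ⊠ b) ⟫ f = (t ⟫ f) ⊠ b := by
  conv_lhs => rw [← P.tensor_id_zero f]
  conv_rhs => rw [← P.comp_id b]
  exact (P.tensor_comp t f b (P.id 0)).symm

theorem scalar_swap {n m : ℕ} (f : P.Hom 1 1) (b : P.Hom 0 0) (g : P.Hom n m) :
    (g ⊠ f) ⊠ b = (g ⊠ b) ⊠ f := by
  have h : f ⊠ b = b ⊠ f := by
    have h := P.symm_natural f b
    have h1 : P.symm 1 0 = P.id 1 := P.symm_zero_right 1
    rw [h1, P.comp_id] at h
    exact h.trans (P.id_comp _)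
  have e1 : (g ⊠ f) ⊠ b = g ⊠ (f ⊠ b) := P.tensor_assoc g f b
  have e2 : (g ⊠ b) ⊠ f = g ⊠ (b ⊠ f) := P.tensor_assoc g b f
  rw [e1, e2]
  exact congrArg (P.tensor g) h

variable (A)

/-- Discarding several wires. -/
def discn : ∀ n : ℕ, P.Hom n 0
  | 0 => P.id 0
  | n + 1 => discn n ⊠ A.disc

/-- Several free wires. -/
def freen : ∀ n : ℕ, P.Hom 0 n
  | 0 => P.id 0
  | n + 1 => freen n ⊠ A.free

variable {A}

theorem isMat_discn : ∀ n : ℕ, A.IsMat (A.discn n)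
  | 0 => isMat_id 0
  | n + 1 => (isMat_discn n).tensor isMat_disc

/-- The inconsistency axiom cuts one wire at a time. -/
theorem id_tensor_bot : ∀ n : ℕ, P.id n ⊠ A.bot = (A.discn n ⟫ A.freen n) ⊠ A.bot
  | 0 => by
    have e : A.discn 0 ⟫ A.freen 0 = P.id 0 := P.id_comp _
    rw [e]
  | n + 1 => by
    have e : A.discn (n + 1) ⟫ A.freen (n + 1) = (A.discn n ⟫ A.freen n) ⊠ (A.disc ⟫ A.free) :=
      (P.tensor_comp _ _ _ _).symm
    have h : A.bot ⊠ P.id 1 = A.bot ⊠ (A.disc ⟫ A.free) := A.empty 1 one_ne_zero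
    have e1 : P.id n ⊠ A.bot ⊠ P.id 1 = P.id n ⊠ (A.bot ⊠ P.id 1) :=
      P.tensor_assoc (P.id n) A.bot (P.id 1)
    have e2 : P.id n ⊠ (A.bot ⊠ (A.disc ⟫ A.free)) = P.id n ⊠ A.bot ⊠ (A.disc ⟫ A.free) :=
      (P.tensor_assoc (P.id n) A.bot (A.disc ⟫ A.free)).symm
    rw [e, ← P.tensor_id n 1, scalar_swap, e1, h, e2, id_tensor_bot n, scalar_swap]

/-- Beside an inconsistent scalar every wire is cut, so a state enters only through what remains of
it after discarding all wires. -/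
theorem tensor_bot {n : ℕ} {t t' : P.Hom 0 n} (h : t ⟫ A.discn n = t' ⟫ A.discn n) :
    t ⊠ A.bot = t' ⊠ A.bot := by
  have key : ∀ t : P.Hom 0 n, t ⊠ A.bot = (t ⟫ A.discn n ⟫ A.freen n) ⊠ A.bot := fun t => by
    have h1 : t ⊠ A.bot = t ⟫ (P.id n ⊠ A.bot) := state_tensor_eq t A.bot
    have h2 : (t ⟫ A.discn n ⟫ A.freen n) ⊠ A.bot = t ⟫ ((A.discn n ⟫ A.freen n) ⊠ A.bot) := by
      have := P.tensor_comp t (A.discn n ⟫ A.freen n) (P.id 0) A.bot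
      rw [P.id_comp, P.tensor_id_zero] at this
      rw [P.comp_assoc]; exact this
    rw [h1, id_tensor_bot, h2]
  rw [key t, key t', h]

/-- One copy of `bot` is the wire from `point 1` to `test 0`. The other copy cuts this wire, and
both halves are trivial. -/
theorem bot_tensor_bot : A.bot ⊠ A.bot = A.bot := by
  have h : A.bot ⊠ P.id 1 = A.bot ⊠ (A.disc ⟫ A.free) := A.empty 1 one_ne_zero
  have e : A.point 1 ⟫ A.test 0 = A.bot := A.point_test 1
  have h2 := congrArg (fun f => (P.id 0 ⊠ A.point 1) ⟫ f ⟫ (P.id 0 ⊠ A.test 0)) h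
  rw [← P.tensor_comp, ← P.tensor_comp, ← P.tensor_comp, ← P.tensor_comp, P.id_comp, P.comp_id,
    P.comp_id, e, ← P.comp_assoc, point_disc, P.id_comp, free_test, P.tensor_id_zero] at h2
  exact h2

theorem discn_state (v : A.St 0) (L K : Multiset (Fin 0 → ℝ)) (a : Fin 0 → ℝ) (h : v = A.nf L K a) :
    v = 0 := by
  subst h
  have e : ∀ w : Fin 0 → ℝ, w = 0 := fun w => Subsingleton.elim _ _
  have h1 : ∀ w : Fin 0 → ℝ, A.nu w = 0 := fun w => by rw [e w, nu_zero]
  have h2 : ∀ w : Fin 0 → ℝ, A.line w = 0 := fun w => by rw [e w, line_zero]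
  have h3 : A.dot a = 0 := by rw [e a, dot_zero]
  simp [nf, h1, h2, h3]

/-- All Gaussian states have the same trivial discard, hence become equal beside `bot`. -/
theorem nf_tensor_bot {n : ℕ} (L K : Multiset (Fin n → ℝ)) (a : Fin n → ℝ) :
    (A.nf L K a).arr ⊠ A.bot = A.zeron n ⊠ A.bot := by
  apply tensor_bot
  have hd := isMat_discn (A := A) n
  choose φ hφ using hd.vec_comp
  have h := discn_state _ _ _ _ (hd.additive.map_nf φ hφ L K a)
  exact (congrArg St.arr h).trans hd.additive.zero.symm

theorem NF.tensor_bot {n : ℕ} {t : P.Hom 0 n} (ht : A.NF t) : t ⊠ A.bot = A.zeron n ⊠ A.bot := by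
  obtain ⟨L, K, a, rfl⟩ | rfl := ht
  · exact nf_tensor_bot L K a
  · have e : A.zeron n ⊠ A.bot ⊠ A.bot = A.zeron n ⊠ (A.bot ⊠ A.bot) :=
      P.tensor_assoc (A.zeron n) A.bot A.bot
    refine e.trans ?_
    rw [bot_tensor_bot]

/-! ### Arrows preserving normal forms -/

variable (A)

/-- Arrows that preserve normal forms. -/
def Good {n m : ℕ} (f : P.Hom n m) : Prop :=
  ∀ (k : ℕ) (s : P.Hom 0 (k + n)), A.NF s → A.NF (s ⟫ (P.id k ⊠ f))

variable {A}

theorem nf_bot (n : ℕ) : A.NF (A.zeron n ⊠ A.bot) := Or.inr rfl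

/-- Inconsistent states need no check of their own: `bot` floats past `f`, and beside it any
resulting normal form collapses to the standard one. -/
theorem good_of_nf {n m : ℕ} {f : P.Hom n m}
    (h : ∀ (k : ℕ) L K a, A.NF ((A.nf (n := k + n) L K a).arr ⟫ (P.id k ⊠ f))) : A.Good f := by
  rintro k s (⟨L, K, a, rfl⟩ | rfl)
  · exact h k L K a
  · have h0 := h k 0 0 0
    rw [nf_zero] at h0
    have e := tensor_scalar_comp (A.zeron (k + n)) A.bot (P.id k ⊠ f)
    have e' : (A.zeron (k + n) ⊠ A.bot) ⟫ (P.id k ⊠ f) = A.zeron (k + m) ⊠ A.bot :=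
      e.trans h0.tensor_bot
    exact e' ▸ nf_bot (k + m)

theorem IsMat.good {n m : ℕ} {f : P.Hom n m} (hf : A.IsMat f) : A.Good f :=
  good_of_nf fun k _ _ _ => NF.comp_of_nf ((isMat_id k).tensor hf) _ _ _

theorem NF.comp_isMat {n m : ℕ} {f : P.Hom n m} {s : P.Hom 0 n} (hs : A.NF s) (hf : A.IsMat f) :
    A.NF (s ⟫ f) := by
  obtain ⟨L, K, a, rfl⟩ | rfl := hs
  · exact NF.comp_of_nf hf L K a
  · have h0 := NF.comp_of_nf hf 0 0 0
    rw [nf_zero] at h0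
    have e' : (A.zeron n ⊠ A.bot) ⟫ f = A.zeron m ⊠ A.bot :=
      (tensor_scalar_comp (A.zeron n) A.bot f).trans h0.tensor_bot
    exact e' ▸ nf_bot m

theorem Good.comp {n m k : ℕ} {f : P.Hom n m} {g : P.Hom m k} (hf : A.Good f) (hg : A.Good g) :
    A.Good (f ⟫ g) := fun l s hs => by
  rw [id_tensor_comp, ← P.comp_assoc]
  exact hg l _ (hf l s hs)

/-- The idle wires in the definition of `Good` are there for this closure property: `l` more of them
are merged with the given `k`. -/
theorem Good.id_tensor {n m : ℕ} {f : P.Hom n m} (hf : A.Good f) (l : ℕ) :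
    A.Good (P.id l ⊠ f) := fun k s hs => by
  have h := tensor_assoc_idCast (P.id k) (P.id l) f
  rw [P.tensor_id] at h
  have h2 : P.id k ⊠ (P.id l ⊠ f) = P.idCast (Nat.add_assoc k l n).symm ⟫ ((P.id (k + l) ⊠ f) ⟫
      P.idCast (Nat.add_assoc k l m)) := by
    rw [h, ← P.comp_assoc, idCast_comp, idCast_rfl, P.id_comp]
  rw [h2, ← P.comp_assoc, ← P.comp_assoc]
  exact (hf (k + l) _ (hs.comp_isMat (isMat_idCast _))).comp_isMat (isMat_idCast _)

theorem Good.tensor_id {n m : ℕ} {f : P.Hom n m} (hf : A.Good f) (l : ℕ) :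
    A.Good (f ⊠ P.id l) := by
  have h : f ⊠ P.id l = P.symm n l ⟫ (P.id l ⊠ f) ⟫ P.symm l m := by
    rw [← P.symm_natural, P.comp_assoc, P.symm_symm, P.comp_id]
  rw [h]
  exact ((isMat_symm n l).good.comp (hf.id_tensor l)).comp (isMat_symm l m).good

theorem Good.tensor {n m n' m' : ℕ} {f : P.Hom n m} {g : P.Hom n' m'} (hf : A.Good f)
    (hg : A.Good g) : A.Good (f ⊠ g) := by
  rw [tensor_eq_left]
  exact (hf.tensor_id n').comp (hg.id_tensor m)

/-- Tensoring with a one-wire state. -/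
theorem good_state {x : P.Hom 0 1}
    (hx : ∀ {n : ℕ} (v : Fin n → ℝ), ∃ L K a, (⟨A.along x v⟩ : A.St n) = A.nf L K a) :
    A.Good x := by
  refine good_of_nf fun k L K a => ?_
  have hm : A.IsMat (P.id k ⊠ A.point 0) := (isMat_id k).tensor isMat_point_zero
  choose φ hφ using hm.vec_comp
  have h1 := hm.additive.map_nf φ hφ L K a
  obtain ⟨L', K', a', h2⟩ := hx (elast k)
  have e : (A.nf L K a).arr ⟫ (P.id k ⊠ x) = (A.nf L K a).arr ⊠ x := (state_tensor_eq _ _).symm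
  have e2 : (A.nf L K a).arr ⟫ (P.id k ⊠ A.point 0) = (A.nf L K a).arr ⊠ A.point 0 :=
    (state_tensor_eq _ _).symm
  refine Or.inl ⟨L.map φ + L', K.map φ + K', φ a + a', ?_⟩
  refine e.trans ?_
  rw [tensor_state, ← nf_add, ← h1, ← h2, ← e2]
  rfl

theorem good_vacuum : A.Good A.vacuum := good_state fun v => ⟨{v}, 0, 0, (nf_nu v).symm⟩

theorem good_free : A.Good A.free := good_state fun v => ⟨0, {v}, 0, (nf_line v).symm⟩

theorem good_point (a : ℝ) : A.Good (A.point a) :=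
  good_state fun v => ⟨0, 0, a • v, by rw [nf_dot, dot, pt_smul]⟩

end GaussAlg

namespace GaussAlg

variable {P : CompactProp} {A : GaussAlg P}

/-! ### Conditioning -/

theorem append_init_last {n : ℕ} (v : Fin (n + 1) → ℝ) :
    (Fin.append (fun i : Fin n => v i.castSucc) (fun _ : Fin 1 => v (Fin.last n)) :) = v := by
  ext i
  refine Fin.lastCases ?_ (fun i => ?_) i
  · exact Fin.append_right (fun i : Fin n => v i.castSucc) (fun _ : Fin 1 => v (Fin.last n)) 0
  · exact Fin.append_left (fun i : Fin n => v i.castSucc) (fun _ : Fin 1 => v (Fin.last n)) i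

theorem append_castSucc {n : ℕ} (v : Fin n → ℝ) (w : Fin 1 → ℝ) (i : Fin n) :
    (Fin.append v w : Fin (n + 1) → ℝ) i.castSucc = v i := Fin.append_left v w i

theorem append_last {n : ℕ} (v : Fin n → ℝ) (w : Fin 1 → ℝ) :
    (Fin.append v w : Fin (n + 1) → ℝ) (Fin.last n) = w 0 := Fin.append_right v w 0

/-- If no vacuum and no line moves the last wire, that wire carries only the last coordinate of the
mean and splits off as a point. -/
theorem nf_tensor_point {n : ℕ} (L K : Multiset (Fin (n + 1) → ℝ)) (a : Fin (n + 1) → ℝ)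
    (hL : ∀ v ∈ L, v (Fin.last n) = 0) (hK : ∀ v ∈ K, v (Fin.last n) = 0) :
    ∃ L' K' a', (A.nf L K a).arr =
      (A.nf L' K' a' : A.St n).arr ⊠ A.point (a (Fin.last n)) := by
  let ini : (Fin (n + 1) → ℝ) → Fin n → ℝ := fun v i => v i.castSucc
  let ext : (Fin n → ℝ) → Fin (n + 1) → ℝ := fun v => Fin.append v (0 : Fin 1 → ℝ)
  have hm : A.IsMat (P.id n ⊠ A.point 0) := (isMat_id n).tensor isMat_point_zero
  have hφ : ∀ v, A.vec n v ⟫ (P.id n ⊠ A.point 0) = A.vec (n + 1) (ext v) := fun v => by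
    have h := vec_tensor_zeron (A := A) v 1
    rw [zeron_one] at h
    exact (state_tensor_eq _ _).symm.trans h
  have hext : ∀ v : Fin (n + 1) → ℝ, v (Fin.last n) = 0 → ext (ini v) = v := fun v hv => by
    refine Eq.trans ?_ (append_init_last v)
    rw [hv]; rfl
  have h1 := hm.additive.map_nf ext hφ (L.map ini) (K.map ini) (ini a)
  have eL : (L.map ini).map ext = L := by
    rw [Multiset.map_map]
    conv_rhs => rw [← Multiset.map_id L]
    exact Multiset.map_congr rfl fun v hv => hext v (hL v hv)
  have eK : (K.map ini).map ext = K := by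
    rw [Multiset.map_map]
    conv_rhs => rw [← Multiset.map_id K]
    exact Multiset.map_congr rfl fun v hv => hext v (hK v hv)
  rw [eL, eK] at h1
  refine ⟨L.map ini, K.map ini, ini a, ?_⟩
  have ea : a = ext (ini a) + a (Fin.last n) • elast n := by
    ext i
    refine Fin.lastCases ?_ (fun i => ?_) i
    · simp [ext, elast, append_last]
    · simp [ext, elast, append_castSucc, ini]
  have e2 : (A.nf (L.map ini) (K.map ini) (ini a)).arr ⟫ (P.id n ⊠ A.point 0) =
      (A.nf (L.map ini) (K.map ini) (ini a)).arr ⊠ A.point 0 := (state_tensor_eq _ _).symm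
  have e3 : A.nf L K a = A.nf L K (ext (ini a)) + A.dot (a (Fin.last n) • elast n) := by
    conv_lhs => rw [ea]
    rw [← nf_dot, nf_add, _root_.add_zero, _root_.add_zero]
  rw [e3, ← h1, tensor_state, ← e2, ← pt_smul]
  rfl

theorem sum_absorb {n : ℕ} (f : (Fin n → ℝ) → A.St n) (b : Fin n → ℝ)
    (hf : ∀ (c : ℝ) w, f (w + c • b) + A.line b = f w + A.line b) (c : (Fin n → ℝ) → ℝ)
    (L : Multiset (Fin n → ℝ)) :
    (L.map fun w => f (w + c w • b)).sum + A.line b = (L.map f).sum + A.line b := by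
  induction L using Multiset.induction with
  | empty => rfl
  | cons w L ih =>
    rw [Multiset.map_cons, Multiset.map_cons, Multiset.sum_cons, Multiset.sum_cons,
      _root_.add_assoc, ih, add_left_comm, hf, add_left_comm, _root_.add_assoc]

/-- Beside a line along `b` all data may be displaced by multiples of `b`, with a separate multiple
for each vector. Conditioning uses this to clear a coordinate. -/
theorem nf_absorb {n : ℕ} (b : Fin n → ℝ) (c : (Fin n → ℝ) → ℝ) (L K : Multiset (Fin n → ℝ))
    (a : Fin n → ℝ) :
    A.nf (L.map fun w => w + c w • b) (K.map fun w => w + c w • b) (a + c a • b) + A.line b =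
      A.nf L K a + A.line b := by
  have h1 := sum_absorb A.nu b (fun c w => nu_add_line c b w) c L
  have h2 := sum_absorb A.line b (fun c w => line_add_line c b w) c K
  have h3 := dot_add_line (A := A) (c a) b a
  have key : ∀ {x x' y y' z z' l : A.St n}, x + l = x' + l → y + l = y' + l → z + l = z' + l →
      x + y + z + l = x' + y' + z' + l := by
    intro x x' y y' z z' l hx hy hz
    calc x + y + z + l = (x + l) + (y + z) := by abel
      _ = (y + l) + (x' + z) := by rw [hx]; abel
      _ = (z + l) + (x' + y') := by rw [hy]; abel
      _ = x' + y' + z' + l := by rw [hz]; abel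
  simp only [nf, Multiset.map_map, Function.comp_def]
  exact key h1 h2 h3

theorem exists_rotation (x y : ℝ) : ∃ c s : ℝ, c ^ 2 + s ^ 2 = 1 ∧ c * x + s * y = 0 := by
  by_cases h : x ^ 2 + y ^ 2 = 0
  · refine ⟨1, 0, by norm_num, ?_⟩
    have : x = 0 := by nlinarith [sq_nonneg x, sq_nonneg y]
    rw [this]; ring
  · have hp : 0 < x ^ 2 + y ^ 2 := lt_of_le_of_ne (by positivity) (Ne.symm h)
    have hs := Real.sq_sqrt hp.le
    have hne : Real.sqrt (x ^ 2 + y ^ 2) ≠ 0 := (Real.sqrt_pos.2 hp).ne'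
    -- The unit vector orthogonal to `(x, y)`.
    refine ⟨y / Real.sqrt (x ^ 2 + y ^ 2), -x / Real.sqrt (x ^ 2 + y ^ 2), ?_, ?_⟩
    · rw [div_pow, div_pow, hs]; field_simp; ring
    · field_simp; ring

/-- The covariance of a family of vectors. -/
def gram {n : ℕ} (L : Multiset (Fin n → ℝ)) (i j : Fin n) : ℝ := (L.map fun v => v i * v j).sum

theorem gram_cons {n : ℕ} (v : Fin n → ℝ) (L : Multiset (Fin n → ℝ)) (i j : Fin n) :
    gram (v ::ₘ L) i j = v i * v j + gram L i j := by
  simp [gram]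

/-- Rotating a family of vacua so that all but one vector vanish at a given coordinate. -/
theorem exists_rotated {n : ℕ} (j : Fin n) (L : Multiset (Fin n → ℝ)) :
    ∃ w L', (L.map A.nu).sum = A.nu w + (L'.map A.nu).sum ∧ gram L = gram (w ::ₘ L') ∧
      (∀ v ∈ L', v j = 0) ∧ ∀ i, (∀ v ∈ L, v i = 0) → ∀ v ∈ w ::ₘ L', v i = 0 := by
  induction L using Multiset.induction with
  | empty => exact ⟨0, 0, by simp [nu_zero], by ext; simp [gram], by simp, by simp⟩
  | cons v L ih =>
    obtain ⟨w, L', h1, h2, h3, h4⟩ := ih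
    obtain ⟨c, s, hcs, h0⟩ := exists_rotation (v j) (w j)
    -- The new vector `v` is rotated against the exceptional vector `w`: one combination vanishes at
    -- `j`, the other becomes the new exceptional vector.
    refine ⟨-s • v + c • w, (c • v + s • w) ::ₘ L', ?_, ?_, ?_, ?_⟩
    · rw [Multiset.map_cons, Multiset.sum_cons, h1, Multiset.map_cons, Multiset.sum_cons,
        ← _root_.add_assoc, ← nu_rotate c s hcs, ← _root_.add_assoc, add_comm (A.nu (c • v + _))]
    · ext i k
      rw [gram_cons, h2, gram_cons, gram_cons, gram_cons]
      simp only [Pi.add_apply, Pi.smul_apply, smul_eq_mul]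
      linear_combination -(v i * v k + w i * w k) * hcs
    · intro u hu
      rcases Multiset.mem_cons.1 hu with rfl | hu
      · simpa using h0
      · exact h3 u hu
    · intro i hi u hu
      have hv : v i = 0 := hi v (Multiset.mem_cons_self v L)
      have hL := h4 i fun u hu => hi u (Multiset.mem_cons_of_mem hu)
      have hw : w i = 0 := hL w (Multiset.mem_cons_self w L')
      rcases Multiset.mem_cons.1 hu with rfl | hu
      · simp [hv, hw]
      rcases Multiset.mem_cons.1 hu with rfl | hu
      · simp [hv, hw]
      · exact hL u (Multiset.mem_cons_of_mem hu)

theorem tensor_white_nf {n : ℕ} (L K : Multiset (Fin n → ℝ)) (a : Fin n → ℝ) (b : ℝ) :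
    A.NF ((A.nf L K a).arr ⊠ A.white 0 0 b) := by
  by_cases hb : b = 0
  · have e : (A.nf L K a).arr ⊠ A.white 0 0 b = (A.nf L K a).arr := by
      rw [hb, white_zero_zero_zero]; exact P.tensor_id_zero _
    rw [NF]; exact Or.inl ⟨L, K, a, e⟩
  · have e : (A.nf L K a).arr ⊠ A.white 0 0 b = A.zeron n ⊠ A.bot := by
      rw [white_zero_zero b hb]; exact nf_tensor_bot L K a
    exact e ▸ nf_bot n

/-- The only summand moving the last wire is consumed by the test: it is solved for, and its sole
trace is a displacement of the mean. -/
theorem condition_nf {n : ℕ} {x : P.Hom 0 1} (hx : ∀ v, x ⟫ A.test v = P.id 0)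
    (w : Fin (n + 1) → ℝ) (hw : w (Fin.last n) ≠ 0) {L K : Multiset (Fin (n + 1) → ℝ)}
    {a : Fin (n + 1) → ℝ} (hL : ∀ v ∈ L, v (Fin.last n) = 0) (hK : ∀ v ∈ K, v (Fin.last n) = 0) :
    A.NF ((⟨A.along x w⟩ + A.nf L K a : A.St (n + 1)).arr ⟫ (P.id n ⊠ A.test 0)) := by
  obtain ⟨L', K', a', h⟩ := nf_tensor_point (A := A) L K a hL hK
  have h' : A.nf L K a = ⟨(A.nf L' K' a').arr ⊠ A.point (a (Fin.last n))⟩ := St.ext h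
  have hc := condition_generic x hx (fun i : Fin n => w i.castSucc) (w (Fin.last n))
    (a (Fin.last n)) hw (A.nf L' K' a').arr
  have hd := nf_add (A := A) 0 0 L' K' (((w (Fin.last n))⁻¹ * -(a (Fin.last n))) •
    (fun i : Fin n => w i.castSucc)) a'
  rw [nf_dot] at hd
  rw [h']
  refine Or.inl ⟨_, _, _, Eq.trans ?_ (hc.trans (congrArg St.arr hd))⟩
  exact congrArg (fun u => ((A.along x u) ⊠ ((A.nf L' K' a').arr ⊠ A.point (a (Fin.last n)))) ⟫
    A.addn (n + 1) ⟫ (P.id n ⊠ A.test 0)) (append_init_last w).symm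

theorem vacuum_test (v : ℝ) : A.vacuum ⟫ A.test v = P.id 0 := A.vacuum_point v

/-- If some line moves the last wire, it clears that wire from every other summand and is consumed
by the test. Otherwise the vacua are rotated until only one can move the wire. Either that vacuum is
consumed, or the wire is deterministic and the test is a scalar. -/
theorem good_test : A.Good (A.test 0) := by
  refine good_of_nf fun n L K a => ?_
  by_cases hK : ∀ v ∈ K, v (Fin.last n) = 0
  · obtain ⟨w, L', h1, -, h3, -⟩ := exists_rotated (A := A) (Fin.last n) L
    by_cases hw : w (Fin.last n) = 0
    · have e : A.nf L K a = A.nf (w ::ₘ L') K a := by simp [nf, h1]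
      obtain ⟨L₀, K₀, a₀, h⟩ := nf_tensor_point (A := A) (w ::ₘ L') K a (fun v hv => by
        rcases Multiset.mem_cons.1 hv with rfl | hv
        exacts [hw, h3 v hv]) hK
      rw [e, h, condition_point]
      exact tensor_white_nf L₀ K₀ a₀ _
    · have e : A.nf L K a = ⟨A.along A.vacuum w⟩ + A.nf L' K a := by
        simp only [nf, h1, _root_.add_assoc]; rfl
      rw [e]
      exact condition_nf vacuum_test w hw h3 hK
  · push Not at hK
    obtain ⟨b, hb, hb0⟩ := hK
    obtain ⟨K', rfl⟩ := Multiset.exists_cons_of_mem hb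
    have e : A.nf L (b ::ₘ K') a = A.nf L K' a + A.line b := by
      simp only [nf, Multiset.map_cons, Multiset.sum_cons]; abel
    -- The multiple of `b` that cancels the last coordinate of `w`.
    let c : (Fin (n + 1) → ℝ) → ℝ := fun w => -(w (Fin.last n) / b (Fin.last n))
    have hc : ∀ w : Fin (n + 1) → ℝ, (w + c w • b) (Fin.last n) = 0 := fun w => by
      simp only [c, Pi.add_apply, Pi.smul_apply, smul_eq_mul]
      field_simp; ring
    rw [e, ← nf_absorb b c, add_comm _ (A.line b)]
    refine condition_nf A.free_test b hb0 (fun v hv => ?_) (fun v hv => ?_) <;>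
    · obtain ⟨w, -, rfl⟩ := Multiset.mem_map.1 hv
      exact hc w

/-! ### The cup, the cap and the spiders preserve normal forms -/

theorem good_cup : A.Good P.cup := by
  rw [A.cup_eq]; exact good_free.comp isMat_copy.good

theorem good_cap : A.Good P.cap := by
  rw [A.cap_eq]
  exact (((isMat_scal (-1)).tensor (isMat_id 1)).comp isMat_add).good.comp good_test

theorem Good.unbend {n m : ℕ} {f : P.Hom n (m + 1)} (hf : A.Good f) :
    A.Good (CompactProp.unbend f) :=
  (hf.tensor_id 1).comp (good_cap.id_tensor m)

theorem Good.bend {n m : ℕ} {f : P.Hom (n + 1) m} (hf : A.Good f) : A.Good (CompactProp.bend f) :=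
  (good_cup.id_tensor n).comp (hf.tensor_id 1)

theorem good_grey_zero : ∀ m : ℕ, A.Good (A.grey 0 m)
  | 0 => by
    -- Fusion with no remaining leg: the spider without legs is a discarded free wire.
    have h := A.grey_fuse 0 0 0
    rw [← h]
    exact good_free.comp (isMat_disc.good.id_tensor 0)
  | 1 => good_free
  | m + 2 => by
    have h := A.grey_fuse 0 m 2
    rw [← h]
    exact (good_grey_zero (m + 1)).comp (isMat_copy.good.id_tensor m)

/-- Inputs are bent outputs, so the states `grey 0 m` suffice. -/
theorem good_grey : ∀ n m : ℕ, A.Good (A.grey n m)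
  | 0, m => good_grey_zero m
  | n + 1, m => by rw [← A.unbend_grey]; exact (good_grey n (m + 1)).unbend

theorem good_white_two_one : A.Good (A.white 2 1 0) := by
  have h : A.white 2 1 0 = A.add ⟫ A.scal (-1) := by
    unfold add
    rw [P.comp_assoc, A.scal_neg_one_comp, P.comp_id]
  rw [h]
  exact (isMat_add.comp (isMat_scal _)).good

theorem good_white_zero (a : ℝ) : ∀ m : ℕ, A.Good (A.white 0 m a)
  | 0 => by
    rw [← A.point_test]; exact (good_point a).comp good_test
  | 1 => good_point a
  | m + 2 => by
    have h := A.white_fuse 0 m 2 a 0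
    rw [_root_.add_zero] at h
    have h12 : A.Good (A.white 1 2 0) := by
      rw [← A.white_bend 1 1 0]; exact good_white_two_one.bend
    rw [← h]
    exact (good_white_zero a (m + 1)).comp (((isMat_scal _).good.comp h12).id_tensor m)

theorem good_white (a : ℝ) : ∀ n m : ℕ, A.Good (A.white n m a)
  | 0, m => good_white_zero a m
  | n + 1, m => by rw [← A.unbend_white]; exact (good_white a n (m + 1)).unbend

end GaussAlg

namespace GaussAlg

variable {P : CompactProp} {A : GaussAlg P}

/-! ### Uniqueness of normal forms -/

theorem gram_eq_zero {n : ℕ} {L : Multiset (Fin n → ℝ)} {j : Fin n} (h : ∀ v ∈ L, v j = 0)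
    (i : Fin n) : gram L i j = 0 := by
  refine Multiset.sum_eq_zero fun x hx => ?_
  obtain ⟨v, hv, rfl⟩ := Multiset.mem_map.1 hx
  rw [h v hv, mul_zero]

/-- Two factorisations of one positive matrix differ by rotations. This is shown by a triangular
reduction on the number `k` of coordinates that may be nonzero. Both families are rotated so that a
single vector meets the last such coordinate; that vector is determined up to sign by its column of
the Gram matrix and is split off. -/
theorem nu_sum_congr_of_support {n : ℕ} (k : ℕ) : ∀ L L' : Multiset (Fin n → ℝ),
    (∀ i : Fin n, k ≤ i → ∀ v ∈ L, v i = 0) → (∀ i : Fin n, k ≤ i → ∀ v ∈ L', v i = 0) →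
    gram L = gram L' → (L.map A.nu).sum = (L'.map A.nu).sum := by
  induction k with
  | zero =>
    have key : ∀ L : Multiset (Fin n → ℝ), (∀ i : Fin n, 0 ≤ (i : ℕ) → ∀ v ∈ L, v i = 0) →
        (L.map A.nu).sum = 0 := fun L hL => by
      refine Multiset.sum_eq_zero fun x hx => ?_
      obtain ⟨v, hv, rfl⟩ := Multiset.mem_map.1 hx
      rw [show v = 0 from funext fun i => hL i (Nat.zero_le _) v hv, nu_zero]
    intro L L' hL hL' _
    rw [key L hL, key L' hL']
  | succ k ih =>
    intro L L' hL hL' hg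
    by_cases hk : n ≤ k
    · exact ih L L' (fun i hi => absurd (hi.trans_lt i.2) (by omega))
        (fun i hi => absurd (hi.trans_lt i.2) (by omega)) hg
    let j : Fin n := ⟨k, by omega⟩
    obtain ⟨w, M, h1, h2, h3, h4⟩ := exists_rotated (A := A) j L
    obtain ⟨w', M', h1', h2', h3', h4'⟩ := exists_rotated (A := A) j L'
    -- The vectors of `M` and `M'` vanish at `j`, so the exceptional vectors alone produce this
    -- column.
    have hcol : ∀ i, w i * w j = w' i * w' j := fun i => by
      have := congrFun (congrFun (h2.symm.trans (hg.trans h2')) i) j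
      rwa [gram_cons, gram_cons, gram_eq_zero h3, gram_eq_zero h3', _root_.add_zero,
        _root_.add_zero] at this
    have hlt : ∀ i : Fin n, k ≤ i → i = j ∨ k + 1 ≤ i := fun i hi => by
      rcases hi.eq_or_lt with h | h
      · exact Or.inl (Fin.ext h.symm)
      · exact Or.inr h
    -- If the exceptional entry is zero, both rotated families already vanish at `j` and the
    -- induction hypothesis applies to them whole.
    by_cases hw : w j = 0
    · have hw' : w' j = 0 := by
        have := hcol j
        rw [hw, mul_zero] at this
        exact mul_self_eq_zero.1 this.symm
      have := ih (w ::ₘ M) (w' ::ₘ M') (fun i hi v hv => ?_) (fun i hi v hv => ?_)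
        (h2.symm.trans (hg.trans h2'))
      · rwa [Multiset.map_cons, Multiset.map_cons, Multiset.sum_cons, Multiset.sum_cons, ← h1,
          ← h1'] at this
      · rcases hlt i hi with rfl | hi
        · rcases Multiset.mem_cons.1 hv with rfl | hv
          exacts [hw, h3 v hv]
        · exact h4 i (hL i hi) v hv
      · rcases hlt i hi with rfl | hi
        · rcases Multiset.mem_cons.1 hv with rfl | hv
          exacts [hw', h3' v hv]
        · exact h4' i (hL' i hi) v hv
    · have hww : w' = w ∨ w' = -w := by
        rcases mul_self_eq_mul_self_iff.1 (hcol j) with h | h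
        · refine Or.inl (funext fun i => ?_)
          have := hcol i
          rw [← h] at this
          exact (mul_right_cancel₀ hw this).symm
        · refine Or.inr (funext fun i => ?_)
          have := hcol i
          have hj : w' j = -w j := by rw [h, neg_neg]
          rw [hj] at this
          have : w i * w j = (-w' i) * w j := by linarith
          have := mul_right_cancel₀ hw this
          simp [this]
      have hnu : A.nu w' = A.nu w := by
        rcases hww with rfl | rfl
        exacts [rfl, nu_neg w]
      have hM := ih M M' (fun i hi v hv => ?_) (fun i hi v hv => ?_) ?_
      · rw [h1, h1', hM, hnu]
      · rcases hlt i hi with rfl | hi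
        · exact h3 v hv
        · exact h4 i (hL i hi) v (Multiset.mem_cons_of_mem hv)
      · rcases hlt i hi with rfl | hi
        · exact h3' v hv
        · exact h4' i (hL' i hi) v (Multiset.mem_cons_of_mem hv)
      · ext i l
        have := congrFun (congrFun (h2.symm.trans (hg.trans h2')) i) l
        rw [gram_cons, gram_cons] at this
        have hp : w' i * w' l = w i * w l := by
          rcases hww with rfl | rfl
          · rfl
          · simp
        linarith

theorem nu_sum_congr {n : ℕ} {L L' : Multiset (Fin n → ℝ)} (h : gram L = gram L') :
    (L.map A.nu).sum = (L'.map A.nu).sum :=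
  nu_sum_congr_of_support n L L' (fun i hi => absurd i.2 (by omega))
    (fun i hi => absurd i.2 (by omega)) h

/-- Multiples of single vectors of `K` are absorbed by their own line, and displacements compose, so
the whole span is absorbed. -/
theorem line_mem_absorb {n : ℕ} {f : (Fin n → ℝ) → A.St n}
    (hf : ∀ (c : ℝ) b w, f (w + c • b) + A.line b = f w + A.line b) {K : Multiset (Fin n → ℝ)}
    {u : Fin n → ℝ} (hu : u ∈ Submodule.span ℝ {v | v ∈ K}) :
    ∀ w, f (w + u) + (K.map A.line).sum = f w + (K.map A.line).sum := by
  have key : ∀ b ∈ K, ∀ (c : ℝ) w,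
      f (w + c • b) + (K.map A.line).sum = f w + (K.map A.line).sum := fun b hb c w => by
    obtain ⟨K', rfl⟩ := Multiset.exists_cons_of_mem hb
    rw [Multiset.map_cons, Multiset.sum_cons, ← _root_.add_assoc, hf, _root_.add_assoc]
  induction hu using Submodule.closure_induction with
  | zero => intro w; rw [_root_.add_zero]
  | add x y _ _ hx hy => intro w; rw [← _root_.add_assoc, hy, hx]
  | smul_mem c b hb => exact key b hb c

/-- Each line of `K'` can be displaced to the line along `0`, which is trivial. -/
theorem line_sum_absorb {n : ℕ} {K K' : Multiset (Fin n → ℝ)}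
    (h : ∀ v ∈ K', v ∈ Submodule.span ℝ {v | v ∈ K}) :
    (K'.map A.line).sum + (K.map A.line).sum = (K.map A.line).sum := by
  induction K' using Multiset.induction with
  | empty => simp
  | cons v K' ih =>
    have hv := line_mem_absorb (A := A) (f := A.line) (fun c b w => line_add_line c b w)
      (h v (Multiset.mem_cons_self v K')) 0
    rw [_root_.zero_add, line_zero, _root_.zero_add] at hv
    rw [Multiset.map_cons, Multiset.sum_cons, _root_.add_assoc,
      ih fun u hu => h u (Multiset.mem_cons_of_mem hu), hv]

/-- Each of the two sums absorbs the other, so both equal their total. -/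
theorem line_sum_congr {n : ℕ} {K K' : Multiset (Fin n → ℝ)}
    (h : Submodule.span ℝ {v | v ∈ K} = Submodule.span ℝ {v | v ∈ K'}) :
    (K.map A.line).sum = (K'.map A.line).sum := by
  rw [← line_sum_absorb (A := A) (K := K) (K' := K') fun v hv => h ▸ Submodule.subset_span hv,
    add_comm, line_sum_absorb fun v hv => h ▸ Submodule.subset_span hv]

/-- `π` is the orthogonal projection onto the complement of `W`. Only its two defining properties
are recorded; linearity is recovered through `projection_apply`. -/
theorem exists_projection {n : ℕ} (W : Submodule ℝ (Fin n → ℝ)) :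
    ∃ π : (Fin n → ℝ) → Fin n → ℝ, ∀ v, v - π v ∈ W ∧ ∀ b ∈ W, b ⬝ᵥ π v = 0 := by
  -- Orthogonal decomposition is carried out in Euclidean space, `Fin n → ℝ` having the sup norm.
  let e := (WithLp.linearEquiv 2 ℝ (Fin n → ℝ))
  let W' : Submodule ℝ (EuclideanSpace ℝ (Fin n)) := W.comap e.toLinearMap
  have h : ∀ v : Fin n → ℝ, ∃ w, v - w ∈ W ∧ ∀ b ∈ W, b ⬝ᵥ w = 0 := fun v => by
    obtain ⟨y, hy, z, hz, hv⟩ := W'.exists_add_mem_mem_orthogonal (e.symm v)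
    have hv' : v = e y + e z := by
      rw [← map_add, ← hv, LinearEquiv.apply_symm_apply]
    refine ⟨e z, ?_, fun b hb => ?_⟩
    · rw [hv', add_sub_cancel_right]; exact hy
    · have := (Submodule.mem_orthogonal _ _).1 hz (e.symm b) (by
        change e (e.symm b) ∈ W
        rwa [LinearEquiv.apply_symm_apply])
      rw [EuclideanSpace.inner_eq_star_dotProduct] at this
      rw [dotProduct_comm]
      exact this
  choose π hπ using h
  exact ⟨π, hπ⟩

/-- Self-adjointness of an orthogonal projection, evaluated on a basis vector. -/
theorem projection_apply {n : ℕ} {W : Submodule ℝ (Fin n → ℝ)} {π : (Fin n → ℝ) → Fin n → ℝ}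
    (hπ : ∀ v, v - π v ∈ W ∧ ∀ b ∈ W, b ⬝ᵥ π v = 0) (v : Fin n → ℝ) (i : Fin n) :
    π v i = v ⬝ᵥ π (Pi.single i 1) := by
  have h1 := (hπ (Pi.single i 1)).2 _ (hπ v).1
  have h2 := (hπ v).2 _ (hπ (Pi.single i 1)).1
  rw [sub_dotProduct, sub_eq_zero] at h1 h2
  rw [h1, dotProduct_comm, ← h2, single_dotProduct, one_mul]

/-- The lines absorb the components of the vacua along `K`, so the vacua may be projected to the
orthogonal complement, where their Gram matrix decides. -/
theorem nf_congr {n : ℕ} {L K L' K' : Multiset (Fin n → ℝ)} {a a' : Fin n → ℝ}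
    (hK : Submodule.span ℝ {v | v ∈ K} = Submodule.span ℝ {v | v ∈ K'})
    (ha : a - a' ∈ Submodule.span ℝ {v | v ∈ K})
    (hL : ∀ x y : Fin n → ℝ, (∀ b ∈ K, b ⬝ᵥ x = 0) → (∀ b ∈ K, b ⬝ᵥ y = 0) →
      (L.map fun v => (v ⬝ᵥ x) * (v ⬝ᵥ y)).sum = (L'.map fun v => (v ⬝ᵥ x) * (v ⬝ᵥ y)).sum) :
    A.nf L K a = A.nf L' K' a' := by
  obtain ⟨π, hπ⟩ := exists_projection (Submodule.span ℝ {v | v ∈ K})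
  have hproj : ∀ L : Multiset (Fin n → ℝ), (L.map A.nu).sum + (K.map A.line).sum =
      ((L.map π).map A.nu).sum + (K.map A.line).sum := fun L => by
    induction L using Multiset.induction with
    | empty => rfl
    | cons v L ih =>
      have h := line_mem_absorb (A := A) (f := A.nu) (fun c b w => nu_add_line c b w) (hπ v).1 (π v)
      rw [add_sub_cancel] at h
      simp only [Multiset.map_cons, Multiset.sum_cons]
      rw [_root_.add_assoc, ih, add_left_comm, h, add_left_comm, _root_.add_assoc]
  -- The entries of the projected Gram matrix are values of the covariance form on the projected
  -- basis vectors, which are orthogonal to `K`.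
  have hg : gram (L.map π) = gram (L'.map π) := by
    ext i j
    simp only [gram, Multiset.map_map, Function.comp_def, projection_apply hπ]
    exact hL _ _ (fun b hb => (hπ _).2 b (Submodule.subset_span hb))
      (fun b hb => (hπ _).2 b (Submodule.subset_span hb))
  have hd := line_mem_absorb (A := A) (f := A.dot) (fun c b w => dot_add_line c b w) ha a'
  rw [add_sub_cancel] at hd
  unfold nf
  rw [← line_sum_congr hK, hproj L, hproj L', nu_sum_congr hg, _root_.add_assoc, add_comm _ (A.dot a),
    hd, add_comm (A.dot a'), _root_.add_assoc]

end GaussAlg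

/-! ### Evaluation of diagrams -/

/-- The value of a diagram in a compact prop. -/
def Diagram.eval {G : ℕ → ℕ → Type} (P : CompactProp) (φ : ∀ n m, G n m → P.Hom n m) :
    ∀ {n m : ℕ}, Diagram G n m → P.Hom n m
  | _, _, .gen g => φ _ _ g
  | _, _, .id n => P.id n
  | _, _, .comp f g => P.comp (f.eval P φ) (g.eval P φ)
  | _, _, .tensor f g => P.tensor (f.eval P φ) (g.eval P φ)
  | _, _, .symm n m => P.symm n m
  | _, _, .cup => P.cup
  | _, _, .cap => P.cap

namespace Diagram

variable {G : ℕ → ℕ → Type} {P : CompactProp} {φ : ∀ n m, G n m → P.Hom n m}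

theorem eval_castHom {n n' m m' : ℕ} (hn : n = n') (hm : m = m') (f : Diagram G n m) :
    (castHom (Diagram G) hn hm f).eval P φ = castHom P.Hom hn hm (f.eval P φ) := by
  subst hn hm; rfl

theorem eval_sound {E : ∀ n m, Diagram G n m → Diagram G n m → Prop}
    (hE : ∀ {n m : ℕ} {f g : Diagram G n m}, E n m f g → f.eval P φ = g.eval P φ) {n m : ℕ}
    {f g : Diagram G n m} (h : Eqv E f g) : f.eval P φ = g.eval P φ := by
  induction h with
  | ax h => exact hE h
  | refl f => rfl
  | symm _ ih => exact ih.symm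
  | trans _ _ ih ih' => exact ih.trans ih'
  | comp _ _ ih ih' => simp only [eval, ih, ih']
  | tensor _ _ ih ih' => simp only [eval, ih, ih']
  | id_comp f => exact P.id_comp _
  | comp_id f => exact P.comp_id _
  | comp_assoc f g h => exact P.comp_assoc _ _ _
  | tensor_id n m => exact P.tensor_id n m
  | tensor_comp f g f' g' => exact P.tensor_comp _ _ _ _
  | tensor_assoc f g h => rw [eval_castHom]; exact P.tensor_assoc _ _ _
  | id_tensor f => rw [eval_castHom]; exact P.id_tensor _
  | tensor_id_zero f => exact P.tensor_id_zero _
  | symm_natural f g => exact P.symm_natural _ _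
  | symm_symm n m => exact P.symm_symm n m
  | hexagon n m k =>
    simp only [eval]
    rw [eval_castHom, eval_castHom]
    exact P.hexagon n m k
  | snake_left => exact P.snake_left
  | snake_right => exact P.snake_right
  | cup_symm => exact P.cup_symm
  | symm_cap => exact P.symm_cap

end Diagram

/-! ### Relations of the generators -/

namespace GaussRel

/-- The value of a diagram as a relation. -/
def rel {n m : ℕ} (f : Diagram GGA.Gen n m) : Set (Phase ℂ n × Phase ℂ m) :=
  f.eval (PhaseRel ℂ) fun _ _ g => GGA.interp g

/-- The grey spider as a relation. -/
def grey (n m : ℕ) : Set (Phase ℂ n × Phase ℂ m) :=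
  {p | (∃ c, (∀ i, p.1.1 i = c) ∧ ∀ j, p.2.1 j = c) ∧ ∑ i, p.1.2 i = ∑ j, p.2.2 j}

/-- The white spider as a relation. -/
def white (n m : ℕ) (a : ℝ) : Set (Phase ℂ n × Phase ℂ m) :=
  {p | ∑ i, p.1.1 i + ∑ j, p.2.1 j = (a : ℂ) ∧ ∃ c, (∀ i, p.1.2 i = c) ∧ ∀ j, p.2.2 j = -c}

/-- Scalar multiplication as a relation. -/
def scalar (a : ℝ) : Set (Phase ℂ 1 × Phase ℂ 1) :=
  {p | p.2.1 0 = (a : ℂ) * p.1.1 0 ∧ p.1.2 0 = (a : ℂ) * p.2.2 0}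

/-- The vacuum as a relation. -/
def vacuum : Set (Phase ℂ 0 × Phase ℂ 1) := {p | p.2.1 0 = Complex.I * p.2.2 0}

theorem forall_add {n m : ℕ} {p : Fin (n + m) → Prop} :
    (∀ i, p i) ↔ (∀ i, p (Fin.castAdd m i)) ∧ ∀ j, p (Fin.natAdd n j) :=
  ⟨fun h => ⟨fun _ => h _, fun _ => h _⟩, fun h i => Fin.addCases h.1 h.2 i⟩

theorem mem_comp {n m k : ℕ} {R : Set (Phase ℂ n × Phase ℂ m)} {S : Set (Phase ℂ m × Phase ℂ k)}
    {u : Phase ℂ n} {v : Phase ℂ k} : (u, v) ∈ relComp R S ↔ ∃ q, (u, q) ∈ R ∧ (q, v) ∈ S := Iff.rfl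

theorem rel_ext {n m : ℕ} {R S : Set (Phase ℂ n × Phase ℂ m)}
    (h : ∀ u v, (u, v) ∈ R ↔ (u, v) ∈ S) : R = S := by
  ext ⟨u, v⟩; exact h u v

theorem comp_perm {n m : ℕ} {R : Set (Phase ℂ n × Phase ℂ m)} {T : Set (Phase ℂ m × Phase ℂ m)}
    (σ : Equiv.Perm (Fin m)) (hT : ∀ q v, (q, v) ∈ T ↔ q = (v.1 ∘ σ, v.2 ∘ σ))
    (hR : ∀ u v, (u, ((v.1 ∘ σ, v.2 ∘ σ) : Phase ℂ m)) ∈ R ↔ (u, v) ∈ R) : relComp R T = R := by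
  refine rel_ext fun u v => ?_
  simp [mem_comp, hT, hR]

theorem mem_swap (a b : ℕ) (q v : Phase ℂ (a + 2 + b)) :
    (q, v) ∈ relTensor (relTensor ((PhaseRel ℂ).id a) ((PhaseRel ℂ).symm 1 1)) ((PhaseRel ℂ).id b) ↔
      q = (v.1 ∘ Equiv.swap (Fin.castAdd b (Fin.natAdd a 0)) (Fin.castAdd b (Fin.natAdd a 1)),
        v.2 ∘ Equiv.swap (Fin.castAdd b (Fin.natAdd a 0)) (Fin.castAdd b (Fin.natAdd a 1))) := by
  have h1 : ∀ i : Fin a, Equiv.swap (Fin.castAdd b (Fin.natAdd a (0 : Fin 2)))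
      (Fin.castAdd b (Fin.natAdd a 1)) (Fin.castAdd b (Fin.castAdd 2 i)) =
        Fin.castAdd b (Fin.castAdd 2 i) := fun i =>
    Equiv.swap_apply_of_ne_of_ne (by simp [Fin.ext_iff]; omega) (by simp [Fin.ext_iff]; omega)
  have h2 : ∀ i : Fin b, Equiv.swap (Fin.castAdd b (Fin.natAdd a (0 : Fin 2)))
      (Fin.castAdd b (Fin.natAdd a 1)) (Fin.natAdd (a + 2) i) = Fin.natAdd (a + 2) i := fun i =>
    Equiv.swap_apply_of_ne_of_ne (by simp [Fin.ext_iff]; omega) (by simp [Fin.ext_iff]; omega)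
  have h3 : ∀ f : Fin (a + 2 + b) → ℂ, ∀ g : Fin (a + 2 + b) → ℂ,
      g = f ∘ Equiv.swap (Fin.castAdd b (Fin.natAdd a 0)) (Fin.castAdd b (Fin.natAdd a 1)) ↔
      ((∀ i, g (Fin.castAdd b (Fin.castAdd 2 i)) = f (Fin.castAdd b (Fin.castAdd 2 i))) ∧
        g (Fin.castAdd b (Fin.natAdd a 0)) = f (Fin.castAdd b (Fin.natAdd a 1)) ∧
        g (Fin.castAdd b (Fin.natAdd a 1)) = f (Fin.castAdd b (Fin.natAdd a 0))) ∧
        ∀ i, g (Fin.natAdd (a + 2) i) = f (Fin.natAdd (a + 2) i) := fun f g => by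
    rw [funext_iff]
    simp [forall_add, Fin.forall_fin_two, h1, h2]
  rw [Prod.ext_iff, h3, h3]
  constructor
  · rintro ⟨⟨hl, hm1, hm2⟩, hr⟩
    have hl1 := congrArg Prod.fst hl
    have hl2 := congrArg Prod.snd hl
    have hr1 := congrArg Prod.fst hr
    have hr2 := congrArg Prod.snd hr
    have e1 := congrArg (fun w => w.1 0) hm1
    have e2 := congrArg (fun w => w.2 0) hm1
    have e3 := congrArg (fun w => w.1 0) hm2
    have e4 := congrArg (fun w => w.2 0) hm2
    exact ⟨⟨⟨congrFun hl1, e3.symm, e1.symm⟩, congrFun hr1⟩,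
      ⟨⟨congrFun hl2, e4.symm, e2.symm⟩, congrFun hr2⟩⟩
  · rintro ⟨⟨⟨a1, a2, a3⟩, a4⟩, ⟨⟨b1, b2, b3⟩, b4⟩⟩
    refine ⟨⟨Prod.ext (funext a1) (funext b1), Prod.ext (funext fun i => ?_) (funext fun i => ?_),
      Prod.ext (funext fun i => ?_) (funext fun i => ?_)⟩, Prod.ext (funext a4) (funext b4)⟩ <;>
      rw [Subsingleton.elim i 0]
    exacts [a3.symm, b3.symm, a2.symm, b2.symm]

theorem grey_swap (n a b : ℕ) :
    relComp (grey n (a + 2 + b)) (relTensor (relTensor ((PhaseRel ℂ).id a) ((PhaseRel ℂ).symm 1 1))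
      ((PhaseRel ℂ).id b)) = grey n (a + 2 + b) := by
  refine comp_perm _ (mem_swap a b) fun u v => ?_
  simp only [grey, Set.mem_ofPred_eq]
  refine and_congr (exists_congr fun c => and_congr Iff.rfl ?_) ?_
  · exact Equiv.forall_congr_right (q := fun j => v.1 j = c) _
  · rw [show ∑ j, (v.2 ∘ Equiv.swap _ _) j = _ from Equiv.sum_comp _ v.2]

theorem white_swap (n a b : ℕ) (c : ℝ) :
    relComp (white n (a + 2 + b) c) (relTensor (relTensor ((PhaseRel ℂ).id a)
      ((PhaseRel ℂ).symm 1 1)) ((PhaseRel ℂ).id b)) = white n (a + 2 + b) c := by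
  refine comp_perm _ (mem_swap a b) fun u v => ?_
  simp only [white, Set.mem_ofPred_eq]
  refine and_congr ?_ (exists_congr fun c => and_congr Iff.rfl ?_)
  · rw [show ∑ j, (v.1 ∘ Equiv.swap _ _) j = _ from Equiv.sum_comp _ v.1]
  · exact Equiv.forall_congr_right (q := fun j => v.2 j = -c) _

/-- The phase space vector of one mode with given coordinates. -/
def one (z x : ℂ) : Phase ℂ 1 := (fun _ => z, fun _ => x)

/-- The identity relation. -/
def idr (n : ℕ) : Set (Phase ℂ n × Phase ℂ n) := {p | p.1 = p.2}

/-- The cup as a relation. -/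
def cup : Set (Phase ℂ 0 × Phase ℂ 2) := {p | p.2.1 0 = p.2.1 1 ∧ p.2.2 0 = -p.2.2 1}

/-- The cap as a relation. -/
def cap : Set (Phase ℂ 2 × Phase ℂ 0) := {p | p.1.1 0 = p.1.1 1 ∧ p.1.2 0 = -p.1.2 1}

/-- The interchange of two wires as a relation. -/
def swap : Set (Phase ℂ 2 × Phase ℂ 2) := {p | p.2.left (n := 1) (m := 1) = p.1.right (n := 1) (m := 1) ∧
    p.2.right (n := 1) (m := 1) = p.1.left (n := 1) (m := 1)}

/-- The cup keeps `z` and negates `x`, so a bent leg re-enters with its `x`-coordinate reversed. -/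
theorem mem_bend {n m : ℕ} (R : Set (Phase ℂ (n + 1) × Phase ℂ m)) (u : Phase ℂ n)
    (v : Phase ℂ (m + 1)) :
    (u, v) ∈ relComp (m := n + 2) (relTensor (idr n) cup) (relTensor (n := n + 1) R (idr 1)) ↔
      (Phase.append u (one (v.right.1 0) (-v.right.2 0)), v.left) ∈ R := by
  constructor
  · rintro ⟨q, ⟨h1, h2, h3⟩, h4, h5⟩
    have : q.left (n := n + 1) (m := 1) = Phase.append u (one (v.right.1 0) (-v.right.2 0)) := by
      refine Phase.ext_append (n := n) ?_ ?_
      · rw [Phase.left_append]; exact h1.symm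
      · rw [Phase.right_append]
        have e1 := congrArg (fun w => w.1 0) h5
        have e2 := congrArg (fun w => w.2 0) h5
        refine Prod.ext (funext fun i => ?_) (funext fun i => ?_) <;> rw [Subsingleton.elim i 0]
        · exact h2.trans e1
        · exact h3.trans (congrArg Neg.neg e2)
    exact this ▸ h4
  · intro h
    have e1 : ∀ (f : Fin n → ℂ) (g h : Fin 1 → ℂ) (i : Fin n),
        (Fin.append (m := n + 1) (n := 1) (Fin.append f g) h) (Fin.castAdd 2 i) = f i := fun f g h i =>
      (Fin.append_left (Fin.append f g) h (Fin.castAdd 1 i)).trans (Fin.append_left f g i)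
    have e2 : ∀ (f : Fin n → ℂ) (g h : Fin 1 → ℂ),
        (Fin.append (m := n + 1) (n := 1) (Fin.append f g) h) (Fin.natAdd n (0 : Fin 2)) = g 0 := fun f g h =>
      (Fin.append_left (Fin.append f g) h (Fin.natAdd n 0)).trans (Fin.append_right f g 0)
    have e3 : ∀ (f : Fin n → ℂ) (g h : Fin 1 → ℂ),
        (Fin.append (m := n + 1) (n := 1) (Fin.append f g) h) (Fin.natAdd n (1 : Fin 2)) = h 0 := fun f g h =>
      Fin.append_right (Fin.append f g) h 0
    refine ⟨Phase.append (n := n + 1) (m := 1)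
      (Phase.append u (one (v.right.1 0) (-v.right.2 0))) v.right, ⟨?_, ?_, ?_⟩, ?_, ?_⟩
    · exact Prod.ext (funext fun i => (e1 _ _ _ i).symm) (funext fun i => (e1 _ _ _ i).symm)
    · exact (e2 _ _ v.right.1).trans (e3 u.1 (fun _ => v.right.1 0) v.right.1).symm
    · exact (e2 _ _ v.right.2).trans
        (congrArg Neg.neg (e3 u.2 (fun _ => -v.right.2 0) v.right.2).symm)
    · simpa using h
    · simp [idr]

theorem grey_bend (n m : ℕ) :
    relComp (m := n + 2) (relTensor (idr n) cup) (relTensor (n := n + 1) (grey (n + 1) m) (idr 1)) =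
      grey n (m + 1) := by
  refine rel_ext fun u v => ?_
  rw [mem_bend]
  simp only [grey, Set.mem_ofPred_eq, forall_add, Fin.sum_univ_add, Phase.append, one,
    Fin.append_left, Fin.append_right, Phase.left, Phase.right, Fin.forall_fin_one, Fin.sum_univ_one]
  refine and_congr (exists_congr fun c => ?_) ?_
  · tauto
  · rw [← sub_eq_add_neg, sub_eq_iff_eq_add]

theorem white_bend (n m : ℕ) (a : ℝ) :
    relComp (m := n + 2) (relTensor (idr n) cup)
      (relTensor (n := n + 1) (white (n + 1) m a) (idr 1)) = white n (m + 1) a := by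
  refine rel_ext fun u v => ?_
  rw [mem_bend]
  simp only [white, Set.mem_ofPred_eq, forall_add, Fin.sum_univ_add, Phase.append, one,
    Fin.append_left, Fin.append_right, Phase.left, Phase.right, Fin.forall_fin_one, Fin.sum_univ_one]
  refine and_congr ?_ (exists_congr fun c => ?_)
  · rw [add_assoc, add_comm (v.1 _)]
  · rw [neg_eq_iff_eq_neg]; tauto

theorem mem_comp_tensor {n m k : ℕ} (R : Set (Phase ℂ n × Phase ℂ (m + 1)))
    (S : Set (Phase ℂ 1 × Phase ℂ k)) (u : Phase ℂ n) (v : Phase ℂ (m + k)) :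
    (u, v) ∈ relComp R (relTensor (idr m) S) ↔
      ∃ z x, (u, Phase.append v.left (one z x)) ∈ R ∧ (one z x, v.right) ∈ S := by
  have h1 : ∀ w : Phase ℂ 1, one (w.1 0) (w.2 0) = w := fun w =>
    Prod.ext (funext fun i => by rw [Subsingleton.elim i 0]; rfl)
      (funext fun i => by rw [Subsingleton.elim i 0]; rfl)
  constructor
  · rintro ⟨q, h, h2, h3⟩
    refine ⟨q.right.1 0, q.right.2 0, ?_, by rwa [h1]⟩
    rw [h1, ← show q.left = v.left from h2,
      show Phase.append q.left q.right = q from Phase.ext_append (by simp) (by simp)]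
    exact h
  · rintro ⟨z, x, h2, h3⟩
    exact ⟨_, h2, by simp [relTensor, idr, h3]⟩

theorem grey_fuse (n m k : ℕ) :
    relComp (grey n (m + 1)) (relTensor (idr m) (grey 1 k)) = grey n (m + k) := by
  refine rel_ext fun u v => ?_
  rw [mem_comp_tensor]
  simp only [grey, Set.mem_ofPred_eq, forall_add, Fin.sum_univ_add, Phase.append, one,
    Fin.append_left, Fin.append_right, Phase.left, Phase.right, Fin.forall_fin_one, Fin.sum_univ_one]
  constructor
  · rintro ⟨z, x, ⟨⟨c, h1, h2, rfl⟩, h3⟩, ⟨c', rfl, h4⟩, rfl⟩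
    exact ⟨⟨z, h1, h2, h4⟩, h3⟩
  · rintro ⟨⟨c, h1, h2, h3⟩, h4⟩
    exact ⟨c, _, ⟨⟨c, h1, h2, rfl⟩, h4⟩, ⟨c, rfl, h3⟩, rfl⟩

theorem white_fuse (n m k : ℕ) (a b : ℝ) :
    relComp (white n (m + 1) a) (relTensor (idr m) (relComp (scalar (-1)) (white 1 k b))) =
      white n (m + k) (a + b) := by
  have hs : relComp (scalar (-1)) (white 1 k b) = {p | (((-p.1.1, -p.1.2) : Phase ℂ 1), p.2) ∈
      white 1 k b} := by
    refine rel_ext fun u v => ?_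
    constructor
    · rintro ⟨q, ⟨h1, h2⟩, h3⟩
      have : q = (-u.1, -u.2) := by
        refine Prod.ext (funext fun i => ?_) (funext fun i => ?_) <;> rw [Subsingleton.elim i 0]
        · simpa using h1
        · simp only at h2; simp [h2]
      rw [this] at h3; exact h3
    · intro h
      exact ⟨_, ⟨by simp, by simp⟩, h⟩
  refine rel_ext fun u v => ?_
  rw [hs, mem_comp_tensor]
  simp only [white, Set.mem_ofPred_eq, forall_add, Fin.sum_univ_add, Phase.append, one,
    Fin.append_left, Fin.append_right, Phase.left, Phase.right, Fin.forall_fin_one,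
    Fin.sum_univ_one, Pi.neg_apply]
  constructor
  · rintro ⟨z, x, ⟨h1, c, h2, h3, rfl⟩, h4, c', h5, h6⟩
    refine ⟨by push_cast; linear_combination h1 + h4, c, h2, h3, ?_⟩
    rw [neg_neg] at h5
    rwa [h5]
  · rintro ⟨h1, c, h2, h3, h4⟩
    -- The joining wire must carry the `z` forced by the second spider, and the `x` that the first
    -- spider gives its outputs.
    refine ⟨∑ i, v.1 (Fin.natAdd m i) - b, -c,
      ⟨?_, c, h2, h3, rfl⟩, ?_, c, neg_neg c, h4⟩
    · push_cast at h1; linear_combination h1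
    · ring

end GaussRel

/-! ### Soundness of the equations for relations -/

namespace GaussRel

/-- Quantification over a vector on at most four wires is replaced by quantification over its
coordinates. Each axiom of fixed arity thus becomes a small system of equations in coordinates. -/
theorem exists_fin_one {p : (Fin 1 → ℂ) → Prop} : (∃ a, p a) ↔ ∃ x, p ![x] :=
  ⟨fun ⟨a, h⟩ => ⟨a 0, by rwa [show ![a 0] = a from by ext i; fin_cases i; rfl]⟩,
    fun ⟨_, h⟩ => ⟨_, h⟩⟩

theorem exists_fin_two {p : (Fin 2 → ℂ) → Prop} : (∃ a, p a) ↔ ∃ x y, p ![x, y] :=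
  ⟨fun ⟨a, h⟩ => ⟨a 0, a 1, by rwa [show ![a 0, a 1] = a from by ext i; fin_cases i <;> rfl]⟩,
    fun ⟨_, _, h⟩ => ⟨_, h⟩⟩

theorem exists_fin_three {p : (Fin 3 → ℂ) → Prop} : (∃ a, p a) ↔ ∃ x y z, p ![x, y, z] :=
  ⟨fun ⟨a, h⟩ => ⟨a 0, a 1, a 2, by
    rwa [show ![a 0, a 1, a 2] = a from by ext i; fin_cases i <;> rfl]⟩,
    fun ⟨_, _, _, h⟩ => ⟨_, h⟩⟩

theorem exists_fin_four {p : (Fin 4 → ℂ) → Prop} : (∃ a, p a) ↔ ∃ x y z w, p ![x, y, z, w] :=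
  ⟨fun ⟨a, h⟩ => ⟨a 0, a 1, a 2, a 3, by
    rwa [show ![a 0, a 1, a 2, a 3] = a from by ext i; fin_cases i <;> rfl]⟩,
    fun ⟨_, _, _, _, h⟩ => ⟨_, h⟩⟩

theorem exists_eq_neg (x : ℂ) : (∃ c, x = -c) ↔ True := iff_true_intro ⟨-x, (neg_neg x).symm⟩

attribute [local simp] relComp relTensor grey white scalar vacuum idr swap cup cap Phase.left
  Phase.right Prod.ext_iff funext_iff Fin.forall_fin_two Fin.sum_univ_two Fin.castAdd Fin.natAdd
  exists_fin_one exists_fin_two exists_fin_three exists_fin_four exists_eq_neg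

theorem bialgebra : relComp (white 2 1 0) (grey 1 2) =
    relComp (n := 2) (k := 2) (relComp (m := 4) (relTensor (grey 1 2) (grey 1 2))
      (relTensor (relTensor (idr 1) swap) (idr 1))) (relTensor (white 2 1 0) (white 2 1 0)) := by
  refine rel_ext fun u v => ?_
  simp
  constructor
  · rintro ⟨⟨h1, h2, h3⟩, h4⟩
    exact ⟨-v.2 0, -v.2 1, by grind⟩
  · rintro ⟨x, z, h⟩
    grind

theorem grey_special : relComp (grey 1 2) (grey 2 1) = idr 1 := by
  refine rel_ext fun u v => ?_
  simp
  constructor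
  · rintro ⟨x, y, h⟩; grind
  · rintro ⟨h1, h2⟩; exact ⟨u.2 0, 0, by grind⟩

theorem grey_bone : relComp (grey 0 1) (grey 1 0) = idr 0 := by
  refine rel_ext fun u v => ?_
  simp

theorem grey_id : grey 1 1 = idr 1 := by
  refine rel_ext fun u v => ?_
  simp
  grind

theorem grey_cup : grey 0 2 = cup := by
  refine rel_ext fun u v => ?_
  simp
  grind

theorem grey_cap : grey 2 0 = cap := by
  refine rel_ext fun u v => ?_
  simp
  grind

theorem white_special : relComp (white 1 2 0) (white 2 1 0) = idr 1 := by
  refine rel_ext fun u v => ?_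
  simp
  constructor
  · rintro ⟨x, y, h⟩; grind
  · rintro ⟨h1, h2⟩; exact ⟨-u.1 0, 0, by grind⟩

theorem white_bone : relComp (white 0 1 0) (white 1 0 0) = idr 0 := by
  refine rel_ext fun u v => ?_
  simp

theorem white_antipode : white 1 1 0 = scalar (-1) := by
  refine rel_ext fun u v => ?_
  simp
  grind

theorem white_discard : relComp (white 2 1 0) (grey 1 0) = relTensor (grey 1 0) (grey 1 0) := by
  refine rel_ext fun u v => ?_
  simp
  have h : ∃ x, u.1 0 + u.1 1 + x = 0 := ⟨_, add_neg_cancel _⟩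
  grind

theorem point_copy (a : ℝ) :
    relComp (white 0 1 a) (grey 1 2) = relTensor (white 0 1 a) (white 0 1 a) := by
  refine rel_ext fun u v => ?_
  simp

theorem point_discard (a : ℝ) : relComp (white 0 1 a) (grey 1 0) = idr 0 := by
  refine rel_ext fun u v => ?_
  simp

theorem scalar_one : scalar 1 = idr 1 := by
  refine rel_ext fun u v => ?_
  simp
  grind

theorem scalar_zero : scalar 0 = relComp (grey 1 0) (white 0 1 0) := by
  refine rel_ext fun u v => ?_
  simp
  grind

theorem scalar_mul (a b : ℝ) : relComp (scalar a) (scalar b) = scalar (a * b) := by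
  refine rel_ext fun u v => ?_
  simp
  grind

theorem scalar_add (a b : ℝ) : relComp (relComp (grey 1 2) (relTensor (scalar a) (scalar b)))
    (relComp (white 2 1 0) (scalar (-1))) = scalar (a + b) := by
  refine rel_ext fun u v => ?_
  simp
  constructor
  · rintro ⟨h1, x, h2⟩; grind
  · rintro ⟨h1, h2⟩; exact ⟨by grind, -v.1 0, by grind⟩

theorem scalar_copy (a : ℝ) : relComp (scalar a) (grey 1 2) =
    relComp (grey 1 2) (relTensor (scalar a) (scalar a)) := by
  refine rel_ext fun u v => ?_
  simp
  grind

theorem scalar_discard (a : ℝ) : relComp (scalar a) (grey 1 0) = grey 1 0 := by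
  refine rel_ext fun u v => ?_
  simp

theorem scalar_white (a : ℝ) : relComp (relTensor (scalar a) (scalar a)) (white 2 1 0) =
    relComp (white 2 1 0) (scalar a) := by
  refine rel_ext fun u v => ?_
  simp
  constructor
  · rintro ⟨x, h⟩; exact ⟨-(u.1 0 + u.1 1), by grind⟩
  · rintro ⟨x, h⟩; exact ⟨-v.2 0, by grind⟩

theorem scalar_point (a b : ℝ) : relComp (white 0 1 b) (scalar a) = white 0 1 (a * b) := by
  refine rel_ext fun u v => ?_
  simp

theorem scalar_inv (c : ℝ) (hc : c ≠ 0) : relComp (m := 3) (relComp (m := 3) (relTensor (idr 1) cup)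
    (relTensor (relTensor (idr 1) (scalar c)) (idr 1))) (relTensor cap (idr 1)) = scalar c⁻¹ := by
  refine rel_ext fun u v => ?_
  simp
  have hc' : (c : ℂ) ≠ 0 := Complex.ofReal_ne_zero.2 hc
  rw [eq_inv_mul_iff_mul_eq₀ hc', eq_inv_mul_iff_mul_eq₀ hc']
  constructor
  · rintro ⟨y, h⟩; grind
  · rintro ⟨h1, h2⟩; exact ⟨-u.2 0, by grind⟩

theorem empty (c : ℝ) (hc : c ≠ 0) : relTensor (white 0 0 c) (idr 1) =
    relTensor (white 0 0 c) (relComp (grey 1 0) (grey 0 1)) := by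
  refine rel_ext fun u v => ?_
  simp
  exact fun h => absurd (Complex.ofReal_eq_zero.1 h.symm) hc

theorem vacuum_point (v : ℝ) : relComp vacuum (white 1 0 v) = idr 0 := by
  refine rel_ext fun u w => ?_
  simp
  -- The solution of `v = i x`; it exists because `x` ranges over complex numbers.
  exact ⟨-(Complex.I * v), by linear_combination (v : ℂ) * Complex.I_mul_I⟩

theorem vacuum_discard : relComp vacuum (grey 1 0) = idr 0 := by
  refine rel_ext fun u v => ?_
  simp

/-- An orthogonal matrix is its own inverse transpose, so it acts alike on `z` and on `x` and
preserves `z = i x`. -/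
theorem vacuum_rotation (θ : ℝ) :
   relComp (m := 2) (relTensor vacuum vacuum) (relComp (m := 4) (relComp (m := 4) (relComp (m := 4) (relTensor (grey 1 2) (grey 1 2))
      (relTensor (relTensor (relTensor (scalar (Real.cos θ)) (scalar (Real.sin θ)))
        (scalar (-Real.sin θ))) (scalar (Real.cos θ))))
      (relTensor (relTensor (idr 1) swap) (idr 1)))
      (relTensor (n := 2) (m := 1) (n' := 2) (m' := 1) (relComp (white 2 1 0) (scalar (-1))) (relComp (white 2 1 0) (scalar (-1))))) =
    relTensor vacuum vacuum := by
  refine rel_ext fun u v => ?_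
  simp
  have h := Complex.sin_sq_add_cos_sq (θ : ℂ)
  constructor
  · rintro ⟨⟨x, h1, h2⟩, y, h3, h4⟩
    constructor
    · linear_combination h2 - h1 + Complex.I * v.2 0 * h
    · linear_combination h4 - h3 + Complex.I * v.2 1 * h
  · rintro ⟨h1, h2⟩
    exact ⟨⟨-v.1 0, by linear_combination -h1 + Complex.I * v.2 0 * h, (neg_neg _).symm⟩,
      -v.1 1, by linear_combination -h2 + Complex.I * v.2 1 * h, (neg_neg _).symm⟩

theorem rel_vacua_point : ∀ (n : ℕ) (v : Fin n → ℝ),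
    relComp (rel (GGA.vacua n)) (rel (GGA.incl (GGA.pointEffect n v))) = idr 0
  | 0, _ => (PhaseRel ℂ).id_comp _
  | n + 1, v => by
    have h := (PhaseRel ℂ).tensor_comp (rel (GGA.vacua n))
      (rel (GGA.incl (GGA.pointEffect n fun i => v i.castSucc))) vacuum
      (white 1 0 (v (Fin.last n)))
    refine h.symm.trans ?_
    change relTensor (relComp _ _) (relComp _ _) = _
    rw [rel_vacua_point n, vacuum_point]
    exact (PhaseRel ℂ).tensor_id 0 0

theorem rel_vacua_discard : ∀ n : ℕ,
    relComp (rel (GGA.vacua n)) (rel (GGA.incl (GGA.discard n))) = idr 0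
  | 0 => (PhaseRel ℂ).id_comp _
  | n + 1 => by
    have h := (PhaseRel ℂ).tensor_comp (rel (GGA.vacua n)) (rel (GGA.incl (GGA.discard n))) vacuum
      (grey 1 0)
    refine h.symm.trans ?_
    change relTensor (relComp _ _) (relComp _ _) = _
    rw [rel_vacua_discard n, vacuum_discard]
    exact (PhaseRel ℂ).tensor_id 0 0

theorem rel_sound_affine {n m : ℕ} {f g : Diagram (GAA.Gen ℝ) n m} (h : GAA.Axiom ℝ n m f g) :
    rel (GGA.incl f) = rel (GGA.incl g) := by
  cases h with
  | grey_swap n a b => exact grey_swap n a b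
  | grey_bend n m => exact grey_bend n m
  | white_swap n a b c => exact white_swap n a b c
  | white_bend n m a => exact white_bend n m a
  | grey_fuse n m k => exact grey_fuse n m k
  | grey_special => exact grey_special
  | grey_bone => exact grey_bone
  | grey_id => exact grey_id
  | grey_cup => exact grey_cup
  | grey_cap => exact grey_cap
  | white_fuse n m k a b => exact white_fuse n m k a b
  | white_special => exact white_special
  | white_bone => exact white_bone
  | white_antipode => exact white_antipode
  | bialgebra => exact bialgebra
  | white_discard => exact white_discard
  | point_copy a => exact point_copy a
  | point_discard a => exact point_discard a
  | scalar_one => exact scalar_one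
  | scalar_zero => exact scalar_zero
  | scalar_mul a b => exact scalar_mul a b
  | scalar_add a b => exact scalar_add a b
  | scalar_copy a => exact scalar_copy a
  | scalar_discard a => exact scalar_discard a
  | scalar_white a => exact scalar_white a
  | scalar_point a b => exact scalar_point a b
  | scalar_inv c hc => exact scalar_inv c hc
  | empty c hc => exact empty c hc

theorem rel_sound {n m : ℕ} {f g : Diagram GGA.Gen n m} (h : GGA.Axiom n m f g) :
    rel f = rel g := by
  cases h with
  | affine h => exact rel_sound_affine h
  | rotation θ h₀ h₁ =>
    have e : rel (GGA.vacua 2) = relTensor vacuum vacuum := by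
      have h : relTensor (idr 0) vacuum = vacuum := (PhaseRel ℂ).id_tensor vacuum
      change relTensor (relTensor (idr 0) vacuum) vacuum = _
      rw [h]
    refine Eq.trans ?_ ((vacuum_rotation θ).trans e.symm)
    exact congrArg (fun R => relComp R (rel (GGA.incl (GGA.rotation θ)))) e
  | point n v => exact rel_vacua_point n v
  | discard n => exact rel_vacua_discard n

end GaussRel

/-! ### Gaussian states as relations -/

namespace GaussRel

/-- A real vector as a complex vector. -/
def cx {n : ℕ} (v : Fin n → ℝ) : Fin n → ℂ := fun j => (v j : ℂ)

/-- The covariance operator of a family of real vectors. -/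
def cov {n : ℕ} (L : Multiset (Fin n → ℝ)) (x : Fin n → ℂ) : Fin n → ℂ :=
  (L.map fun v => (cx v ⬝ᵥ x) • cx v).sum

theorem cov_cons {n : ℕ} (v : Fin n → ℝ) (L : Multiset (Fin n → ℝ)) (x : Fin n → ℂ) :
    cov (v ::ₘ L) x = (cx v ⬝ᵥ x) • cx v + cov L x := by
  simp [cov]

theorem cov_add {n : ℕ} (L : Multiset (Fin n → ℝ)) (x y : Fin n → ℂ) :
    cov L (x + y) = cov L x + cov L y := by
  simp only [cov, dotProduct_add, add_smul, Multiset.sum_map_add]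

theorem cov_smul {n : ℕ} (L : Multiset (Fin n → ℝ)) (c : ℂ) (x : Fin n → ℂ) :
    cov L (c • x) = c • cov L x := by
  simp only [cov, dotProduct_smul, smul_eq_mul, mul_smul, Multiset.smul_sum, Multiset.map_map,
    Function.comp_def]

theorem cov_zero {n : ℕ} (L : Multiset (Fin n → ℝ)) : cov L 0 = 0 := by
  simpa using cov_smul L 0 0

theorem cov_dotProduct {n : ℕ} (L : Multiset (Fin n → ℝ)) (x y : Fin n → ℂ) :
    cov L x ⬝ᵥ y = (L.map fun v => (cx v ⬝ᵥ x) * (cx v ⬝ᵥ y)).sum := by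
  induction L using Multiset.induction with
  | empty => simp [cov]
  | cons v L ih => rw [cov_cons, add_dotProduct, ih, smul_dotProduct]; simp

theorem cov_dotProduct_comm {n : ℕ} (L : Multiset (Fin n → ℝ)) (x y : Fin n → ℂ) :
    cov L x ⬝ᵥ y = cov L y ⬝ᵥ x := by
  simp only [cov_dotProduct, mul_comm]

theorem cov_star {n : ℕ} (L : Multiset (Fin n → ℝ)) (x : Fin n → ℂ) :
    star (cov L x) = cov L (star x) := by
  induction L using Multiset.induction with
  | empty => simp [cov]
  | cons v L ih =>
    have h : star (cx v) = cx v := by ext; simp [cx]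
    have h2 : star (cx v ⬝ᵥ x) = cx v ⬝ᵥ star x := by
      rw [← Matrix.star_dotProduct_star, h, dotProduct_comm]
    rw [cov_cons, cov_cons, star_add, ih, star_smul, h, h2]

/-- The complex span of a family of real vectors. -/
def cspan {n : ℕ} (K : Multiset (Fin n → ℝ)) : Submodule ℂ (Fin n → ℂ) :=
  Submodule.span ℂ (cx '' {v | v ∈ K})

theorem cx_mem_cspan {n : ℕ} {K : Multiset (Fin n → ℝ)} {b : Fin n → ℝ} (hb : b ∈ K) :
    cx b ∈ cspan K := Submodule.subset_span ⟨b, hb, rfl⟩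

theorem cspan_dotProduct {n : ℕ} {K : Multiset (Fin n → ℝ)} {x : Fin n → ℂ}
    (hx : ∀ b ∈ K, cx b ⬝ᵥ x = 0) {y : Fin n → ℂ} (hy : y ∈ cspan K) : y ⬝ᵥ x = 0 := by
  induction hy using Submodule.span_induction with
  | mem y hy => obtain ⟨b, hb, rfl⟩ := hy; exact hx b hb
  | zero => exact zero_dotProduct x
  | add y z _ _ hy hz => rw [add_dotProduct, hy, hz, add_zero]
  | smul c y _ hy => rw [smul_dotProduct, hy, smul_zero]

/-- Double orthogonality for the bilinear dot product. It is not Hermitian and has isotropic vectors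
over `ℂ`, but nondegeneracy is all that is needed. -/
theorem mem_span_of_dotProduct {n : ℕ} (U : Submodule ℂ (Fin n → ℂ)) (y : Fin n → ℂ)
    (h : ∀ x : Fin n → ℂ, (∀ u ∈ U, u ⬝ᵥ x = 0) → y ⬝ᵥ x = 0) : y ∈ U := by
  let B : LinearMap.BilinForm ℂ (Fin n → ℂ) := Matrix.toBilin' 1
  have hB : ∀ u v, B u v = u ⬝ᵥ v := fun u v => by
    simp [B, Matrix.toBilin'_apply', Matrix.one_mulVec]
  have hn : B.Nondegenerate :=
    LinearMap.BilinForm.nondegenerate_toBilin'_of_det_ne_zero' _ (by simp)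
  have hr : B.IsRefl := fun u v huv => by rw [hB] at *; rwa [dotProduct_comm]
  have := mem_sup_of_orthogonal hn hr U ⊥ y fun x hx _ => by
    rw [hB, dotProduct_comm]
    exact h x fun u hu => by rw [← hB]; exact hx u hu
  simpa using this

/-- The Lagrangian subspace with given vacua and free directions. -/
noncomputable def gaussSub {n : ℕ} (L K : Multiset (Fin n → ℝ)) :
    Submodule ℂ (Phase ℂ 0 × Phase ℂ n) where
  carrier := {p | (∀ b ∈ K, cx b ⬝ᵥ p.2.2 = 0) ∧ p.2.1 - Complex.I • cov L p.2.2 ∈ cspan K}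
  add_mem' := by
    rintro p q ⟨h1, h2⟩ ⟨h3, h4⟩
    refine ⟨fun b hb => ?_, ?_⟩
    · change cx b ⬝ᵥ (p.2.2 + q.2.2) = 0
      rw [dotProduct_add, h1 b hb, h3 b hb, add_zero]
    · change p.2.1 + q.2.1 - Complex.I • cov L (p.2.2 + q.2.2) ∈ _
      rw [cov_add, smul_add, add_sub_add_comm]
      exact add_mem h2 h4
  zero_mem' := by
    refine ⟨fun b _ => dotProduct_zero _, ?_⟩
    change (0 : Fin n → ℂ) - Complex.I • cov L (0 : Fin n → ℂ) ∈ _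
    rw [cov_zero, smul_zero, sub_zero]
    exact zero_mem _
  smul_mem' := by
    rintro c p ⟨h1, h2⟩
    refine ⟨fun b hb => ?_, ?_⟩
    · change cx b ⬝ᵥ (c • p.2.2) = 0
      rw [dotProduct_smul, h1 b hb, smul_zero]
    · change c • p.2.1 - Complex.I • cov L (c • p.2.2) ∈ _
      rw [cov_smul, smul_comm, ← smul_sub]
      exact Submodule.smul_mem _ c h2

theorem symp_eq {n : ℕ} (v w : Phase ℂ n) : symp v w = v.1 ⬝ᵥ w.2 - w.1 ⬝ᵥ v.2 := by
  simp only [symp, dotProduct, Finset.sum_sub_distrib]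
  exact congrArg _ (Finset.sum_congr rfl fun _ _ => mul_comm _ _)

theorem sympRel_state {n : ℕ} (v w : Phase ℂ 0 × Phase ℂ n) :
    sympRel v w = v.2.1 ⬝ᵥ w.2.2 - w.2.1 ⬝ᵥ v.2.2 := by
  rw [sympRel, symp_eq]; simp [symp]

theorem dotProduct_of_mem_gaussSub {n : ℕ} {L K : Multiset (Fin n → ℝ)}
    {p : Phase ℂ 0 × Phase ℂ n} (hp : p ∈ gaussSub L K) {x : Fin n → ℂ}
    (hx : ∀ b ∈ K, cx b ⬝ᵥ x = 0) : p.2.1 ⬝ᵥ x = Complex.I * (cov L p.2.2 ⬝ᵥ x) := by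
  have := cspan_dotProduct hx hp.2
  rwa [sub_dotProduct, smul_dotProduct, smul_eq_mul, sub_eq_zero] at this

/-- Isotropy is the symmetry of the covariance. Conversely, pairing with the vectors `(b, 0)` for `b
∈ K` forces `x ⊥ K`, and pairing with the vectors `(i Σ x, x)` forces the condition on `z`. -/
theorem isLagrangian_gaussSub {n : ℕ} (L K : Multiset (Fin n → ℝ)) :
    IsLagrangian (gaussSub L K) := by
  refine isLagrangian_iff.2 fun p => ⟨fun hp q hq => ?_, fun h => ?_⟩
  · rw [sympRel_state, dotProduct_of_mem_gaussSub hp hq.1, dotProduct_of_mem_gaussSub hq hp.1,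
      cov_dotProduct_comm, sub_self]
  · have h1 : ∀ b ∈ K, cx b ⬝ᵥ p.2.2 = 0 := fun b hb => by
      have := h (0, (cx b, 0)) ⟨fun _ _ => dotProduct_zero _, by
        change cx b - Complex.I • cov L 0 ∈ _
        rw [cov_zero, smul_zero, sub_zero]; exact cx_mem_cspan hb⟩
      rw [sympRel_state] at this
      simpa using this
    refine ⟨h1, mem_span_of_dotProduct _ _ fun x hx => ?_⟩
    have := h (0, (Complex.I • cov L x, x)) ⟨fun b hb => hx _ (cx_mem_cspan hb), by
      change Complex.I • cov L x - Complex.I • cov L x ∈ _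
      rw [sub_self]; exact zero_mem _⟩
    rw [sympRel_state] at this
    rw [sub_dotProduct, smul_dotProduct, cov_dotProduct_comm, ← smul_dotProduct]
    exact this

theorem star_orthogonal {n : ℕ} {K : Multiset (Fin n → ℝ)} {x : Fin n → ℂ}
    (hx : ∀ b ∈ K, cx b ⬝ᵥ x = 0) (b : Fin n → ℝ) (hb : b ∈ K) : cx b ⬝ᵥ star x = 0 := by
  have h : star (cx b) = cx b := by ext; simp [cx]
  rw [← h, Matrix.star_dotProduct_star, dotProduct_comm, hx b hb, star_zero]

theorem star_dotProduct_of_mem {n : ℕ} {L K : Multiset (Fin n → ℝ)}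
    {p : Phase ℂ 0 × Phase ℂ n} (hp : p ∈ gaussSub L K) {x : Fin n → ℂ}
    (hx : ∀ b ∈ K, cx b ⬝ᵥ x = 0) :
    star p.2.1 ⬝ᵥ x = -Complex.I * (cov L (star p.2.2) ⬝ᵥ x) := by
  have h := congrArg star (dotProduct_of_mem_gaussSub hp (star_orthogonal hx))
  rw [← Matrix.star_dotProduct_star, star_star, star_mul', ← Matrix.star_dotProduct_star, star_star,
    cov_star, Complex.star_def, Complex.conj_I] at h
  rwa [dotProduct_comm, dotProduct_comm (cov L _)]

/-- The positivity form comes out as `2 ∑ |v · x|²` over `v ∈ L`. In `χ` the factors `i` and `-i`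
cancel, because the covariance is real and symmetric. -/
theorem isQuasiRealLinear_gaussSub {n : ℕ} (L K : Multiset (Fin n → ℝ)) :
    IsQuasiRealLinear (gaussSub L K) := by
  refine ⟨fun p hp => ?_, fun p hp q hq => ?_⟩
  · have h1 := star_dotProduct_of_mem hp hp.1
    have h2 := dotProduct_of_mem_gaussSub hp (star_orthogonal hp.1)
    have e : sympRel (p.1.conj, p.2.conj) p = star p.2.1 ⬝ᵥ p.2.2 - p.2.1 ⬝ᵥ star p.2.2 := by
      rw [sympRel_state]; rfl
    have e2 : Complex.I * sympRel (p.1.conj, p.2.conj) p = 2 * (cov L p.2.2 ⬝ᵥ star p.2.2) := by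
      rw [e, h1, h2, cov_dotProduct_comm]
      linear_combination (-2 * (cov L p.2.2 ⬝ᵥ star p.2.2)) * Complex.I_mul_I
    rw [e2, cov_dotProduct]
    refine mul_nonneg (by norm_num) (Multiset.sum_nonneg fun c hc => ?_)
    obtain ⟨v, -, rfl⟩ := Multiset.mem_map.1 hc
    have h : star (cx v) = cx v := by ext; simp [cx]
    have : cx v ⬝ᵥ star p.2.2 = star (cx v ⬝ᵥ p.2.2) := by
      rw [← h, Matrix.star_dotProduct_star, dotProduct_comm, h]
    rw [this]
    exact mul_star_self_nonneg _
  · have h1 := star_dotProduct_of_mem hp hq.1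
    have h2 := dotProduct_of_mem_gaussSub hq (star_orthogonal hp.1)
    have e : ∀ v w : Phase ℂ n, chi v w = star v.1 ⬝ᵥ w.2 + w.1 ⬝ᵥ star v.2 := fun v w => by
      simp only [chi, dotProduct, Finset.sum_add_distrib]
      exact congrArg _ (Finset.sum_congr rfl fun _ _ => mul_comm _ _)
    have e0 : chi p.1 q.1 = 0 := by simp [chi]
    rw [e0, sub_zero, e, h1, h2, cov_dotProduct_comm]
    ring

/-- The Gaussian state with given vacua, free directions and mean. -/
def gauss {n : ℕ} (L K : Multiset (Fin n → ℝ)) (a : Fin n → ℝ) : Set (Phase ℂ 0 × Phase ℂ n) :=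
  {p | (∀ b ∈ K, cx b ⬝ᵥ p.2.2 = 0) ∧ p.2.1 - cx a - Complex.I • cov L p.2.2 ∈ cspan K}

theorem gauss_eq {n : ℕ} (L K : Multiset (Fin n → ℝ)) (a : Fin n → ℝ) :
    gauss L K a = {p | p - (0, (cx a, 0)) ∈ gaussSub L K} := by
  ext p
  change _ ↔ (∀ b ∈ K, cx b ⬝ᵥ (p.2.2 - 0) = 0) ∧
    p.2.1 - cx a - Complex.I • cov L (p.2.2 - 0) ∈ cspan K
  rw [sub_zero]; rfl

theorem isQuasiReal_gauss {n : ℕ} (L K : Multiset (Fin n → ℝ)) (a : Fin n → ℝ) :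
    IsQuasiReal (gauss L K a) :=
  Or.inr ⟨gaussSub L K, (0, (cx a, 0)), isLagrangian_gaussSub L K, isQuasiRealLinear_gaussSub L K,
    ⟨fun _ => rfl, rfl⟩, ⟨fun _ => Complex.ofReal_im _, rfl⟩, gauss_eq L K a⟩

end GaussRel

/-! ### The generators are quasi-real -/

namespace GaussRel

theorem isQuasiReal_unbend {n m : ℕ} {R : (PhaseRel ℂ).Hom n (m + 1)} (h : IsQuasiReal R) :
    IsQuasiReal (unbend R) :=
  (h.tensor ((isLagrangian_linId 1).quasiReal (isQuasiRealLinear_linId 1))).comp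
    (((isLagrangian_linId m).quasiReal (isQuasiRealLinear_linId m)).tensor
      (isLagrangian_linCap.quasiReal isQuasiRealLinear_linCap))

/-- Quasi-reality of a generator may be checked on the state obtained by bending its inputs. -/
theorem isQuasiReal_of_bend {n m : ℕ} {R : (PhaseRel ℂ).Hom (n + 1) m} (h : IsQuasiReal (bend R)) :
    IsQuasiReal R := by
  have := isQuasiReal_unbend h
  rwa [unbend_bend] at this

theorem cspan_singleton {n : ℕ} (b : Fin n → ℝ) : cspan {b} = Submodule.span ℂ {cx b} := by
  simp [cspan]

theorem cspan_zero {n : ℕ} : cspan (0 : Multiset (Fin n → ℝ)) = ⊥ := by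
  simp [cspan]

theorem cov_empty {n : ℕ} (x : Fin n → ℂ) : cov (0 : Multiset (Fin n → ℝ)) x = 0 := rfl

theorem cx_zero {n : ℕ} : cx (0 : Fin n → ℝ) = 0 := by ext; simp [cx]

/-- The values with all coordinates equal form the line along `(1, …, 1)`. -/
theorem grey_eq_gauss (m : ℕ) : grey 0 m = gauss 0 {1} 0 := by
  ext p
  have h1 : cx (1 : Fin m → ℝ) = 1 := by ext; simp [cx]
  simp only [grey, gauss, Set.mem_ofPred_eq, Multiset.mem_singleton, forall_eq, cspan_singleton,
    cov_empty, cx_zero, smul_zero, sub_zero, Submodule.mem_span_singleton, h1]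
  rw [and_comm]
  refine and_congr ?_ (exists_congr fun c => ?_)
  · simp [dotProduct, eq_comm]
  · rw [funext_iff]; simp [eq_comm]

theorem isQuasiReal_grey : ∀ n m : ℕ, IsQuasiReal (grey n m)
  | 0, m => grey_eq_gauss m ▸ isQuasiReal_gauss _ _ _
  | n + 1, m => isQuasiReal_of_bend (R := grey (n + 1) m)
      ((congrArg IsQuasiReal (grey_bend n m)).mpr (isQuasiReal_grey n (m + 1)))

/-- The hyperplane `∑ z = a` passes through `a e₀` with directions `eⱼ - e₀`. At least one wire is
needed for this, whence `m + 1`. -/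
theorem white_eq_gauss (m : ℕ) (a : ℝ) : white 0 (m + 1) a =
    gauss 0 (Finset.univ.val.map fun j : Fin m => Pi.single j.succ 1 - Pi.single 0 1)
      (Pi.single 0 a) := by
  ext p
  have hcx : ∀ (i : Fin (m + 1)) (c : ℝ), cx (Pi.single i c) = Pi.single i (c : ℂ) := fun i c => by
    ext k; by_cases h : k = i <;> simp [cx, h]
  have hb : ∀ i : Fin m, cx (Pi.single i.succ 1 - Pi.single 0 1 : Fin (m + 1) → ℝ) =
      Pi.single i.succ 1 - Pi.single 0 1 := fun i => by
    have : ∀ v w : Fin (m + 1) → ℝ, cx (v - w) = cx v - cx w := fun v w => by ext; simp [cx]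
    rw [this, hcx, hcx]; simp
  have hK : ∀ x : Fin (m + 1) → ℂ, (∀ b ∈ (Finset.univ.val.map fun j : Fin m =>
      (Pi.single j.succ 1 - Pi.single 0 1 : Fin (m + 1) → ℝ)), cx b ⬝ᵥ x = 0) ↔
      ∀ j, x j = x 0 := fun x => by
    simp only [Multiset.mem_map, Finset.mem_val, Finset.mem_univ, true_and,
      forall_exists_index, forall_apply_eq_imp_iff, hb, sub_dotProduct, single_dotProduct, one_mul,
      sub_eq_zero]
    exact ⟨fun h j => Fin.cases rfl h j, fun h j => h _⟩
  have hs : ∀ y x : Fin (m + 1) → ℂ, (∀ j, x j = x 0) → y ⬝ᵥ x = (∑ j, y j) * x 0 :=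
    fun y x h => by
      rw [dotProduct, Finset.sum_mul]; exact Finset.sum_congr rfl fun j _ => by rw [h j]
  simp only [white, gauss, Set.mem_ofPred_eq, hK, cov_empty, smul_zero, sub_zero, hcx,
    Finset.univ_eq_empty, Finset.sum_empty, zero_add, IsEmpty.forall_iff, true_and]
  rw [and_comm]
  refine and_congr ⟨fun ⟨c, h⟩ j => (h j).trans (h 0).symm, fun h => ⟨-p.2.2 0, by simpa using h⟩⟩
    ⟨fun h => mem_span_of_dotProduct _ _ fun x hx => ?_, fun h => ?_⟩
  · have hx := (hK x).1 fun b hb => hx _ (cx_mem_cspan hb)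
    rw [hs _ _ hx]
    simp [h]
  · have := cspan_dotProduct ((hK 1).2 fun _ => rfl) h
    rw [hs _ _ fun _ => rfl] at this
    simpa [sub_eq_zero] using this

theorem isQuasiReal_white (a : ℝ) : ∀ n m : ℕ, IsQuasiReal (white n m a)
  | 0, 0 => by
    by_cases ha : a = 0
    · have : white 0 0 a = gauss 0 0 0 := by
        ext p
        have : p.2.1 - cx 0 - Complex.I • cov 0 p.2.2 = 0 := Subsingleton.elim _ _
        simp only [white, gauss, Set.mem_ofPred_eq, this, zero_mem]
        simp [ha]
      exact this ▸ isQuasiReal_gauss _ _ _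
    · exact Or.inl (Set.eq_empty_of_forall_notMem fun p hp => ha (by simpa using hp.1.symm))
  | 0, m + 1 => white_eq_gauss m a ▸ isQuasiReal_gauss _ _ _
  | n + 1, m => isQuasiReal_of_bend (R := white (n + 1) m a)
      ((congrArg IsQuasiReal (white_bend n m a)).mpr (isQuasiReal_white a n (m + 1)))

theorem isQuasiReal_vacuum : IsQuasiReal vacuum := by
  have : vacuum = gauss {1} 0 0 := by
    ext p
    simp only [vacuum, gauss, Set.mem_ofPred_eq, Multiset.notMem_zero, IsEmpty.forall_iff,
      implies_true, true_and, cspan_zero, Submodule.mem_bot, cx_zero, sub_zero, sub_eq_zero]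
    rw [funext_iff, Fin.forall_fin_one]
    simp [cov, cx, dotProduct]
  exact this ▸ isQuasiReal_gauss _ _ _

theorem isQuasiReal_scalar (a : ℝ) : IsQuasiReal (scalar a) := by
  refine isQuasiReal_of_bend (n := 0) (R := scalar a) ?_
  -- Bending puts the former input last, so the graph of multiplication by `a` is the line along
  -- `(a, 1)`.
  have : relComp (m := 2) (relTensor (idr 0) cup) (relTensor (n := 1) (scalar a) (idr 1)) =
      gauss 0 {![a, 1]} 0 := by
    refine rel_ext fun u v => (mem_bend (n := 0) (scalar a) u v).trans ?_
    have e : (Phase.append u (one ((v.right (n := 1) (m := 1)).1 0)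
        (-(v.right (n := 1) (m := 1)).2 0)), v.left (n := 1) (m := 1)) ∈ scalar a ↔
        v.1 0 = a * v.1 1 ∧ -v.2 1 = a * v.2 0 := Iff.rfl
    refine e.trans ?_
    simp only [gauss, Set.mem_ofPred_eq, Multiset.mem_singleton, forall_eq, cspan_singleton,
      cov_empty, cx_zero, smul_zero, sub_zero, Submodule.mem_span_singleton]
    rw [and_comm]
    refine and_congr ?_ ?_
    · simp [dotProduct, cx, neg_eq_iff_add_eq_zero, add_comm]
    · constructor
      · intro h
        refine ⟨v.1 1, ?_⟩
        ext j; fin_cases j <;> simp [cx, h, mul_comm]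
      · rintro ⟨c, hc⟩
        have h0 := congrFun hc 0
        have h1 := congrFun hc 1
        simp [cx] at h0 h1
        rw [← h0, ← h1, mul_comm]
  exact (congrArg IsQuasiReal this).mpr (isQuasiReal_gauss _ _ _)

theorem isQuasiReal_interp : ∀ {n m : ℕ} (g : GGA.Gen n m), IsQuasiReal (GGA.interp g)
  | _, _, .affine (.grey n m) => isQuasiReal_grey n m
  | _, _, .affine (.white n m a) => isQuasiReal_white a n m
  | _, _, .affine (.scalar a) => isQuasiReal_scalar a
  | _, _, .vacuum => isQuasiReal_vacuum

theorem isAffineLagrangian_of_isQuasiReal {n m : ℕ} {R : Set (Phase ℂ n × Phase ℂ m)}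
    (h : IsQuasiReal R) : IsAffineLagrangian R :=
  h.imp id fun ⟨S, a, hS, _, _, _, hR⟩ => ⟨S, a, hS, hR⟩

/-- A quasi-real relation as an arrow. -/
def ofSet {n m : ℕ} (R : Set (Phase ℂ n × Phase ℂ m)) (h : IsQuasiReal R) : GaussRel.Hom n m :=
  ⟨⟨R, isAffineLagrangian_of_isQuasiReal h⟩, h⟩

theorem graph_injective {n m : ℕ} {R S : GaussRel.Hom n m} (h : graph R = graph S) : R = S :=
  Subtype.ext (Subtype.ext h)

/-- The value of a diagram as a Gaussian relation. -/
noncomputable def value {n m : ℕ} (f : Diagram GGA.Gen n m) : GaussRel.Hom n m :=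
  f.eval GaussRel fun _ _ g => ofSet (GGA.interp g) (isQuasiReal_interp g)

theorem graph_value {n m : ℕ} (f : Diagram GGA.Gen n m) : graph (value f) = rel f := by
  induction f with
  | gen g => rfl
  | id n => rfl
  | comp f g ihf ihg => exact congrArg₂ relComp ihf ihg
  | tensor f g ihf ihg => exact congrArg₂ relTensor ihf ihg
  | symm n m => rfl
  | cup => rfl
  | cap => rfl

/-! ### Descent to the quotient, and reduction to states -/

theorem value_sound {n m : ℕ} {f g : Diagram GGA.Gen n m} (h : Diagram.Eqv GGA.Axiom f g) :
    value f = value g :=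
  graph_injective <| by
    rw [graph_value, graph_value]
    exact Diagram.eval_sound (fun h => rel_sound h) h

/-- The interpretation of graphical Gaussian algebra. -/
noncomputable def sem {n m : ℕ} : GGA.Hom n m → GaussRel.Hom n m :=
  Quotient.lift value fun _ _ h => value_sound h

theorem sem_comp {n m k : ℕ} (f : GGA.Hom n m) (g : GGA.Hom m k) :
    sem (GGA.comp f g) = GaussRel.comp (sem f) (sem g) := by
  induction f using Quotient.inductionOn; induction g using Quotient.inductionOn; rfl

theorem sem_tensor {n m n' m' : ℕ} (f : GGA.Hom n m) (g : GGA.Hom n' m') :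
    sem (GGA.tensor f g) = GaussRel.tensor (sem f) (sem g) := by
  induction f using Quotient.inductionOn; induction g using Quotient.inductionOn; rfl

theorem sem_id (n : ℕ) : sem (GGA.id n) = GaussRel.id n := rfl

theorem sem_symm (n m : ℕ) : sem (GGA.symm n m) = GaussRel.symm n m := rfl

theorem sem_cup : sem GGA.cup = CompactProp.cup GaussRel := rfl

theorem sem_cap : sem GGA.cap = CompactProp.cap GaussRel := rfl

theorem sem_bend {n m : ℕ} (f : GGA.Hom (n + 1) m) : sem (bend f) = bend (sem f) := by
  unfold bend; rw [sem_comp, sem_tensor, sem_tensor]; rfl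

theorem sem_unbend {n m : ℕ} (f : GGA.Hom n (m + 1)) : sem (unbend f) = unbend (sem f) := by
  unfold unbend; rw [sem_comp, sem_tensor, sem_tensor]; rfl

/-- Bending turns each input into an output and commutes with `sem`. Only `unbend_bend` is needed:
in the source for injectivity, in the target for surjectivity. -/
theorem bijective_sem (h : ∀ n, Function.Bijective (sem (n := 0) (m := n))) :
    ∀ n m : ℕ, Function.Bijective (sem (n := n) (m := m))
  | 0, m => h m
  | n + 1, m => by
    have ih := bijective_sem h n (m + 1)
    refine ⟨fun f g hfg => ?_, fun R => ?_⟩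
    · rw [← unbend_bend f, ← unbend_bend g, ih.1 (a₁ := bend f) (a₂ := bend g)]
      rw [sem_bend, sem_bend, hfg]
    · obtain ⟨f, hf⟩ := ih.2 (bend R)
      exact ⟨unbend f, by rw [sem_unbend, hf, unbend_bend]⟩

end GaussRel

/-! ### Normal forms in graphical Gaussian algebra -/

namespace GGA

theorem sound {n m : ℕ} {f g : Diagram Gen n m} (h : Axiom n m f g) :
    (Quotient.mk (Diagram.setoid Axiom n m) f : GGA.Hom n m) = Quotient.mk _ g :=
  Quotient.sound (.ax h)

theorem affine_sound {n m : ℕ} {f g : Diagram (GAA.Gen ℝ) n m} (h : GAA.Axiom ℝ n m f g) :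
    (Quotient.mk (Diagram.setoid Axiom n m) (incl f) : GGA.Hom n m) = Quotient.mk _ (incl g) :=
  sound (.affine h)

/-- The tautological Gaussian algebra. -/
def alg : GaussAlg GGA where
  grey n m := arrow (.affine (.grey n m))
  white n m a := arrow (.affine (.white n m a))
  scal a := arrow (.affine (.scalar a))
  vacuum := arrow .vacuum
  grey_swap n a b := affine_sound (.grey_swap n a b)
  grey_bend n m := affine_sound (.grey_bend n m)
  white_swap n a b c := affine_sound (.white_swap n a b c)
  white_bend n m a := affine_sound (.white_bend n m a)
  grey_fuse n m k := affine_sound (.grey_fuse n m k)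
  grey_bone := affine_sound .grey_bone
  grey_id := affine_sound .grey_id
  grey_cup := affine_sound .grey_cup
  grey_cap := affine_sound .grey_cap
  white_fuse n m k a b := affine_sound (.white_fuse n m k a b)
  white_bone := affine_sound .white_bone
  white_antipode := affine_sound .white_antipode
  bialgebra := affine_sound .bialgebra
  white_discard := affine_sound .white_discard
  point_copy a := affine_sound (.point_copy a)
  point_discard a := affine_sound (.point_discard a)
  scal_one := affine_sound .scalar_one
  scal_zero := affine_sound .scalar_zero
  scal_mul a b := affine_sound (.scalar_mul a b)
  scal_add a b := affine_sound (.scalar_add a b)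
  scal_copy a := affine_sound (.scalar_copy a)
  scal_discard a := affine_sound (.scalar_discard a)
  scal_white a := affine_sound (.scalar_white a)
  scal_point a b := affine_sound (.scalar_point a b)
  scal_inv c hc := affine_sound (.scalar_inv c hc)
  empty c hc := affine_sound (.empty c hc)
  vacuum_rotation θ h₀ h₁ := by
    have h := sound (.rotation θ h₀ h₁)
    have e : (Quotient.mk (Diagram.setoid Axiom 0 2) (vacua 2) : GGA.Hom 0 2) =
        (arrow .vacuum ⊠ arrow .vacuum) :=
      congrArg (fun x : GGA.Hom 0 1 => (x ⊠ arrow .vacuum : GGA.Hom 0 2))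
        (GGA.id_tensor (arrow .vacuum))
    rw [← e]
    exact h
  vacuum_point v := by
    -- Only the one-wire case of the axiom is used; the recursion starts from `id 0`, which is
    -- removed on both factors.
    have h := sound (.point 1 fun _ => v)
    have e1 : GGA.id 0 ⊠ arrow .vacuum = arrow .vacuum := GGA.id_tensor (arrow .vacuum)
    have e2 : GGA.id 0 ⊠ arrow (.affine (.white 1 0 v)) = arrow (.affine (.white 1 0 v)) :=
      GGA.id_tensor (arrow (.affine (.white 1 0 v)))
    exact (congrArg₂ (fun (x : GGA.Hom 0 1) (y : GGA.Hom 1 0) => x ⟫ y) e1 e2).symm.trans h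
  vacuum_discard := by
    have h := sound (.discard 1)
    have e1 : GGA.id 0 ⊠ arrow .vacuum = arrow .vacuum := GGA.id_tensor (arrow .vacuum)
    have e2 : GGA.id 0 ⊠ arrow (.affine (.grey 1 0)) = arrow (.affine (.grey 1 0)) :=
      GGA.id_tensor (arrow (.affine (.grey 1 0)))
    exact (congrArg₂ (fun (x : GGA.Hom 0 1) (y : GGA.Hom 1 0) => x ⟫ y) e1 e2).symm.trans h

theorem good {n m : ℕ} (f : GGA.Hom n m) : alg.Good f := by
  induction f using Quotient.inductionOn with | h f => ?_
  induction f with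
  | gen g =>
    cases g with
    | affine g =>
      cases g with
      | grey => exact GaussAlg.good_grey _ _
      | white _ _ a => exact GaussAlg.good_white a _ _
      | scalar a => exact (GaussAlg.isMat_scal a).good
    | vacuum => exact GaussAlg.good_vacuum
  | id n => exact (GaussAlg.isMat_id n).good
  | comp f g ihf ihg => exact ihf.comp ihg
  | tensor f g ihf ihg => exact ihf.tensor ihg
  | symm n m => exact (GaussAlg.isMat_symm n m).good
  | cup => exact GaussAlg.good_cup
  | cap => exact GaussAlg.good_cap

/-- A state is the result of applying itself to the empty state, which is in normal form. -/
theorem nf_state {n : ℕ} (s : GGA.Hom 0 n) : alg.NF s := by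
  have h0 : alg.NF (GGA.id 0) :=
    Or.inl ⟨0, 0, 0, by rw [GaussAlg.nf_zero]; exact (alg.zeron_zero).symm⟩
  have h := (good s 0 (GGA.id 0) h0).comp_isMat (GaussAlg.isMat_idCast (Nat.zero_add n))
  have e := (castHom_eq (Nat.zero_add 0) (Nat.zero_add n) (GGA.id 0 ⊠ s)).symm.trans (GGA.id_tensor s)
  rw [idCast_rfl] at e
  exact e ▸ h

end GGA

/-! ### The relations of normal forms -/

namespace GaussRel

/-- The set of pairs in the relation of an arrow of graphical Gaussian algebra. -/
def den {n m : ℕ} (f : GGA.Hom n m) : Set (Phase ℂ n × Phase ℂ m) := graph (sem f)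

theorem den_comp {n m k : ℕ} (f : GGA.Hom n m) (g : GGA.Hom m k) :
    den (f ⟫ g) = relComp (den f) (den g) := by
  unfold den; rw [sem_comp]; rfl

theorem den_tensor {n m n' m' : ℕ} (f : GGA.Hom n m) (g : GGA.Hom n' m') :
    den (f ⊠ g) = relTensor (den f) (den g) := by
  unfold den; rw [sem_tensor]; rfl

theorem den_castHom {n n' m m' : ℕ} (hn : n = n') (hm : m = m') (f : GGA.Hom n m) :
    den (castHom GGA.Hom hn hm f) = {p | (p.1.cast hn.symm, p.2.cast hm.symm) ∈ den f} := by
  subst hn hm; rfl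

/-- The relation of a matrix acts on `x` by the transpose: where `z` is added, `x` is copied. -/
theorem mem_den_add (u : Phase ℂ 2) (v : Phase ℂ 1) : (u, v) ∈ den GGA.alg.add ↔
    v.1 0 = u.1 0 + u.1 1 ∧ v.2 0 = u.2 0 ∧ v.2 0 = u.2 1 := by
  have e : den GGA.alg.add = relComp (white 2 1 0) (scalar (-1)) := rfl
  rw [e]
  constructor
  · rintro ⟨q, ⟨h1, c, h2, h3⟩, h4, h5⟩
    simp only [Fin.sum_univ_two, Fin.sum_univ_one, Complex.ofReal_zero, Complex.ofReal_neg,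
      Complex.ofReal_one] at *
    have := h2 0; have := h2 1; have := h3 0
    grind
  · rintro ⟨h1, h2, h3⟩
    refine ⟨one (-v.1 0) (-v.2 0), ⟨?_, v.2 0, ?_, ?_⟩, ?_, ?_⟩
    · simp [one, h1]
    · exact Fin.forall_fin_two.2 ⟨h2.symm, h3.symm⟩
    · simp [one]
    · simp [one]
    · simp [one]

theorem mem_den_middle (n : ℕ) (u : Phase ℂ (n + 1 + (n + 1))) (v : Phase ℂ (n + n + (1 + 1))) :
    (u, v) ∈ den (GGA.middle n 1 n 1) ↔ (v.left.left = u.left.left ∧ v.left.right = u.right.left) ∧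
      v.right.left = u.left.right ∧ v.right.right = u.right.right := by
  rw [middle_eq, den_castHom]
  let w : Phase ℂ (n + (1 + n) + 1) := u.cast (congrArg (· + 1) (Nat.add_assoc n 1 n))
  let v' : Phase ℂ (n + (n + 1) + 1) := v
  have e : (w, v') ∈ den (GGA.id n ⊠ GGA.symm 1 n ⊠ GGA.id 1) ↔
      (w.left.left = v'.left.left ∧ (v'.left.right.left = w.left.right.right ∧
        v'.left.right.right = w.left.right.left)) ∧ w.right = v'.right := by
    rw [den_tensor, den_tensor]; rfl
  refine e.trans ?_
  have h1 : w.left.right.right = u.right.left := by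
    ext i <;> simp only [w, Phase.left, Phase.right, Phase.cast] <;>
      exact congrArg _ (Fin.ext (by simp; omega))
  have h2 : w.right = u.right.right := by
    ext i <;> simp only [w, Phase.right, Phase.cast] <;>
      exact congrArg _ (Fin.ext (by simp; omega))
  have h3 : w.left.left = u.left.left := rfl
  have h4 : w.left.right.left = u.left.right := rfl
  have h5 : v'.left.left = v.left.left := rfl
  have h6 : v'.left.right.left = v.left.right := rfl
  have h7 : v'.left.right.right = v.right.left := by
    ext i <;> simp only [v', Phase.left, Phase.right] <;>
      exact congrArg _ (Fin.ext (by simp))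
  have h8 : v'.right = v.right.right := by
    ext i <;> simp only [v', Phase.right] <;>
      exact congrArg _ (Fin.ext (by simp; omega))
  rw [h1, h2, h3, h4, h5, h6, h7, h8]
  constructor
  · rintro ⟨⟨a, b, c⟩, d⟩; exact ⟨⟨a.symm, b⟩, c, d.symm⟩
  · rintro ⟨⟨a, b⟩, c, d⟩; exact ⟨⟨a.symm, b, c⟩, d.symm⟩

theorem mem_den_addn : ∀ (n : ℕ) (u : Phase ℂ (n + n)) (v : Phase ℂ n),
    (u, v) ∈ den (GGA.alg.addn n) ↔
      v.1 = u.left.1 + u.right.1 ∧ v.2 = u.left.2 ∧ v.2 = u.right.2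
  | 0, u, v => by
    refine iff_of_true ?_ ⟨Subsingleton.elim _ _, Subsingleton.elim _ _, Subsingleton.elim _ _⟩
    have : u = v := Subsingleton.elim (α := Phase ℂ 0) u v
    exact this
  | n + 1, u, v => by
    have ih := mem_den_addn n
    have hs : ∀ f g : Fin (n + 1) → ℂ, f = g ↔
        (fun i => f (Fin.castAdd 1 i)) = (fun i => g (Fin.castAdd 1 i)) ∧
          f (Fin.natAdd n 0) = g (Fin.natAdd n 0) := fun f g => by
      simp only [funext_iff]
      rw [forall_add (n := n) (m := 1), Fin.forall_fin_one]
    rw [GaussAlg.addn_succ, den_comp, den_tensor, hs v.1, hs v.2, hs v.2]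
    constructor
    · rintro ⟨q, h1, h2, h3⟩
      obtain ⟨⟨a1, a2⟩, a3, a4⟩ := (mem_den_middle n u q).1 h1
      obtain ⟨b1, b2, b3⟩ := (ih _ _).1 h2
      obtain ⟨c1, c2, c3⟩ := (mem_den_add _ _).1 h3
      have d1 := congrArg (fun w => w.1 0) a3
      have d2 := congrArg (fun w => w.2 0) a3
      have d3 := congrArg (fun w => w.1 0) a4
      have d4 := congrArg (fun w => w.2 0) a4
      rw [a1] at b1 b2
      rw [a2] at b1 b3
      exact ⟨⟨b1, c1.trans (congrArg₂ (· + ·) d1 d3)⟩, ⟨b2, c2.trans d2⟩, b3, c3.trans d4⟩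
    · rintro ⟨⟨b1, c1⟩, ⟨b2, c2⟩, b3, c3⟩
      refine ⟨Phase.append (n := n + n) (m := 1 + 1) (Phase.append u.left.left u.right.left)
        (Phase.append u.left.right u.right.right), (mem_den_middle n u _).2 ?_, ?_, ?_⟩
      · simp only [Phase.left_append, Phase.right_append, and_self]
      · rw [Phase.left_append]
        refine (ih _ _).2 ?_
        simp only [Phase.left_append, Phase.right_append]
        exact ⟨b1, b2, b3⟩
      · have : ∀ w w' : Phase ℂ 1, (Phase.append w w').1 1 = w'.1 0 ∧
            (Phase.append w w').2 1 = w'.2 0 := fun w w' =>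
          ⟨Fin.append_right w.1 w'.1 0, Fin.append_right w.2 w'.2 0⟩
        have h' : ∀ w w' : Phase ℂ 1, (Phase.append w w').1 0 = w.1 0 ∧
            (Phase.append w w').2 0 = w.2 0 := fun w w' =>
          ⟨Fin.append_left w.1 w'.1 0, Fin.append_left w.2 w'.2 0⟩
        refine (mem_den_add _ _).2 ?_
        erw [Phase.right_append]
        rw [(this _ _).1, (this _ _).2, (h' _ _).1, (h' _ _).2]
        exact ⟨c1, c2, c3⟩

theorem mem_den_zeron : ∀ (n : ℕ) (u : Phase ℂ 0) (v : Phase ℂ n),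
    (u, v) ∈ den (GGA.alg.zeron n) ↔ v.1 = 0
  | 0, u, v => iff_of_true (Subsingleton.elim u v) (Subsingleton.elim _ _)
  | n + 1, u, v => by
    have hp : ∀ w : Phase ℂ 1, (u, w) ∈ den (GGA.alg.point 0) ↔ w.1 0 = 0 := fun w => by
      have e : den (GGA.alg.point 0) = white 0 1 0 := rfl
      rw [e]
      simp [white, exists_eq_neg]
    have hs : v.1 = 0 ↔ v.left.1 = 0 ∧ v.right.1 0 = 0 := by
      simp only [funext_iff]
      rw [forall_add (n := n) (m := 1), Fin.forall_fin_one]; rfl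
    have hu : u.right (n := 0) (m := 0) = u := Subsingleton.elim _ _
    rw [GaussAlg.zeron_succ, den_tensor, hs, ← hp, ← mem_den_zeron n u]
    change _ ∧ (u.right (n := 0) (m := 0), v.right) ∈ _ ↔ _
    rw [hu]; rfl

theorem mem_den_vec : ∀ {m : ℕ} (c : Fin m → ℝ) (u : Phase ℂ 1) (v : Phase ℂ m),
    (u, v) ∈ den (GGA.alg.vec m c) ↔ v.1 = u.1 0 • cx c ∧ u.2 0 = cx c ⬝ᵥ v.2
  | 0, c, u, v => by
    have e : den (GGA.alg.vec 0 c) = grey 1 0 := rfl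
    rw [e]
    simp [grey, dotProduct, Subsingleton.elim v.1 (u.1 0 • cx c)]
  | m + 1, c, u, v => by
    have ih := mem_den_vec (fun j => c j.castSucc)
    have hv : (v.1 = u.1 0 • cx c ∧ u.2 0 = cx c ⬝ᵥ v.2) ↔
        (v.left.1 = u.1 0 • cx (fun j : Fin m => c j.castSucc) ∧
          v.right.1 0 = u.1 0 * c (Fin.last m)) ∧
          u.2 0 = cx (fun j : Fin m => c j.castSucc) ⬝ᵥ v.left.2 + c (Fin.last m) * v.right.2 0 := by
      refine and_congr ?_ ?_
      · simp only [funext_iff]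
        rw [forall_add (n := m) (m := 1), Fin.forall_fin_one]; rfl
      · rw [dotProduct, Fin.sum_univ_castSucc]; rfl
    rw [hv, show GGA.alg.vec (m + 1) c = GGA.alg.copy ⟫
      (GGA.alg.vec m (fun j => c j.castSucc) ⊠ GGA.alg.scal (c (Fin.last m))) from rfl,
      den_comp, den_tensor]
    have e1 : den GGA.alg.copy = grey 1 2 := rfl
    have e2 : den (GGA.alg.scal (c (Fin.last m))) = scalar (c (Fin.last m)) := rfl
    rw [e1, e2]
    constructor
    · rintro ⟨q, ⟨⟨k, h1, h2⟩, h3⟩, h4, h5, h6⟩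
      obtain ⟨h7, h8⟩ := (ih _ _).1 h4
      have h3 : u.2 0 = q.2 0 + q.2 1 := by simpa using h3
      have a0 : q.1 0 = u.1 0 := (h2 0).trans (h1 0).symm
      have a1 : q.1 1 = u.1 0 := (h2 1).trans (h1 0).symm
      change v.right.1 0 = (c (Fin.last m) : ℂ) * q.1 1 at h5
      change q.2 1 = (c (Fin.last m) : ℂ) * v.right.2 0 at h6
      change v.left.1 = q.1 0 • _ at h7
      change q.2 0 = _ at h8
      rw [a0] at h7
      rw [a1] at h5
      exact ⟨⟨h7, h5.trans (mul_comm _ _)⟩, by rw [h3, h8, h6]⟩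
    · rintro ⟨⟨h1, h2⟩, h3⟩
      refine ⟨(fun _ => u.1 0, ![cx (fun j : Fin m => c j.castSucc) ⬝ᵥ v.left.2,
        c (Fin.last m) * v.right.2 0]), ⟨⟨u.1 0, fun i => ?_, fun _ => rfl⟩, ?_⟩, ?_, ?_, ?_⟩
      · rw [Subsingleton.elim i 0]
      · simpa using h3
      · exact (ih _ _).2 ⟨h1, rfl⟩
      · exact h2.trans (mul_comm _ _)
      · rfl

theorem mem_den_along {m : ℕ} (s : GGA.Hom 0 1) (c : Fin m → ℝ) (u : Phase ℂ 0) (v : Phase ℂ m) :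
    (u, v) ∈ den (GGA.alg.along s c) ↔
      ∃ z, (u, one z (cx c ⬝ᵥ v.2)) ∈ den s ∧ v.1 = z • cx c := by
  rw [GaussAlg.along, den_comp]
  constructor
  · rintro ⟨q, h1, h2⟩
    obtain ⟨h3, h4⟩ := (mem_den_vec _ _ _).1 h2
    refine ⟨q.1 0, ?_, h3⟩
    have : q = one (q.1 0) (cx c ⬝ᵥ v.2) := by
      refine Prod.ext (funext fun i => ?_) (funext fun i => ?_) <;> rw [Subsingleton.elim i 0]
      · rfl
      · exact h4
    exact this ▸ h1
  · rintro ⟨z, h1, h2⟩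
    exact ⟨_, h1, (mem_den_vec _ _ _).2 ⟨h2, rfl⟩⟩

/-- Summands have separate `z`-coordinates but share `x`. Covariances and free directions are
therefore additive in `gauss_add`. -/
theorem mem_den_state_add {n : ℕ} (s t : GGA.alg.St n) (u : Phase ℂ 0) (v : Phase ℂ n) :
    (u, v) ∈ den (s + t).arr ↔
      ∃ z z', v.1 = z + z' ∧ (u, (z, v.2)) ∈ den s.arr ∧ (u, (z', v.2)) ∈ den t.arr := by
  have e : den (s + t).arr = relComp (relTensor (den s.arr) (den t.arr)) (den (GGA.alg.addn n)) := by
    rw [← den_tensor]; exact den_comp _ _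
  have hu : u.right (n := 0) (m := 0) = u := Subsingleton.elim _ _
  rw [e]
  constructor
  · rintro ⟨q, ⟨h1, h2⟩, h3⟩
    change (u.right (n := 0) (m := 0), q.right) ∈ _ at h2
    rw [hu] at h2
    obtain ⟨a1, a2, a3⟩ := (mem_den_addn n q v).1 h3
    exact ⟨_, _, a1, a2 ▸ h1, a3 ▸ h2⟩
  · rintro ⟨z, z', h1, h2, h3⟩
    refine ⟨Phase.append (z, v.2) (z', v.2), ⟨?_, ?_⟩, (mem_den_addn n _ v).2 ?_⟩
    · rw [Phase.left_append]; exact h2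
    · rw [Phase.right_append]; exact hu.symm ▸ h3
    · rw [Phase.left_append, Phase.right_append]; exact ⟨h1, rfl, rfl⟩

theorem cov_append {n : ℕ} (L L' : Multiset (Fin n → ℝ)) (x : Fin n → ℂ) :
    cov (L + L') x = cov L x + cov L' x := by
  simp [cov]

theorem cx_add {n : ℕ} (v w : Fin n → ℝ) : cx (v + w) = cx v + cx w := by ext; simp [cx]

theorem cspan_append {n : ℕ} (K K' : Multiset (Fin n → ℝ)) :
    cspan (K + K') = cspan K ⊔ cspan K' := by
  rw [cspan, cspan, cspan, ← Submodule.span_union, ← Set.image_union]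
  congr 2; ext; simp

theorem gauss_add {n : ℕ} (L K L' K' : Multiset (Fin n → ℝ)) (a a' : Fin n → ℝ) (u : Phase ℂ 0)
    (v : Phase ℂ n) : (u, v) ∈ gauss (L + L') (K + K') (a + a') ↔
      ∃ z z', v.1 = z + z' ∧ (u, (z, v.2)) ∈ gauss L K a ∧ (u, (z', v.2)) ∈ gauss L' K' a' := by
  simp only [gauss, Set.mem_ofPred_eq, Multiset.mem_add, cov_append, cx_add, cspan_append,
    Submodule.mem_sup]
  constructor
  · rintro ⟨h1, y, hy, y', hy', h⟩
    refine ⟨y + cx a + Complex.I • cov L v.2, y' + cx a' + Complex.I • cov L' v.2, ?_,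
      ⟨fun b hb => h1 b (.inl hb), ?_⟩, fun b hb => h1 b (.inr hb), ?_⟩
    · rw [smul_add] at h
      linear_combination (exp := 1) -h
    · convert hy using 1; abel
    · convert hy' using 1; abel
  · rintro ⟨z, z', h, ⟨h1, h2⟩, h3, h4⟩
    refine ⟨fun b hb => hb.elim (h1 b) (h3 b), _, h2, _, h4, ?_⟩
    rw [h, smul_add]; abel

theorem den_state_add {n : ℕ} {s t : GGA.alg.St n} {L K L' K' : Multiset (Fin n → ℝ)}
    {a a' : Fin n → ℝ} (hs : den s.arr = gauss L K a) (ht : den t.arr = gauss L' K' a') :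
    den (s + t).arr = gauss (L + L') (K + K') (a + a') :=
  rel_ext fun u v => by rw [mem_den_state_add, hs, ht, gauss_add]

theorem den_zero (n : ℕ) : den (0 : GGA.alg.St n).arr = gauss 0 0 0 :=
  rel_ext fun u v => by
    refine (mem_den_zeron n u v).trans ?_
    simp [gauss, cov_empty, cx_zero, cspan_zero]

theorem den_nu {n : ℕ} (v : Fin n → ℝ) : den (GGA.alg.nu v).arr = gauss {v} 0 0 :=
  rel_ext fun u w => by
    refine (mem_den_along GGA.alg.vacuum v u w).trans ?_
    have e : den GGA.alg.vacuum = vacuum := rfl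
    simp [e, vacuum, one, gauss, cov, cx_zero, cspan_zero, smul_smul, sub_eq_zero]

theorem den_line {n : ℕ} (v : Fin n → ℝ) : den (GGA.alg.line v).arr = gauss 0 {v} 0 :=
  rel_ext fun u w => by
    refine (mem_den_along GGA.alg.free v u w).trans ?_
    have e : den GGA.alg.free = grey 0 1 := rfl
    simp [e, grey, one, gauss, cov_empty, cx_zero, cspan_singleton, Submodule.mem_span_singleton,
      eq_comm]

theorem den_dot {n : ℕ} (v : Fin n → ℝ) : den (GGA.alg.dot v).arr = gauss 0 0 v :=
  rel_ext fun u w => by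
    refine (mem_den_along (GGA.alg.point 1) v u w).trans ?_
    have e : den (GGA.alg.point 1) = white 0 1 1 := rfl
    simp [e, white, one, gauss, cov_empty, cspan_zero, exists_eq_neg, sub_eq_zero]

theorem den_nf {n : ℕ} (L K : Multiset (Fin n → ℝ)) (a : Fin n → ℝ) :
    den (GGA.alg.nf L K a).arr = gauss L K a := by
  have hL : den (L.map GGA.alg.nu).sum.arr = gauss L 0 0 := by
    induction L using Multiset.induction with
    | empty => exact den_zero n
    | cons v L ih =>
      rw [Multiset.map_cons, Multiset.sum_cons, den_state_add (den_nu v) ih]; simp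
  have hK : den (K.map GGA.alg.line).sum.arr = gauss 0 K 0 := by
    induction K using Multiset.induction with
    | empty => exact den_zero n
    | cons v K ih =>
      rw [Multiset.map_cons, Multiset.sum_cons, den_state_add (den_line v) ih]; simp
  rw [GaussAlg.nf, den_state_add (den_state_add hL hK) (den_dot a)]
  simp

theorem den_bot (n : ℕ) : den (GGA.alg.zeron n ⊠ GGA.alg.bot) = ∅ := by
  have e : den GGA.alg.bot = white 0 0 1 := rfl
  have h : relTensor (den (GGA.alg.zeron n)) (den GGA.alg.bot) = ∅ := by
    rw [e]
    refine Set.eq_empty_of_forall_notMem fun p hp => ?_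
    simpa using hp.2.1
  exact (den_tensor _ _).trans h

theorem gauss_nonempty {n : ℕ} (L K : Multiset (Fin n → ℝ)) (a : Fin n → ℝ) :
    (0, (cx a, 0)) ∈ gauss L K a := by
  simp [gauss, cov_zero]

end GaussRel

/-! ### Normal forms are determined by their relations -/

namespace GaussRel

/-- The real parts of the coordinates. -/
def reals {n : ℕ} (x : Fin n → ℂ) : Fin n → ℝ := fun j => (x j).re

/-- The imaginary parts of the coordinates. -/
def imags {n : ℕ} (x : Fin n → ℂ) : Fin n → ℝ := fun j => (x j).im

theorem cx_reals_add_imags {n : ℕ} (x : Fin n → ℂ) : cx (reals x) + Complex.I • cx (imags x) = x := by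
  ext j
  simp only [cx, reals, imags, Pi.add_apply, Pi.smul_apply, smul_eq_mul, mul_comm Complex.I]
  exact Complex.re_add_im _

theorem cx_sub {n : ℕ} (v w : Fin n → ℝ) : cx (v - w) = cx v - cx w := by ext; simp [cx]

theorem cx_smul {n : ℕ} (c : ℝ) (v : Fin n → ℝ) : cx (c • v) = (c : ℂ) • cx v := by ext; simp [cx]

theorem cx_dotProduct {n : ℕ} (v w : Fin n → ℝ) : cx v ⬝ᵥ cx w = ((v ⬝ᵥ w : ℝ) : ℂ) := by
  simp [dotProduct, cx]

/-- The complex span of real vectors is the complexification of their real span. -/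
theorem reals_imags_mem {n : ℕ} {K : Multiset (Fin n → ℝ)} {y : Fin n → ℂ} (hy : y ∈ cspan K) :
    reals y ∈ Submodule.span ℝ {v | v ∈ K} ∧ imags y ∈ Submodule.span ℝ {v | v ∈ K} := by
  induction hy using Submodule.span_induction with
  | mem y hy =>
    obtain ⟨b, hb, rfl⟩ := hy
    refine ⟨Submodule.subset_span hb, ?_⟩
    rw [show imags (cx b) = 0 from rfl]
    exact zero_mem _
  | zero => exact ⟨zero_mem _, zero_mem _⟩
  | add y z _ _ hy hz => exact ⟨add_mem hy.1 hz.1, add_mem hy.2 hz.2⟩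
  | smul c y _ hy =>
    have h1 : reals (c • y) = c.re • reals y - c.im • imags y := by ext; simp [reals, imags]
    have h2 : imags (c • y) = c.re • imags y + c.im • reals y := by ext; simp [reals, imags]
    rw [h1, h2]
    exact ⟨sub_mem (Submodule.smul_mem _ _ hy.1) (Submodule.smul_mem _ _ hy.2),
      add_mem (Submodule.smul_mem _ _ hy.2) (Submodule.smul_mem _ _ hy.1)⟩

theorem cx_mem_cspan_iff {n : ℕ} {K : Multiset (Fin n → ℝ)} {c : Fin n → ℝ} :
    cx c ∈ cspan K ↔ c ∈ Submodule.span ℝ {v | v ∈ K} := by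
  refine ⟨fun h => (reals_imags_mem h).1, fun h => ?_⟩
  induction h using Submodule.span_induction with
  | mem b hb => exact cx_mem_cspan hb
  | zero => rw [cx_zero]; exact zero_mem _
  | add y z _ _ hy hz => rw [cx_add]; exact add_mem hy hz
  | smul c y _ hy => rw [cx_smul]; exact Submodule.smul_mem _ _ hy

theorem span_dotProduct {n : ℕ} {K : Multiset (Fin n → ℝ)} {x : Fin n → ℝ}
    (hx : ∀ b ∈ K, b ⬝ᵥ x = 0) {y : Fin n → ℝ} (hy : y ∈ Submodule.span ℝ {v | v ∈ K}) :
    y ⬝ᵥ x = 0 := by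
  have := cspan_dotProduct (x := cx x) (fun b hb => by rw [cx_dotProduct, hx b hb]; simp)
    (cx_mem_cspan_iff.2 hy)
  rw [cx_dotProduct] at this
  exact_mod_cast this

theorem mem_gauss_zero {n : ℕ} {L K : Multiset (Fin n → ℝ)} {a c : Fin n → ℝ} {u : Phase ℂ 0} :
    (u, (cx c, 0)) ∈ gauss L K a ↔ c - a ∈ Submodule.span ℝ {v | v ∈ K} := by
  rw [← cx_mem_cspan_iff, cx_sub]
  simp [gauss, cov_zero]

/-- The real points with `x = 0` form the coset of `a` modulo the span of `K`, which determines
both. -/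
theorem span_le_of_gauss_eq {n : ℕ} {L K L' K' : Multiset (Fin n → ℝ)} {a a' : Fin n → ℝ}
    (h : gauss L K a = gauss L' K' a') :
    a - a' ∈ Submodule.span ℝ {v | v ∈ K'} ∧
      Submodule.span ℝ {v | v ∈ K} ≤ Submodule.span ℝ {v | v ∈ K'} := by
  have key : ∀ c, c - a ∈ Submodule.span ℝ {v | v ∈ K} → c - a' ∈ Submodule.span ℝ {v | v ∈ K'} :=
    fun c hc => mem_gauss_zero.1 (h ▸ mem_gauss_zero (u := 0).2 hc)
  have ha := key a (by rw [sub_self]; exact zero_mem _)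
  refine ⟨ha, fun b hb => ?_⟩
  have := sub_mem (key (a + b) (by rwa [add_sub_cancel_left])) ha
  convert this using 1; abel

/-- Once span and mean are matched, the covariance on vectors orthogonal to `K` is read off from the
`z`-coordinates over a given `x`. -/
theorem nf_eq_of_gauss_eq {n : ℕ} {L K L' K' : Multiset (Fin n → ℝ)} {a a' : Fin n → ℝ}
    (h : gauss L K a = gauss L' K' a') : GGA.alg.nf L K a = GGA.alg.nf L' K' a' := by
  obtain ⟨ha, hK⟩ := span_le_of_gauss_eq h
  have hspan := le_antisymm hK (span_le_of_gauss_eq h.symm).2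
  rw [← hspan] at ha
  refine GaussAlg.nf_congr hspan ha fun x y hx hy => ?_
  have hc : ∀ w, (∀ b ∈ K, b ⬝ᵥ w = 0) → ∀ b ∈ K', cx b ⬝ᵥ cx w = 0 := fun w hw b hb => by
    rw [cx_dotProduct, span_dotProduct hw (hspan ▸ Submodule.subset_span hb)]; simp
  -- The point of the first relation over `x` with no component added along `K`; pairing its `z`
  -- with `y ⊥ K` in the second relation compares the covariances.
  have hm : (0, (cx a + Complex.I • cov L (cx x), cx x)) ∈ gauss L' K' a' := by
    rw [← h]
    refine ⟨fun b hb => ?_, ?_⟩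
    · change cx b ⬝ᵥ cx x = 0
      rw [cx_dotProduct, hx b hb]; simp
    · simp
  have h1 := cspan_dotProduct (hc y hy) hm.2
  have h2 : (cx a - cx a') ⬝ᵥ cx y = 0 := by
    rw [← cx_sub, cx_dotProduct, span_dotProduct hy ha]; simp
  simp only [sub_dotProduct, add_dotProduct, smul_dotProduct, smul_eq_mul] at h1 h2
  have h3 : cov L (cx x) ⬝ᵥ cx y = cov L' (cx x) ⬝ᵥ cx y :=
    mul_left_cancel₀ Complex.I_ne_zero (by linear_combination h1 - h2)
  have h4 : ∀ M : Multiset (Fin n → ℝ), cov M (cx x) ⬝ᵥ cx y =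
      (((M.map fun v => (v ⬝ᵥ x) * (v ⬝ᵥ y)).sum : ℝ) : ℂ) := fun M => by
    rw [cov_dotProduct]
    induction M using Multiset.induction with
    | empty => simp
    | cons v M ih =>
      rw [Multiset.map_cons, Multiset.sum_cons, ih, Multiset.map_cons, Multiset.sum_cons,
        cx_dotProduct, cx_dotProduct]
      push_cast; rfl
  rw [h4, h4] at h3
  exact_mod_cast h3

theorem sem_injective (n : ℕ) : Function.Injective (sem (n := 0) (m := n)) := fun s t h => by
  have h : den s = den t := congrArg graph h
  obtain ⟨L, K, a, rfl⟩ | rfl := GGA.nf_state s <;>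
    obtain ⟨L', K', a', rfl⟩ | rfl := GGA.nf_state t
  · rw [den_nf, den_nf] at h
    rw [nf_eq_of_gauss_eq h]
  · have e := (den_nf L K a).symm.trans (h.trans (den_bot n))
    exact absurd (e ▸ gauss_nonempty L K a) (Set.notMem_empty _)
  · have e := (den_nf L' K' a').symm.trans (h.symm.trans (den_bot n))
    exact absurd (e ▸ gauss_nonempty L' K' a') (Set.notMem_empty _)
  · rfl

end GaussRel

/-! ### Every quasi-real state is a normal form -/

namespace GaussRel

variable {n : ℕ} {S : Submodule ℂ (Phase ℂ 0 × Phase ℂ n)}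

theorem twist_state_mem (hS : IsLagrangian S) (hq : IsQuasiRealLinear S) {z x : Fin n → ℂ}
    (h : (0, (z, x)) ∈ S) : (0, (star z, -star x)) ∈ S := by
  have := twist_mem hS hq h
  rwa [show (((0 : Phase ℂ 0), ((z, x) : Phase ℂ n)).1.twist) = 0 from Subsingleton.elim _ _] at this

/-- The real directions of a linear state. -/
def directions (S : Submodule ℂ (Phase ℂ 0 × Phase ℂ n)) : Submodule ℝ (Fin n → ℝ) where
  carrier := {z | (0, (cx z, 0)) ∈ S}
  add_mem' := fun {z w} hz hw => by
    have := S.add_mem hz hw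
    simpa [← cx_add] using this
  zero_mem' := by
    change (0, (cx 0, 0)) ∈ S
    rw [cx_zero]; exact S.zero_mem
  smul_mem' := fun c z hz => by
    have := S.smul_mem (c : ℂ) hz
    change (0, (cx (c • z), 0)) ∈ S
    rw [cx_smul]
    convert this using 1
    exact Prod.ext (Subsingleton.elim _ _) (Prod.ext rfl (smul_zero _).symm)

/-- At `x = 0` the twist is complex conjugation, so half the sum and half the difference of a vector
with its twist remain in `S`. -/
theorem reals_imags_mem_directions (hS : IsLagrangian S) (hq : IsQuasiRealLinear S) {w : Fin n → ℂ}
    (h : (0, (w, 0)) ∈ S) : reals w ∈ directions S ∧ imags w ∈ directions S := by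
  have ht := twist_state_mem hS hq h
  constructor
  · have := S.smul_mem (1 / 2 : ℂ) (S.add_mem h ht)
    change (0, (cx (reals w), 0)) ∈ S
    convert this using 1
    refine Prod.ext (Subsingleton.elim _ _) (Prod.ext (funext fun j => ?_) (by simp))
    refine Complex.ext ?_ ?_ <;> simp [cx, reals]
    ring
  · have := S.smul_mem (-Complex.I / 2 : ℂ) (S.sub_mem h ht)
    change (0, (cx (imags w), 0)) ∈ S
    convert this using 1
    refine Prod.ext (Subsingleton.elim _ _) (Prod.ext (funext fun j => ?_) (by simp))
    refine Complex.ext ?_ ?_ <;> simp [cx, imags]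
    ring

/-- By duality, the `x`-coordinates attained in `S` are those orthogonal to the vectors of `S` with
`x = 0`. Antisymmetrising under the twist then leaves only the imaginary part of `z`. -/
theorem exists_imaginary (hS : IsLagrangian S) (hq : IsQuasiRealLinear S) {x : Fin n → ℝ}
    (hx : ∀ b ∈ directions S, b ⬝ᵥ x = 0) : ∃ y : Fin n → ℝ, (0, (Complex.I • cx y, cx x)) ∈ S := by
  let Z : Submodule ℂ (Phase ℂ 0 × Phase ℂ n) :=
    { carrier := {u | u.2.2 = 0}
      add_mem' := fun {u v} (h1 : _ = 0) (h2 : _ = 0) => show u.2.2 + v.2.2 = 0 by rw [h1, h2, add_zero]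
      zero_mem' := rfl
      smul_mem' := fun c u (h1 : _ = 0) => show c • u.2.2 = 0 by rw [h1, smul_zero] }
  have key : (0, (0, cx x)) ∈ S ⊔ Z := by
    refine mem_sup_of_orthogonal (sympForm_nondegenerate 0 n) (sympForm_isRefl 0 n) _ _ _
      fun u hu1 hu2 => ?_
    have huS : u ∈ S := (isLagrangian_iff.1 hS u).2 fun w hw => by
      rw [sympRel_swap, neg_eq_zero]; exact hu1 w hw
    have hu0 : u.2.2 = 0 := by
      funext j
      have : sympRel (0, (Pi.single j 1, 0)) u = 0 := hu2 (0, (Pi.single j 1, 0)) rfl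
      rw [sympRel_state] at this
      simpa using this
    have hu : (0, (u.2.1, 0)) ∈ S := by
      convert huS using 1
      exact Prod.ext (Subsingleton.elim _ _) (Prod.ext rfl hu0.symm)
    obtain ⟨h1, h2⟩ := reals_imags_mem_directions hS hq hu
    change sympRel u (0, (0, cx x)) = 0
    rw [sympRel_state]
    simp only [zero_dotProduct, sub_zero]
    rw [← cx_reals_add_imags u.2.1, add_dotProduct, smul_dotProduct, cx_dotProduct, cx_dotProduct,
      hx _ h1, hx _ h2]
    simp
  obtain ⟨s, hs, t, ht, hst⟩ := Submodule.mem_sup.1 key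
  have hs2 : s.2.2 = cx x := by
    have := congrArg (fun p => p.2.2) hst
    change s.2.2 + t.2.2 = cx x at this
    rwa [show t.2.2 = 0 from ht, add_zero] at this
  have hs' : (0, (s.2.1, cx x)) ∈ S := by
    convert hs using 1
    exact Prod.ext (Subsingleton.elim _ _) (Prod.ext rfl hs2.symm)
  -- As `x` is real, the twist sends `(z, x)` to `(z̄, -x)`; half the difference is `(i Im z, x)`.
  have := S.smul_mem (1 / 2 : ℂ) (S.sub_mem hs' (twist_state_mem hS hq hs'))
  refine ⟨imags s.2.1, ?_⟩
  convert this using 1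
  refine Prod.ext (Subsingleton.elim _ _) (Prod.ext (funext fun j => ?_) (funext fun j => ?_))
  · refine Complex.ext ?_ ?_ <;> simp [cx, imags]; ring
  · refine Complex.ext ?_ ?_ <;> simp [cx]; ring

theorem projection_fixed {W : Submodule ℝ (Fin n → ℝ)} {π : (Fin n → ℝ) → Fin n → ℝ}
    (hπ : ∀ v, v - π v ∈ W ∧ ∀ b ∈ W, b ⬝ᵥ π v = 0) {x : Fin n → ℝ} (hx : ∀ b ∈ W, b ⬝ᵥ x = 0) :
    π x = x := by
  have h1 := hx _ (hπ x).1
  have h2 := (hπ x).2 _ (hπ x).1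
  have : (x - π x) ⬝ᵥ (x - π x) = 0 := by rw [dotProduct_sub, h1, h2, sub_zero]
  exact (sub_eq_zero.1 (dotProduct_self_eq_zero.1 this)).symm

/-- A positive semidefinite matrix is a sum of rank-one matrices `vᵀ v`; these vectors become the
vacua. -/
theorem exists_gram {N : Fin n → Fin n → ℝ} (hs : ∀ i j, N i j = N j i)
    (hp : ∀ c : Fin n → ℝ, 0 ≤ ∑ i, ∑ j, c i * c j * N i j) :
    ∃ L : Multiset (Fin n → ℝ), ∀ x y : Fin n → ℂ,
      cov L x ⬝ᵥ y = ∑ i, ∑ j, x i * y j * (N i j : ℂ) := by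
  have hN : (Matrix.of N).PosSemidef := by
    refine Matrix.PosSemidef.of_dotProduct_mulVec_nonneg (Matrix.IsHermitian.ext fun i j => ?_)
      fun c => ?_
    · simpa using hs j i
    · refine (hp c).trans_eq ?_
      simp only [dotProduct, Matrix.mulVec, Matrix.of_apply, star_trivial, Finset.mul_sum]
      exact Finset.sum_congr rfl fun i _ => Finset.sum_congr rfl fun j _ => by ring
  obtain ⟨m, B, hB⟩ := Matrix.posSemidef_iff_eq_sum_vecMulVec.1 hN
  have hB' : ∀ i j, N i j = ∑ k, B k i * B k j := fun i j => by
    have := congrFun (congrFun hB i) j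
    simpa [Matrix.sum_apply, Matrix.vecMulVec_apply] using this
  refine ⟨Finset.univ.val.map fun k => B k, fun x y => ?_⟩
  rw [cov_dotProduct, Multiset.map_map]
  change ∑ k, (cx (B k) ⬝ᵥ x) * (cx (B k) ⬝ᵥ y) = _
  simp only [dotProduct, cx, hB', Finset.sum_mul_sum, Complex.ofReal_sum, Complex.ofReal_mul]
  simp only [Finset.mul_sum]
  rw [Finset.sum_comm]
  refine Finset.sum_congr rfl fun i _ => ?_
  rw [Finset.sum_comm]
  exact Finset.sum_congr rfl fun j _ => Finset.sum_congr rfl fun k _ => by ring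

/-- `K` spans the real directions, and the projected basis vectors `t i` span their orthogonal
complement. Over each of them `S` contains some `(i y i, t i)`. The matrix `y i ⬝ᵥ t j` is symmetric
by isotropy and positive semidefinite by positivity, and its Gram factorisation is `L`. -/
theorem exists_gaussSub (hS : IsLagrangian S) (hq : IsQuasiRealLinear S) :
    ∃ L K : Multiset (Fin n → ℝ), S = gaussSub L K := by
  obtain ⟨F, hF⟩ := IsNoetherian.noetherian (directions S)
  have hFD : ∀ b ∈ F, b ∈ directions S := fun b hb => hF ▸ Submodule.subset_span hb
  obtain ⟨π, hπ⟩ := GaussAlg.exists_projection (directions S)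
  choose y hy using fun i : Fin n => exists_imaginary hS hq (hπ (Pi.single i 1)).2
  set t : Fin n → Fin n → ℝ := fun i => π (Pi.single i 1) with ht
  -- A vector orthogonal to the directions is fixed by the projection, so it expands in the `t i`
  -- with its own coordinates as coefficients.
  have hxt : ∀ x : Fin n → ℂ, (∀ b ∈ F.val, cx b ⬝ᵥ x = 0) → x = ∑ i, x i • cx (t i) := fun x hx => by
    have hr : ∀ b ∈ directions S, b ⬝ᵥ reals x = 0 ∧ b ⬝ᵥ imags x = 0 := fun b hb => by
      have h := cspan_dotProduct hx (cx_mem_cspan_iff.2 (show b ∈ Submodule.span ℝ (F : Set _) by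
        rwa [hF]))
      rw [← cx_reals_add_imags x, dotProduct_add, dotProduct_smul, cx_dotProduct, cx_dotProduct] at h
      have h1 := congrArg Complex.re h
      have h2 := congrArg Complex.im h
      simp at h1 h2
      exact ⟨h1, h2⟩
    have hr1 := projection_fixed hπ fun b hb => (hr b hb).1
    have hr2 := projection_fixed hπ fun b hb => (hr b hb).2
    have hsym : ∀ i j, t i j = t j i := fun i j => by
      rw [ht]
      simp only
      rw [GaussAlg.projection_apply hπ, single_dotProduct, one_mul]
    ext i
    have e1 := GaussAlg.projection_apply hπ (reals x) i
    have e2 := GaussAlg.projection_apply hπ (imags x) i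
    rw [hr1] at e1
    rw [hr2] at e2
    have : x i = ∑ j, x j * (t i j : ℂ) := by
      refine Complex.ext ?_ ?_
      · simp only [Complex.re_sum, Complex.re_mul_ofReal]; exact e1
      · simp only [Complex.im_sum, Complex.im_mul_ofReal]; exact e2
    rw [this, Finset.sum_apply]
    exact Finset.sum_congr rfl fun j _ => by simp [cx, hsym i j]
  have hmem : ∀ c : Fin n → ℂ,
      (0, (Complex.I • ∑ i, c i • cx (y i), ∑ i, c i • cx (t i))) ∈ S := fun c => by
    have := S.sum_mem fun i (_ : i ∈ Finset.univ) => S.smul_mem (c i) (hy i)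
    convert this using 1
    refine Prod.ext (Subsingleton.elim _ _) (Prod.ext ?_ ?_)
    · simp only [Prod.snd_sum, Prod.fst_sum, Prod.smul_snd, Prod.smul_fst, Finset.smul_sum,
        smul_comm Complex.I]
    · simp only [Prod.snd_sum, Prod.smul_snd]; rfl
  have hN : ∀ i j, y i ⬝ᵥ t j = y j ⬝ᵥ t i := fun i j => by
    have := hS.isotropic _ (hy i) _ (hy j)
    rw [sympRel_state] at this
    simp only [smul_dotProduct, cx_dotProduct, smul_eq_mul] at this
    have := mul_left_cancel₀ Complex.I_ne_zero (sub_eq_zero.1 this)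
    exact_mod_cast this
  have hdot : ∀ c d : Fin n → ℂ, (∑ i, c i • cx (y i)) ⬝ᵥ (∑ i, d i • cx (t i)) =
      ∑ i, ∑ j, c i * d j * ((y i ⬝ᵥ t j : ℝ) : ℂ) := fun c d => by
    simp only [sum_dotProduct, dotProduct_sum, smul_dotProduct, dotProduct_smul, cx_dotProduct,
      smul_eq_mul, Finset.mul_sum]
    rw [Finset.sum_comm]
    exact Finset.sum_congr rfl fun i _ => Finset.sum_congr rfl fun j _ => by ring
  obtain ⟨L, hL⟩ := exists_gram hN fun c => by
    -- On real combinations of the `(i y i, t i)` the positivity form is twice the quadratic form of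
    -- the matrix.
    have h := hq.1 _ (hmem fun i => (c i : ℂ))
    have e := hdot (fun i => (c i : ℂ)) (fun i => (c i : ℂ))
    have e1 : (∑ i, (c i : ℂ) • cx (y i)) = cx (∑ i, c i • y i) := by ext; simp [cx]
    have e2 : (∑ i, (c i : ℂ) • cx (t i)) = cx (∑ i, c i • t i) := by ext; simp [cx]
    have hst : ∀ v : Fin n → ℝ, star (cx v) = cx v := fun v => by ext; simp [cx]
    rw [e1, e2] at h e
    rw [sympRel_state] at h
    change 0 ≤ Complex.I * (star (Complex.I • cx _) ⬝ᵥ cx _ - Complex.I • cx _ ⬝ᵥ star (cx _)) at h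
    rw [star_smul, hst, hst, smul_dotProduct, smul_dotProduct, e] at h
    have : (0 : ℂ) ≤ 2 * ((∑ i, ∑ j, c i * c j * (y i ⬝ᵥ t j) : ℝ) : ℂ) := by
      refine h.trans_eq ?_
      push_cast
      simp only [smul_eq_mul, Complex.star_def, Complex.conj_I]
      linear_combination (-2 * ∑ i, ∑ j, (c i : ℂ) * c j * ((y i ⬝ᵥ t j : ℝ) : ℂ)) * Complex.I_mul_I
    have : (0 : ℝ) ≤ 2 * ∑ i, ∑ j, c i * c j * (y i ⬝ᵥ t j) := by exact_mod_cast this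
    linarith
  refine ⟨L, F.val, ?_⟩
  have hle : ∀ p ∈ S, p ∈ gaussSub L F.val := fun p hp => by
    have h1 : ∀ b ∈ F.val, cx b ⬝ᵥ p.2.2 = 0 := fun b hb => by
      have := hS.isotropic _ (hFD b hb) _ hp
      rw [sympRel_state] at this
      simpa using this
    refine ⟨h1, mem_span_of_dotProduct _ _ fun w hw => ?_⟩
    have hw := hxt w fun b hb => hw _ (cx_mem_cspan hb)
    have := hS.isotropic _ hp _ (hmem w)
    rw [sympRel_state, ← hw] at this
    simp only [smul_dotProduct] at this
    rw [sub_dotProduct, smul_dotProduct, cov_dotProduct_comm, hL, ← hdot, ← hxt _ h1]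
    exact this
  -- One inclusion suffices: elements of `gaussSub` are symplectically orthogonal to `S`, which
  -- contains its own orthogonal.
  refine le_antisymm hle fun p hp => (isLagrangian_iff.1 hS p).2 fun q hq => ?_
  exact (isLagrangian_gaussSub L F.val).isotropic _ hp _ (hle q hq)

theorem exists_gauss {R : Set (Phase ℂ 0 × Phase ℂ n)} (h : IsQuasiReal R) :
    R = ∅ ∨ ∃ L K a, R = gauss L K a := by
  refine h.imp id ?_
  rintro ⟨S, a, hS, hq, -, ha, rfl⟩
  obtain ⟨L, K, rfl⟩ := exists_gaussSub hS hq
  refine ⟨L, K, reals a.2.1, ?_⟩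
  rw [gauss_eq]
  have : a = (0, (cx (reals a.2.1), 0)) :=
    Prod.ext (Subsingleton.elim _ _) (Prod.ext (funext fun j => Complex.ext rfl (ha.1 j)) ha.2)
  rw [← this]

theorem sem_surjective (n : ℕ) : Function.Surjective (sem (n := 0) (m := n)) := fun R => by
  obtain h | ⟨L, K, a, h⟩ := exists_gauss R.2
  · exact ⟨_, graph_injective ((den_bot n).trans h.symm)⟩
  · exact ⟨_, graph_injective ((den_nf L K a).trans h.symm)⟩

/-- The isomorphism of graphical Gaussian algebra with Gaussian relations. -/
noncomputable def iso : CompactProp.Iso GGA GaussRel where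
  equiv n m := Equiv.ofBijective sem
    (bijective_sem (fun n => ⟨sem_injective n, sem_surjective n⟩) n m)
  map_id := sem_id
  map_comp := sem_comp
  map_tensor := sem_tensor
  map_symm := sem_symm
  map_cup := sem_cup
  map_cap := sem_cap

end GaussRel

theorem mainTheorem2 :
    ∃ F : CompactProp.Iso GGA GaussRel,
      ∀ (n m : ℕ) (g : GGA.Gen n m),
        GaussRel.graph (F.equiv n m (GGA.arrow g)) = GGA.interp g := by
  exact ⟨GaussRel.iso, fun _ _ _ => rfl⟩
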